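/- Let $S^1=\mathbb R/2\pi\mathbb Z$ with quotient metric $d$, let $f:S^1\to S^1$ and $\sigma:S^1\to(0,\infty)$ be $C^\infty$, and let $\chi$ be a standard normal random variable. Suppose that $f$ has fixed points $x_s,x_u$ with $c_s:=f'(x_s)\in(-1,1)$ and $f'(x_u)\notin[-1,1]$, and that $f^n(x)\to x_s$ as $n\to\infty$ for every $x\neq x_u$. Put $\alpha=\sqrt{(1-c_s^2)/(2\sigma(x_s)^2)}$ and $h_j(x)=e^{-x^2}H_j(x)$, where $H_j$ is the $j$-th (physicists') Hermite polynomial. Let $V_3=\{x: d(x,x_s)<\delta_s\}$ be a neighbourhood of $x_s$ not containing $x_u$ such that, for some $\eta>0$, $d(f(x),S^1\setminus V_3)>\eta$ for all $x\in V_3$. For $\varepsilon>0$ let $T_{33}^\varepsilon$ be the operator on the space $B(V_3)$ of bounded (complex-valued) Borel functions on $V_3$ given by $$T_{33}^\varepsilon\phi(x)=\mathbb E\big[(\phi\mathbf 1_{V_3})(f(x)+\varepsilon\sigma(x)\chi \bmod 2\pi)\big],\qquad x\in V_3 .$$ An eigendensity of $T_{33}^\varepsilon$ for $\lambda$ is an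 integrable function $\phi$ on $V_3$, not a.e. zero, with $\int_{V_3}(T_{33}^\varepsilon g)\,\phi\,dx=\lambda\int_{V_3} g\,\phi\,dx$ for all $g\in B(V_3)$; eigendensities are identified when they agree a.e. Theorem 4. There is $k>0$ such that for every $r>0$ there exist $\varepsilon_{s,r},L_{s,r},K_{s,r}>0$ with the following property. For every $0<\varepsilon<\varepsilon_{s,r}$ there are numbers $\lambda^\varepsilon_{s,j,1}\in\mathbb C$ and functions $\psi^\varepsilon_{s,j}:\mathbb R\to\mathbb C$ $(j\ge 0)$ with $$|\lambda^\varepsilon_{s,j,1}|\le L_{s,r},\qquad \sup_{x\in\mathbb R}|\psi^\varepsilon_{s,j}(x)|e^{kx^2}\le K_{s,r}\qquad\text{for all } j\ge 0,$$ such that every eigenvalue of $T_{33}^\varepsilon$ in $B(V_3)$ with modulus greater than $r$ is simple (has algebraic multiplicity one) and equals $$\lambda^\varepsilon_{s,j}=c_s^j+\varepsilon\lambda^\varepsilon_{s,j,1}$$ for some $j\ge0$; and, whenever $\lambda^\varepsilon_{s,j}$ is an eigenvalue of $T_{33}^\varepsilon$ with modulus greater than $r$, every eigendensity of $T_{33}^\varepsilon$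 for $\lambda^\varepsilon_{s,j}$ is a scalar multiple of $$\Big[h_j\Big(\frac{\alpha(x-x_s)}{\varepsilon}\Big)+\varepsilon\,\psi^\varepsilon_{s,j}\Big(\frac{x-x_s}{\varepsilon}\Big)\Big]\mathbf 1_{V_3}(x),$$ where $x-x_s$ denotes the representative in $(-\pi,\pi]$. -/

import Mathlib

open MeasureTheory ProbabilityTheory Filter Topology
open scoped ContDiff

noncomputable section

instance fact_two_pi_pos : Fact (0 < 2 * Real.pi) := ⟨Real.two_pi_pos⟩

/-- The circle `ℝ / 2πℤ`, with its quotient metric and its arc-length measure. -/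
abbrev S1 : Type := AddCircle (2 * Real.pi)

/-- The representative in `(-π, π]` of `x - x₀`. -/
def displacement (x₀ x : S1) : ℝ :=
  (AddCircle.equivIoc (2 * Real.pi) (-Real.pi) (x - x₀) : ℝ)

/-- The physicists' Hermite polynomial `H_n`, expressed through the probabilists' one:
`H_n(x) = 2^{n/2} He_n(√2 x)`. -/
def hermiteH (n : ℕ) (x : ℝ) : ℝ :=
  Real.sqrt 2 ^ n * Polynomial.aeval (Real.sqrt 2 * x) (Polynomial.hermite n)

/-- The Hermite function `h_n(x) = exp(-x²) H_n(x)`. -/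
def hermiteFun (n : ℕ) (x : ℝ) : ℝ := Real.exp (-x ^ 2) * hermiteH n x

/-- `B(V)`: the (complex) vector space of bounded Borel functions on `V`. -/
def BddMeas (V : Set S1) : Submodule ℂ (V → ℂ) where
  carrier := {φ | Measurable φ ∧ ∃ C : ℝ, ∀ x, ‖φ x‖ ≤ C}
  add_mem' := by
    rintro φ ψ ⟨hφ, C, hC⟩ ⟨hψ, D, hD⟩
    exact ⟨hφ.add hψ, C + D, fun x => (norm_add_le _ _).trans (add_le_add (hC x) (hD x))⟩
  zero_mem' := ⟨measurable_const, 0, fun x => by simp⟩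
  smul_mem' := by
    rintro c φ ⟨hφ, C, hC⟩
    refine ⟨hφ.const_smul c, ‖c‖ * C, fun x => ?_⟩
    rw [Pi.smul_apply, norm_smul]
    exact mul_le_mul_of_nonneg_left (hC x) (norm_nonneg c)

/-- Extension by zero, i.e. `φ 𝟏_V`. -/
def extendZero (V : Set S1) (φ : V → ℂ) : S1 → ℂ := Function.extend Subtype.val φ 0

/-- The transition operator `φ ↦ 𝔼[φ(f(x) + ε σ(x) χ mod 2π)]`, `χ` standard normal. -/
def transition (f : C(S1, S1)) (σ : C(S1, ℝ)) (ε : ℝ) (φ : S1 → ℂ) (x : S1) : ℂ :=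
  ∫ z : ℝ, φ (f x + ((ε * σ x * z : ℝ) : S1)) ∂(gaussianReal 0 1)

lemma extendZero_apply (V : Set S1) (φ : V → ℂ) (x : V) : extendZero V φ x = φ x :=
  Subtype.val_injective.extend_apply φ 0 x

lemma extendZero_of_notMem (V : Set S1) (φ : V → ℂ) {x : S1} (hx : x ∉ V) :
    extendZero V φ x = 0 := by
  refine Function.extend_apply' _ _ _ ?_
  rintro ⟨a, rfl⟩
  exact hx a.2

lemma extendZero_measurable {V : Set S1} (hV : MeasurableSet V) {φ : V → ℂ}
    (hφ : Measurable φ) : Measurable (extendZero V φ) :=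
  (MeasurableEmbedding.subtype_coe hV).measurable_extend hφ measurable_const

lemma extendZero_bound {V : Set S1} {φ : V → ℂ} {C : ℝ} (hC : ∀ x, ‖φ x‖ ≤ C) (x : S1) :
    ‖extendZero V φ x‖ ≤ |C| := by
  by_cases hx : x ∈ V
  · rw [extendZero_apply V φ ⟨x, hx⟩]
    exact (hC _).trans (le_abs_self C)
  · rw [extendZero_of_notMem V φ hx]
    simp

lemma extendZero_add (V : Set S1) (φ ψ : V → ℂ) (x : S1) :
    extendZero V (φ + ψ) x = extendZero V φ x + extendZero V ψ x := by
  by_cases hx : x ∈ V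
  · have h := fun g => extendZero_apply V g ⟨x, hx⟩
    simp only at h
    rw [h, h, h, Pi.add_apply]
  · simp [extendZero_of_notMem V _ hx]

lemma extendZero_smul (V : Set S1) (c : ℂ) (φ : V → ℂ) (x : S1) :
    extendZero V (c • φ) x = c * extendZero V φ x := by
  by_cases hx : x ∈ V
  · have h := fun g => extendZero_apply V g ⟨x, hx⟩
    simp only at h
    rw [h, h, Pi.smul_apply, smul_eq_mul]
  · simp [extendZero_of_notMem V _ hx]

lemma measurable_noise (f : C(S1, S1)) (σ : C(S1, ℝ)) (ε : ℝ) :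
    Measurable (fun q : S1 × ℝ => f q.1 + ((ε * σ q.1 * q.2 : ℝ) : S1)) := by
  refine Continuous.measurable ?_
  have h : Continuous (fun t : ℝ => (t : S1)) := AddCircle.continuous_mk' _
  exact (f.continuous.comp continuous_fst).add (h.comp (by fun_prop))

lemma transition_integrable (f : C(S1, S1)) (σ : C(S1, ℝ)) (ε : ℝ) {V : Set S1}
    (hV : MeasurableSet V) (φ : BddMeas V) (x : S1) :
    Integrable (fun z : ℝ => extendZero V φ.1 (f x + ((ε * σ x * z : ℝ) : S1)))
      (gaussianReal 0 1) := by
  obtain ⟨hφ, C, hC⟩ := φ.2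
  refine Integrable.of_bound (C := |C|) ?_ (Eventually.of_forall fun z => extendZero_bound hC _)
  exact ((extendZero_measurable hV hφ).comp
    ((measurable_noise f σ ε).comp measurable_prodMk_left)).aestronglyMeasurable

lemma transition_mem (f : C(S1, S1)) (σ : C(S1, ℝ)) (ε : ℝ) {V : Set S1}
    (hV : MeasurableSet V) (φ : BddMeas V) :
    (fun x : V => transition f σ ε (extendZero V φ.1) x) ∈ BddMeas V := by
  obtain ⟨hφ, C, hC⟩ := φ.2
  constructor
  · have h : StronglyMeasurable (Function.uncurry fun (x : S1) (z : ℝ) =>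
        extendZero V φ.1 (f x + ((ε * σ x * z : ℝ) : S1))) :=
      ((extendZero_measurable hV hφ).comp (measurable_noise f σ ε)).stronglyMeasurable
    exact (h.integral_prod_right (ν := gaussianReal 0 1)).measurable.comp measurable_subtype_coe
  · refine ⟨|C|, fun x => ?_⟩
    refine (norm_integral_le_of_norm_le_const (C := |C|)
      (Eventually.of_forall fun z => extendZero_bound hC _)).trans ?_
    simp

/-- The diagonal block of the transition operator on `B(V)`:
`φ ↦ 𝟏_V(x) 𝔼[(φ 𝟏_V)(f(x) + ε σ(x) χ mod 2π)]`. -/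
def localBlock (f : C(S1, S1)) (σ : C(S1, ℝ)) (ε : ℝ) (V : Set S1) (hV : MeasurableSet V) :
    Module.End ℂ (BddMeas V) where
  toFun φ := ⟨fun x : V => transition f σ ε (extendZero V φ.1) x, transition_mem f σ ε hV φ⟩
  map_add' φ ψ := by
    ext x
    have h := integral_add (transition_integrable f σ ε hV φ x)
      (transition_integrable f σ ε hV ψ x)
    simp only [transition, Submodule.coe_add, Pi.add_apply, extendZero_add]
    exact h
  map_smul' c φ := by
    ext x
    simp only [transition, Submodule.coe_smul, Pi.smul_apply, extendZero_smul,
      RingHom.id_apply, smul_eq_mul]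
    exact integral_const_mul c _

/-- `μ` is an eigenvalue of algebraic multiplicity one. -/
def IsSimpleEigenvalue {V : Set S1} (T : Module.End ℂ (BddMeas V)) (μ : ℂ) : Prop :=
  T.HasEigenvalue μ ∧ Module.finrank ℂ (T.maxGenEigenspace μ) = 1

/-- Arc length on `V`. -/
def arcMeasure (V : Set S1) : Measure V := (volume : Measure S1).comap Subtype.val

/-- `φ` is the density, with respect to arc length on `V`, of an eigenmeasure `m = φ dx` of `T`
for `μ`, i.e. `m ≠ 0` and `m T = μ m`, where `m T` is given by `∫ g d(mT) = ∫ T g dm`. -/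
def IsEigendensity {V : Set S1} (T : Module.End ℂ (BddMeas V)) (μ : ℂ) (φ : V → ℂ) : Prop :=
  Integrable φ (arcMeasure V) ∧ ¬ (φ =ᵐ[arcMeasure V] 0) ∧
    ∀ g : BddMeas V,
      ∫ x, (T g).1 x * φ x ∂(arcMeasure V) = μ * ∫ x, g.1 x * φ x ∂(arcMeasure V)

/-- The diagonal block on the arc `B_δ(x₀)`. -/
def arcBlock (f : C(S1, S1)) (σ : C(S1, ℝ)) (ε : ℝ) (x₀ : S1) (δ : ℝ) :
    Module.End ℂ (BddMeas (Metric.ball x₀ δ)) :=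
  localBlock f σ ε (Metric.ball x₀ δ) measurableSet_ball

end

/-- A bounded operator `A₀` with finitely many biorthogonal eigenvectors and eigenfunctionals,
whose `n`-th power is small on the complement of the corresponding spectral projection. -/
structure SpectralModel {ι X : Type*} [Fintype ι] [NormedAddCommGroup X] [NormedSpace ℂ X]
    (A₀ : X →L[ℂ] X) (lam : ι → ℂ) (e : ι → X) (l : ι → X →L[ℂ] ℂ) (M r : ℝ) (n : ℕ) :
    Prop where
  eig : ∀ i, A₀ (e i) = lam i • e i
  coeig : ∀ i g, l i (A₀ g) = lam i * l i g
  biorth_self : ∀ i, l i (e i) = 1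
  biorth : ∀ i k, i ≠ k → l i (e k) = 0
  one_le : 1 ≤ M
  norm_op : ‖A₀‖ ≤ M
  norm_vec : ∀ i, ‖e i‖ ≤ M
  norm_fun : ∀ i, ‖l i‖ ≤ M
  power : ∀ g, ‖(A₀ ^ n) (g - ∑ i, l i g • e i)‖ ≤ r ^ n / 2 * ‖g‖

/-- The transpose of a bounded operator. -/
noncomputable def dualOperator {X : Type*} [NormedAddCommGroup X] [NormedSpace ℂ X]
    (A : X →L[ℂ] X) : (X →L[ℂ] ℂ) →L[ℂ] (X →L[ℂ] ℂ) :=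
  (ContinuousLinearMap.compL ℂ X X ℂ).flip A

section Abstract

variable {ι X : Type*} [Fintype ι] [NormedAddCommGroup X] [NormedSpace ℂ X]

lemma dualOperator_apply (A : X →L[ℂ] X) (F : X →L[ℂ] ℂ) (g : X) :
    dualOperator A F g = F (A g) := rfl

lemma norm_dualOperator_le (A : X →L[ℂ] X) : ‖dualOperator A‖ ≤ ‖A‖ := by
  refine ContinuousLinearMap.opNorm_le_bound _ (norm_nonneg _) fun F => ?_
  rw [mul_comm]
  exact ContinuousLinearMap.opNorm_comp_le F A

lemma dualOperator_sub (A B : X →L[ℂ] X) :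
    dualOperator A - dualOperator B = dualOperator (A - B) := by
  ext F g
  simp [dualOperator_apply]

set_option synthInstance.maxHeartbeats 200000 in
lemma dualOperator_pow_apply (A : X →L[ℂ] X) (n : ℕ) (F : X →L[ℂ] ℂ) (g : X) :
    (dualOperator A ^ n) F g = F ((A ^ n) g) := by
  induction n generalizing F with
  | zero => simp
  | succ n ih =>
    rw [pow_succ, mul_apply_eq_comp, ih, dualOperator_apply, pow_succ',
      mul_apply_eq_comp]

variable {A₀ : X →L[ℂ] X} {lam : ι → ℂ} {e : ι → X} {l : ι → X →L[ℂ] ℂ} {M r : ℝ} {n : ℕ}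

namespace SpectralModel

lemma fun_sub_proj (h : SpectralModel A₀ lam e l M r n) (i : ι) (g : X) :
    l i (g - ∑ k, l k g • e k) = 0 := by
  classical
  rw [map_sub, map_sum, Finset.sum_eq_single i]
  · simp [h.biorth_self]
  · intro k _ hk
    simp [h.biorth i k hk.symm]
  · simp

lemma pow_vec (h : SpectralModel A₀ lam e l M r n) (m : ℕ) (i : ι) :
    (A₀ ^ m) (e i) = lam i ^ m • e i := by
  induction m with
  | zero => simp
  | succ m ih =>
    rw [pow_succ, mul_apply_eq_comp, h.eig, map_smul, ih, smul_smul, pow_succ']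

lemma fun_pow (h : SpectralModel A₀ lam e l M r n) (m : ℕ) (i : ι) (g : X) :
    l i ((A₀ ^ m) g) = lam i ^ m * l i g := by
  induction m generalizing g with
  | zero => simp
  | succ m ih =>
    rw [pow_succ, mul_apply_eq_comp, ih, h.coeig, pow_succ]
    ring

set_option synthInstance.maxHeartbeats 200000 in
lemma dual (h : SpectralModel A₀ lam e l M r n) :
    SpectralModel (dualOperator A₀) lam l (fun i => ContinuousLinearMap.apply ℂ ℂ (e i)) M r n where
  eig i := by
    ext g
    simp [dualOperator_apply, h.coeig]
  coeig i F := by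
    simp [dualOperator_apply, h.eig]
  biorth_self i := by simp [h.biorth_self]
  biorth i k hik := by simp [h.biorth k i hik.symm]
  one_le := h.one_le
  norm_op := (norm_dualOperator_le _).trans h.norm_op
  norm_vec := h.norm_fun
  norm_fun i := by
    refine ContinuousLinearMap.opNorm_le_bound _ (zero_le_one.trans h.one_le) fun F => ?_
    rw [ContinuousLinearMap.apply_apply, mul_comm]
    exact (F.le_opNorm _).trans (mul_le_mul_of_nonneg_left (h.norm_vec i) (norm_nonneg _))
  power F := by
    have key : ∀ g, (dualOperator A₀ ^ n)
        (F - ∑ i, ContinuousLinearMap.apply ℂ ℂ (e i) F • l i) g =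
          F ((A₀ ^ n) (g - ∑ i, l i g • e i)) := by
      intro g
      rw [dualOperator_pow_apply]
      simp only [sub_apply, sum_apply,
        smul_apply, ContinuousLinearMap.apply_apply, smul_eq_mul, h.fun_pow,
        map_sub, map_sum, map_smul, h.pow_vec]
      congr 1
      refine Finset.sum_congr rfl fun i _ => ?_
      ring
    have hr : 0 ≤ r ^ n / 2 * ‖F‖ := by
      by_cases hF : ∃ g : X, g ≠ 0
      · obtain ⟨g, hg⟩ := hF
        have := (norm_nonneg _).trans (h.power g)
        exact mul_nonneg (nonneg_of_mul_nonneg_left this (norm_pos_iff.2 hg)) (norm_nonneg _)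
      · push Not at hF
        have : F = 0 := by
          ext g
          simp [hF g]
        simp [this]
    refine ContinuousLinearMap.opNorm_le_bound _ hr fun g => ?_
    rw [key]
    refine (F.le_opNorm _).trans ?_
    calc ‖F‖ * ‖(A₀ ^ n) (g - ∑ i, l i g • e i)‖ ≤ ‖F‖ * (r ^ n / 2 * ‖g‖) :=
          mul_le_mul_of_nonneg_left (h.power g) (norm_nonneg _)
      _ = _ := by ring

/-- Resolvent bound on the joint kernel of the eigenfunctionals. -/
lemma resolvent_bound_ker (h : SpectralModel A₀ lam e l M r n) (hr : 0 < r) {μ : ℂ} (hμ : r < ‖μ‖)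
    {g : X} (hg : ∀ i, l i g = 0) :
    ‖g‖ ≤ 2 * (∑ k ∈ Finset.range n, M ^ k / r ^ (k + 1)) * ‖A₀ g - μ • g‖ := by
  have hM : 0 ≤ M := zero_le_one.trans h.one_le
  have hpow : ∀ m (x : X), ‖(A₀ ^ m) x‖ ≤ M ^ m * ‖x‖ := by
    intro m
    induction m with
    | zero => simp
    | succ m ih =>
      intro x
      rw [pow_succ, mul_apply_eq_comp, pow_succ, mul_assoc]
      exact (ih _).trans (mul_le_mul_of_nonneg_left
        ((A₀.le_opNorm x).trans (mul_le_mul_of_nonneg_right h.norm_op (norm_nonneg _)))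
          (pow_nonneg hM _))
  have key : ∀ m, ‖(A₀ ^ m) g - μ ^ m • g‖ ≤
      ‖μ‖ ^ m * ((∑ k ∈ Finset.range m, M ^ k / r ^ (k + 1)) * ‖A₀ g - μ • g‖) := by
    intro m
    induction m with
    | zero => simp
    | succ m ih =>
      have : (A₀ ^ (m + 1)) g - μ ^ (m + 1) • g =
          (A₀ ^ m) (A₀ g - μ • g) + μ • ((A₀ ^ m) g - μ ^ m • g) := by
        rw [pow_succ, mul_apply_eq_comp, map_sub, map_smul, smul_sub, smul_smul,
          pow_succ']
        abel
      rw [this, Finset.sum_range_succ, add_mul, mul_add, add_comm]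
      refine (norm_add_le _ _).trans (add_le_add ?_ ?_)
      · rw [norm_smul, pow_succ', mul_assoc]
        exact mul_le_mul_of_nonneg_left ih (norm_nonneg _)
      · refine (hpow m _).trans ?_
        rw [← mul_assoc]
        refine mul_le_mul_of_nonneg_right ?_ (norm_nonneg _)
        rw [mul_div_assoc', le_div_iff₀ (by positivity), mul_comm]
        exact mul_le_mul_of_nonneg_right (pow_le_pow_left₀ hr.le hμ.le _) (by positivity)
  have h1 := key n
  have h2 := h.power g
  simp only [hg, zero_smul, Finset.sum_const_zero, sub_zero] at h2
  set S := ∑ k ∈ Finset.range n, M ^ k / r ^ (k + 1)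
  have h3 : ‖μ‖ ^ n * ‖g‖ ≤ ‖(A₀ ^ n) g‖ + ‖(A₀ ^ n) g - μ ^ n • g‖ := by
    rw [← norm_pow, ← norm_smul]
    have := norm_sub_norm_le (μ ^ n • g) ((A₀ ^ n) g)
    rw [norm_sub_rev] at this
    linarith
  have h4 : r ^ n ≤ ‖μ‖ ^ n := pow_le_pow_left₀ hr.le hμ.le _
  have h5 : 0 < ‖μ‖ ^ n := pow_pos (hr.trans hμ) _
  have h6 : ‖μ‖ ^ n * ‖g‖ ≤ ‖μ‖ ^ n * (‖g‖ / 2 + S * ‖A₀ g - μ • g‖) := by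
    have := mul_le_mul_of_nonneg_right h4 (norm_nonneg g)
    nlinarith
  have h7 := le_of_mul_le_mul_left h6 h5
  linarith

lemma resolvent_bound (h : SpectralModel A₀ lam e l M r n) (hr : 0 < r) {μ : ℂ} (hμ : r < ‖μ‖)
    (g : X) :
    ‖g - ∑ i, l i g • e i‖ ≤ 2 * (∑ k ∈ Finset.range n, M ^ k / r ^ (k + 1)) *
      (1 + Fintype.card ι * M ^ 2) * ‖A₀ g - μ • g‖ := by
  have hM : 0 ≤ M := zero_le_one.trans h.one_le
  have h1 := h.resolvent_bound_ker hr hμ (fun i => h.fun_sub_proj i g)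
  refine h1.trans ?_
  rw [mul_assoc _ _ ‖A₀ g - μ • g‖]
  refine mul_le_mul_of_nonneg_left ?_ (by positivity)
  set y := A₀ g - μ • g with hy
  have h2 : A₀ (g - ∑ i, l i g • e i) - μ • (g - ∑ i, l i g • e i) = y - ∑ i, l i y • e i := by
    simp only [hy, map_sub, map_sum, map_smul, h.eig, h.coeig, smul_sub, Finset.smul_sum,
      smul_eq_mul, sub_smul, Finset.sum_sub_distrib, mul_smul]
    have : ∑ i, l i g • lam i • e i = ∑ i, lam i • l i g • e i :=
      Finset.sum_congr rfl fun i _ => smul_comm _ _ _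
    rw [this]
    abel
  rw [h2]
  refine (norm_sub_le _ _).trans ?_
  rw [add_mul, one_mul]
  refine add_le_add le_rfl ((norm_sum_le _ _).trans ?_)
  have : ∀ i ∈ Finset.univ, ‖l i y • e i‖ ≤ M ^ 2 * ‖y‖ := by
    intro i _
    rw [norm_smul]
    calc ‖l i y‖ * ‖e i‖ ≤ (M * ‖y‖) * M :=
          mul_le_mul (((l i).le_opNorm y).trans
            (mul_le_mul_of_nonneg_right (h.norm_fun i) (norm_nonneg _))) (h.norm_vec i)
            (norm_nonneg _) (by positivity)
      _ = _ := by ring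
  refine (Finset.sum_le_card_nsmul _ _ _ this).trans ?_
  rw [nsmul_eq_mul, Finset.card_univ, mul_assoc]

lemma norm_fun_apply_le (h : SpectralModel A₀ lam e l M r n) (i : ι) (g : X) :
    ‖l i g‖ ≤ M * ‖g‖ :=
  ((l i).le_opNorm g).trans (mul_le_mul_of_nonneg_right (h.norm_fun i) (norm_nonneg _))

lemma fun_residual (h : SpectralModel A₀ lam e l M r n) (i : ι) (μ : ℂ) (g : X) :
    l i (A₀ g - μ • g) = (lam i - μ) * l i g := by
  rw [map_sub, map_smul, h.coeig, smul_eq_mul]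
  ring

lemma norm_fun_le_of_gap (h : SpectralModel A₀ lam e l M r n) {i : ι} {μ : ℂ} {d : ℝ}
    (hd : 0 < d) (hi : d ≤ ‖lam i - μ‖) (g : X) :
    ‖l i g‖ ≤ M / d * ‖A₀ g - μ • g‖ := by
  have h1 := h.norm_fun_apply_le i (A₀ g - μ • g)
  rw [h.fun_residual, norm_mul] at h1
  rw [div_mul_eq_mul_div, le_div_iff₀ hd, mul_comm]
  exact (mul_le_mul_of_nonneg_right hi (norm_nonneg _)).trans h1

/-- If `μ` is away from all eigenvalues but `lam i`, then the residual controls the distance of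
`g` to the line through `e i`. -/
lemma dist_line_le (h : SpectralModel A₀ lam e l M r n) (hr : 0 < r) {μ : ℂ} (hμ : r < ‖μ‖)
    {d : ℝ} (hd : 0 < d) {i : ι} (hi : ∀ k, k ≠ i → d ≤ ‖lam k - μ‖) (g : X) :
    ‖g - l i g • e i‖ ≤ (2 * (∑ k ∈ Finset.range n, M ^ k / r ^ (k + 1)) *
      (1 + Fintype.card ι * M ^ 2) + Fintype.card ι * (M ^ 2 / d)) * ‖A₀ g - μ • g‖ := by
  classical
  have hM : 0 ≤ M := zero_le_one.trans h.one_le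
  have h1 := h.resolvent_bound hr hμ g
  have h2 : g - l i g • e i = (g - ∑ k, l k g • e k) + ∑ k ∈ Finset.univ.erase i, l k g • e k := by
    rw [← Finset.add_sum_erase _ _ (Finset.mem_univ i)]
    abel
  rw [h2, add_mul]
  refine (norm_add_le _ _).trans (add_le_add h1 ((norm_sum_le _ _).trans ?_))
  have : ∀ k ∈ Finset.univ.erase i, ‖l k g • e k‖ ≤ M ^ 2 / d * ‖A₀ g - μ • g‖ := by
    intro k hk
    rw [norm_smul]
    calc ‖l k g‖ * ‖e k‖ ≤ (M / d * ‖A₀ g - μ • g‖) * M :=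
          mul_le_mul (h.norm_fun_le_of_gap hd (hi k (Finset.ne_of_mem_erase hk)) g)
            (h.norm_vec k) (norm_nonneg _) (by positivity)
      _ = _ := by ring
  refine (Finset.sum_le_card_nsmul _ _ _ this).trans ?_
  rw [nsmul_eq_mul, mul_assoc]
  refine mul_le_mul_of_nonneg_right ?_ (by positivity)
  exact_mod_cast Finset.card_le_univ _

end SpectralModel

end Abstract

lemma exists_gap {ι : Type*} [Fintype ι] {lam : ι → ℂ} (hinj : Function.Injective lam) :
    ∃ d > (0 : ℝ), ∀ i k, i ≠ k → d ≤ ‖lam i - lam k‖ := by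
  classical
  obtain ⟨d, hd, h⟩ : ∃ d > (0 : ℝ), ∀ p : ι × ι, p.1 ≠ p.2 → d ≤ ‖lam p.1 - lam p.2‖ := by
    have : ∀ p : ι × ι, ∃ d > (0 : ℝ), p.1 ≠ p.2 → d ≤ ‖lam p.1 - lam p.2‖ := by
      intro p
      by_cases hp : p.1 = p.2
      · exact ⟨1, one_pos, fun h => absurd hp h⟩
      · exact ⟨_, norm_pos_iff.2 (sub_ne_zero.2 (hinj.ne hp)), fun _ => le_rfl⟩
    choose D hD h using this
    rcases isEmpty_or_nonempty (ι × ι) with hE | hE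
    · exact ⟨1, one_pos, fun p => hE.elim p⟩
    · obtain ⟨p₀, hp₀⟩ := Finite.exists_min D
      exact ⟨D p₀, hD p₀, fun p hp => (hp₀ p).trans (h p hp)⟩
  exact ⟨d, hd, fun i k hik => h (i, k) hik⟩

namespace SpectralModel

variable {ι X : Type*} [Fintype ι] [NormedAddCommGroup X] [NormedSpace ℂ X]
  {A₀ : X →L[ℂ] X} {lam : ι → ℂ} {e : ι → X} {l : ι → X →L[ℂ] ℂ} {M r : ℝ} {n : ℕ}

lemma exists_near_eigenvalue (h : SpectralModel A₀ lam e l M r n) (hr : 0 < r) {C η : ℝ}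
    (hC : 0 < C) (hCη : C * η ≤ 1 / 4)
    (hRC : 2 * (∑ k ∈ Finset.range n, M ^ k / r ^ (k + 1)) * (1 + Fintype.card ι * M ^ 2) ≤ C)
    (hKC : Fintype.card ι * (2 * M ^ 2) ≤ C) {μ : ℂ} (hμ : r < ‖μ‖) {g : X} (hg : g ≠ 0)
    (hres : ‖A₀ g - μ • g‖ ≤ η * ‖g‖) : ∃ i, ‖μ - lam i‖ ≤ C * η := by
  have hM0 : 0 ≤ M := zero_le_one.trans h.one_le
  have hgpos := norm_pos_iff.2 hg
  have hη : 0 ≤ η := nonneg_of_mul_nonneg_left ((norm_nonneg _).trans hres) hgpos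
  by_contra! hne
  have h1 : ‖g - ∑ i, l i g • e i‖ ≤ ‖g‖ / 4 := by
    refine (h.resolvent_bound hr hμ g).trans ?_
    calc _ ≤ C * (η * ‖g‖) := mul_le_mul hRC hres (norm_nonneg _) hC.le
      _ = (C * η) * ‖g‖ := by ring
      _ ≤ 1 / 4 * ‖g‖ := mul_le_mul_of_nonneg_right hCη hgpos.le
      _ = _ := by ring
  have h2 : ∀ i ∈ Finset.univ, ‖l i g • e i‖ ≤ M ^ 2 / C * ‖g‖ := by
    intro i _
    have h3 := h.norm_fun_apply_le i (A₀ g - μ • g)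
    rw [h.fun_residual, norm_mul, norm_sub_rev] at h3
    have h6 : ‖l i g‖ ≤ M * ‖g‖ / C := by
      by_contra! hlt
      have hpos : 0 < ‖l i g‖ := lt_of_le_of_lt (by positivity) hlt
      rw [div_lt_iff₀ hC] at hlt
      have h4 := mul_lt_mul_of_pos_right (hne i) hpos
      have h5 := mul_le_mul_of_nonneg_left hres hM0
      have h7 := mul_le_mul_of_nonneg_left hlt.le hη
      linarith
    rw [norm_smul]
    calc ‖l i g‖ * ‖e i‖ ≤ (M * ‖g‖ / C) * M :=
          mul_le_mul h6 (h.norm_vec i) (norm_nonneg _) (by positivity)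
      _ = _ := by ring
  have h3 : ‖∑ i, l i g • e i‖ ≤ ‖g‖ / 2 := by
    refine (norm_sum_le _ _).trans ((Finset.sum_le_card_nsmul _ _ _ h2).trans ?_)
    rw [nsmul_eq_mul, Finset.card_univ]
    have : Fintype.card ι * (M ^ 2 / C) ≤ 1 / 2 := by
      rw [mul_div_assoc', div_le_iff₀ hC]
      linarith
    calc Fintype.card ι * (M ^ 2 / C * ‖g‖) = (Fintype.card ι * (M ^ 2 / C)) * ‖g‖ := by ring
      _ ≤ 1 / 2 * ‖g‖ := mul_le_mul_of_nonneg_right this hgpos.le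
      _ = _ := by ring
  have h4 := norm_add_le (g - ∑ i, l i g • e i) (∑ i, l i g • e i)
  rw [sub_add_cancel] at h4
  linarith

lemma eigenvector_unique (h : SpectralModel A₀ lam e l M r n) (hr : 0 < r) {d η Q : ℝ}
    (hd : 0 < d) (hη : 0 ≤ η)
    (hQ : 2 * (∑ k ∈ Finset.range n, M ^ k / r ^ (k + 1)) * (1 + Fintype.card ι * M ^ 2) +
      Fintype.card ι * (M ^ 2 / d) ≤ Q) (hQη : Q * (2 * M ^ 2 + 1) * η ≤ 1 / 4)
    {A : X →L[ℂ] X} (hres : ∀ g, ‖A₀ g - A g‖ ≤ η * ‖g‖) {i : ι} {μ₁ μ₂ a : ℂ} {g₁ g₂ : X}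
    (hμ₁ : r < ‖μ₁‖) (hμ₂ : r < ‖μ₂‖) (hi₁ : ∀ k, k ≠ i → d ≤ ‖lam k - μ₁‖)
    (hi₂ : ∀ k, k ≠ i → d ≤ ‖lam k - μ₂‖) (hg₁ : g₁ ≠ 0) (hA₁ : A g₁ = μ₁ • g₁)
    (hA₂ : A g₂ = μ₂ • g₂ + a • g₁) : ∃ t : ℂ, g₂ = t • g₁ := by
  have hM0 : 0 ≤ M := zero_le_one.trans h.one_le
  have hQ0 : 0 ≤ Q := le_trans (by positivity) hQ
  have hp₁ := norm_pos_iff.2 hg₁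
  have hline : ∀ {μ : ℂ}, r < ‖μ‖ → (∀ k, k ≠ i → d ≤ ‖lam k - μ‖) → ∀ g,
      ‖g - l i g • e i‖ ≤ Q * ‖A₀ g - μ • g‖ := fun hμ hi g =>
    (h.dist_line_le hr hμ hd hi g).trans (mul_le_mul_of_nonneg_right hQ (norm_nonneg _))
  have hQη' : Q * η ≤ 1 / 4 := by
    have : 0 ≤ Q * (2 * M ^ 2) * η := by positivity
    linarith
  have hline₁ : ‖g₁ - l i g₁ • e i‖ ≤ 1 / 4 * ‖g₁‖ := by
    have hh : ‖A₀ g₁ - μ₁ • g₁‖ ≤ η * ‖g₁‖ := hA₁ ▸ hres g₁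
    calc _ ≤ _ := hline hμ₁ hi₁ g₁
      _ ≤ Q * (η * ‖g₁‖) := mul_le_mul_of_nonneg_left hh hQ0
      _ = Q * η * ‖g₁‖ := by ring
      _ ≤ _ := mul_le_mul_of_nonneg_right hQη' hp₁.le
  have hl₁ : ‖g₁‖ ≤ 2 * M * ‖l i g₁‖ := by
    have h1 := norm_add_le (g₁ - l i g₁ • e i) (l i g₁ • e i)
    rw [sub_add_cancel, norm_smul] at h1
    have h2 := mul_le_mul_of_nonneg_left (h.norm_vec i) (norm_nonneg (l i g₁))
    have h3 : 0 ≤ M * ‖l i g₁‖ := by positivity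
    linarith
  have hl₁' : l i g₁ ≠ 0 := by
    intro h0
    rw [h0, norm_zero, mul_zero] at hl₁
    linarith
  obtain ⟨t, ht⟩ : ∃ t, t * l i g₁ = l i g₂ := ⟨l i g₂ / l i g₁, div_mul_cancel₀ _ hl₁'⟩
  refine ⟨t, ?_⟩
  obtain ⟨g, hg⟩ : ∃ g, g = g₂ - t • g₁ := ⟨_, rfl⟩
  have hlg : l i g = 0 := by
    rw [hg, map_sub, map_smul, smul_eq_mul, ht, sub_self]
  obtain ⟨b, hb⟩ : ∃ b, b = a + t * (μ₂ - μ₁) := ⟨_, rfl⟩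
  have hAg : A g = μ₂ • g + b • g₁ := by
    rw [hg, hb, map_sub, map_smul, hA₂, hA₁]
    module
  suffices hz : ‖g‖ ≤ 0 by
    have := norm_le_zero_iff.1 hz
    rwa [hg, sub_eq_zero] at this
  have hbl : ‖b‖ * ‖l i g₁‖ ≤ M * (η * ‖g‖) := by
    have h1 : l i (A g - A₀ g) = b * l i g₁ := by
      rw [hAg, map_sub, h.coeig, hlg, map_add, map_smul, map_smul, hlg]
      simp
    rw [← norm_mul, ← h1]
    refine (h.norm_fun_apply_le i _).trans (mul_le_mul_of_nonneg_left ?_ hM0)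
    rw [norm_sub_rev]
    exact hres g
  have hbg : ‖b • g₁‖ ≤ 2 * M ^ 2 * η * ‖g‖ := by
    rw [norm_smul]
    calc ‖b‖ * ‖g₁‖ ≤ ‖b‖ * (2 * M * ‖l i g₁‖) := mul_le_mul_of_nonneg_left hl₁ (norm_nonneg _)
      _ = 2 * M * (‖b‖ * ‖l i g₁‖) := by ring
      _ ≤ 2 * M * (M * (η * ‖g‖)) := mul_le_mul_of_nonneg_left hbl (by positivity)
      _ = _ := by ring
  have hresid : ‖A₀ g - μ₂ • g‖ ≤ (2 * M ^ 2 + 1) * η * ‖g‖ := by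
    have h1 : A₀ g - μ₂ • g = (A₀ g - A g) + b • g₁ := by
      rw [hAg]
      abel
    rw [h1]
    refine (norm_add_le _ _).trans ?_
    linarith [hres g]
  have h1 := hline hμ₂ hi₂ g
  rw [hlg, zero_smul, sub_zero] at h1
  have h2 : ‖g‖ ≤ 1 / 4 * ‖g‖ := by
    calc ‖g‖ ≤ Q * ‖A₀ g - μ₂ • g‖ := h1
      _ ≤ Q * ((2 * M ^ 2 + 1) * η * ‖g‖) := mul_le_mul_of_nonneg_left hresid hQ0
      _ = Q * (2 * M ^ 2 + 1) * η * ‖g‖ := by ring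
      _ ≤ _ := mul_le_mul_of_nonneg_right hQη (norm_nonneg _)
  linarith

end SpectralModel

/-- Perturbation of the isolated simple eigenvalues of a `SpectralModel`, with constants that do
not depend on the space. -/
theorem SpectralModel.perturbation {ι : Type*} [Fintype ι] {lam : ι → ℂ}
    (hinj : Function.Injective lam) (M : ℝ) {r : ℝ} (hr : 0 < r) (n : ℕ) :
    ∃ d > (0 : ℝ), (∀ i k, i ≠ k → d ≤ ‖lam i - lam k‖) ∧ ∃ C > (0 : ℝ), ∃ η₀ > (0 : ℝ),
      C * η₀ ≤ d / 4 ∧ C * η₀ ≤ 1 / 4 ∧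
      ∀ (X : Type) [NormedAddCommGroup X] [NormedSpace ℂ X] (A₀ : X →L[ℂ] X) (e : ι → X)
        (l : ι → X →L[ℂ] ℂ), SpectralModel A₀ lam e l M r n →
        ∀ (A : X →L[ℂ] X) (η : ℝ), η ≤ η₀ → ‖A - A₀‖ ≤ η →
          (∀ (μ : ℂ) (g : X), r < ‖μ‖ → g ≠ 0 → A g = μ • g →
            ∃ i, ‖μ - lam i‖ ≤ C * η ∧ ‖g - l i g • e i‖ ≤ C * η * ‖g‖) ∧
          (∀ (i : ι) (μ₁ μ₂ a : ℂ) (g₁ g₂ : X), r < ‖μ₁‖ → r < ‖μ₂‖ → ‖μ₁ - lam i‖ ≤ C * η →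
            ‖μ₂ - lam i‖ ≤ C * η → g₁ ≠ 0 → A g₁ = μ₁ • g₁ → A g₂ = μ₂ • g₂ + a • g₁ →
              ∃ t : ℂ, g₂ = t • g₁) := by
  obtain ⟨d, hd, hgap⟩ := exists_gap hinj
  refine ⟨d, hd, hgap, ?_⟩
  wlog hM : 1 ≤ M
  · refine ⟨1, one_pos, min (d / 4) (1 / 4), by positivity, by simp, by simp, ?_⟩
    intro X _ _ A₀ e l h
    exact absurd h.one_le hM
  have hM0 : 0 ≤ M := zero_le_one.trans hM
  obtain ⟨R, hR⟩ : ∃ R, R = 2 * (∑ k ∈ Finset.range n, M ^ k / r ^ (k + 1)) *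
    (1 + Fintype.card ι * M ^ 2) := ⟨_, rfl⟩
  have hR0 : 0 ≤ R := by rw [hR]; positivity
  obtain ⟨Q, hQ⟩ : ∃ Q, Q = R + Fintype.card ι * (M ^ 2 / (d / 2)) := ⟨_, rfl⟩
  have hQ0 : 0 ≤ Q := by rw [hQ]; positivity
  obtain ⟨C, hC⟩ : ∃ C, C = Fintype.card ι * (2 * M ^ 2) + Q * (2 * M ^ 2 + 1) + R + 1 := ⟨_, rfl⟩
  have hp1 : 0 ≤ Fintype.card ι * (2 * M ^ 2) := by positivity
  have hp2 : 0 ≤ Q * (2 * M ^ 2) := by positivity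
  have hC0 : 0 < C := by linarith
  refine ⟨C, hC0, min (d / 4) (1 / 4) / C, by positivity, ?_, ?_, ?_⟩
  · rw [mul_div_cancel₀ _ hC0.ne']; exact min_le_left _ _
  · rw [mul_div_cancel₀ _ hC0.ne']; exact min_le_right _ _
  intro X _ _ A₀ e l h A η hη hA
  have hη0 : 0 ≤ η := (norm_nonneg _).trans hA
  have hCη : C * η ≤ min (d / 4) (1 / 4) := by
    rw [mul_comm]
    exact (le_div_iff₀ hC0).1 hη
  have hCd : C * η ≤ d / 4 := hCη.trans (min_le_left _ _)
  have hC4 : C * η ≤ 1 / 4 := hCη.trans (min_le_right _ _)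
  have hfar : ∀ {i : ι} {μ : ℂ}, ‖μ - lam i‖ ≤ C * η → ∀ k, k ≠ i → d / 2 ≤ ‖lam k - μ‖ := by
    intro i μ hi k hk
    have h1 := hgap k i hk
    have h2 := norm_sub_le_norm_sub_add_norm_sub (lam k) μ (lam i)
    linarith
  have hres : ∀ g : X, ‖A₀ g - A g‖ ≤ η * ‖g‖ := by
    intro g
    rw [norm_sub_rev]
    exact ((A - A₀).le_opNorm g).trans (mul_le_mul_of_nonneg_right hA (norm_nonneg _))
  constructor
  · intro μ g hμ hg hAg
    have hh : ‖A₀ g - μ • g‖ ≤ η * ‖g‖ := hAg ▸ hres g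
    obtain ⟨i, hi⟩ := h.exists_near_eigenvalue hr hC0 hC4 (by rw [← hR]; linarith) (by linarith)
      hμ hg hh
    refine ⟨i, hi, (h.dist_line_le hr hμ (half_pos hd) (hfar hi) g).trans ?_⟩
    rw [← hR, ← hQ, mul_assoc C]
    exact mul_le_mul (by linarith) hh (norm_nonneg _) hC0.le
  · intro i μ₁ μ₂ a g₁ g₂ hμ₁ hμ₂ hi₁ hi₂ hg₁ hA₁ hA₂
    refine h.eigenvector_unique hr (half_pos hd) hη0 (Q := Q) (by rw [hQ, hR]) ?_ hres hμ₁ hμ₂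
      (hfar hi₁) (hfar hi₂) hg₁ hA₁ hA₂
    exact (mul_le_mul_of_nonneg_right (by linarith) hη0).trans hC4

section Weighted

variable {Ω : Type} [MeasurableSpace Ω]

/-- Measurable functions bounded by a multiple of `exp u`. -/
def weightedSubmodule (u : Ω → ℝ) : Submodule ℂ (Ω → ℂ) where
  carrier := {φ | Measurable φ ∧ ∃ C : ℝ, ∀ x, ‖φ x‖ ≤ C * Real.exp (u x)}
  add_mem' := by
    rintro φ ψ ⟨hφ, C, hC⟩ ⟨hψ, D, hD⟩
    refine ⟨hφ.add hψ, C + D, fun x => ?_⟩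
    rw [add_mul]
    exact (norm_add_le _ _).trans (add_le_add (hC x) (hD x))
  zero_mem' := ⟨measurable_const, 0, fun x => by simp⟩
  smul_mem' := by
    rintro c φ ⟨hφ, C, hC⟩
    refine ⟨hφ.const_smul c, ‖c‖ * C, fun x => ?_⟩
    rw [Pi.smul_apply, norm_smul, mul_assoc]
    exact mul_le_mul_of_nonneg_left (hC x) (norm_nonneg c)

/-- The space of measurable functions bounded by a multiple of `exp u`, to be equipped with the
weighted supremum norm. -/
def WeightedBdd (u : Ω → ℝ) : Type := weightedSubmodule u

namespace WeightedBdd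

variable {u : Ω → ℝ}

noncomputable instance : AddCommGroup (WeightedBdd u) :=
  inferInstanceAs (AddCommGroup (weightedSubmodule u))

noncomputable instance : Module ℂ (WeightedBdd u) :=
  inferInstanceAs (Module ℂ (weightedSubmodule u))

instance : CoeFun (WeightedBdd u) fun _ => Ω → ℂ := ⟨fun φ => φ.1⟩

/-- Constructor from a measurable function with a weighted bound. -/
def mk (φ : Ω → ℂ) (hφ : Measurable φ) (C : ℝ) (hC : ∀ x, ‖φ x‖ ≤ C * Real.exp (u x)) :
    WeightedBdd u := ⟨φ, hφ, C, hC⟩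

@[simp] lemma mk_apply (φ : Ω → ℂ) (hφ : Measurable φ) (C : ℝ)
    (hC : ∀ x, ‖φ x‖ ≤ C * Real.exp (u x)) (x : Ω) : (mk φ hφ C hC : WeightedBdd u) x = φ x := rfl

@[ext] lemma ext {φ ψ : WeightedBdd u} (h : ∀ x, φ x = ψ x) : φ = ψ := Subtype.ext (funext h)

lemma measurable (φ : WeightedBdd u) : Measurable φ := φ.2.1

@[simp] lemma add_apply (φ ψ : WeightedBdd u) (x : Ω) : (φ + ψ) x = φ x + ψ x := rfl
@[simp] lemma sub_apply (φ ψ : WeightedBdd u) (x : Ω) : (φ - ψ) x = φ x - ψ x := rfl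
@[simp] lemma zero_apply (x : Ω) : (0 : WeightedBdd u) x = 0 := rfl
@[simp] lemma smul_apply (c : ℂ) (φ : WeightedBdd u) (x : Ω) : (c • φ) x = c * φ x := rfl

noncomputable instance : Norm (WeightedBdd u) := ⟨fun φ => ⨆ x, ‖φ x‖ * Real.exp (-u x)⟩

lemma bddAbove (φ : WeightedBdd u) :
    BddAbove (Set.range fun x => ‖φ x‖ * Real.exp (-u x)) := by
  obtain ⟨C, hC⟩ := φ.2.2
  refine ⟨C, ?_⟩
  rintro _ ⟨x, rfl⟩
  calc ‖φ x‖ * Real.exp (-u x) ≤ C * Real.exp (u x) * Real.exp (-u x) :=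
        mul_le_mul_of_nonneg_right (hC x) (Real.exp_pos _).le
    _ = C := by rw [mul_assoc, ← Real.exp_add]; simp

lemma norm_apply_le (φ : WeightedBdd u) (x : Ω) : ‖φ x‖ ≤ ‖φ‖ * Real.exp (u x) := by
  have h := mul_le_mul_of_nonneg_right (le_ciSup φ.bddAbove x) (Real.exp_pos (u x)).le
  rw [mul_assoc, ← Real.exp_add, neg_add_cancel, Real.exp_zero, mul_one] at h
  exact h

lemma norm_le {φ : WeightedBdd u} {C : ℝ} (hC : 0 ≤ C)
    (h : ∀ x, ‖φ x‖ ≤ C * Real.exp (u x)) : ‖φ‖ ≤ C := by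
  refine Real.iSup_le (fun x => ?_) hC
  calc ‖φ x‖ * Real.exp (-u x) ≤ C * Real.exp (u x) * Real.exp (-u x) :=
        mul_le_mul_of_nonneg_right (h x) (Real.exp_pos _).le
    _ = C := by rw [mul_assoc, ← Real.exp_add]; simp

lemma norm_nonneg' (φ : WeightedBdd u) : 0 ≤ ‖φ‖ :=
  Real.iSup_nonneg fun x => by positivity

lemma core : NormedSpace.Core ℂ (WeightedBdd u) where
  norm_nonneg := norm_nonneg'
  norm_smul c φ := by
    change (⨆ x, _) = _ * (⨆ x, _)
    rw [Real.mul_iSup_of_nonneg (_root_.norm_nonneg c)]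
    refine iSup_congr fun x => ?_
    rw [smul_apply, norm_mul, mul_assoc]
  norm_triangle φ ψ := by
    refine norm_le (add_nonneg (norm_nonneg' _) (norm_nonneg' _)) fun x => ?_
    rw [add_mul]
    exact (norm_add_le _ _).trans (add_le_add (norm_apply_le _ _) (norm_apply_le _ _))
  norm_eq_zero_iff φ := by
    constructor
    · intro h
      ext x
      have := φ.norm_apply_le x
      rw [h, zero_mul] at this
      exact norm_le_zero_iff.1 this
    · rintro rfl
      exact le_antisymm (norm_le le_rfl (by simp)) (norm_nonneg' _)

noncomputable instance : NormedAddCommGroup (WeightedBdd u) := NormedAddCommGroup.ofCore core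

noncomputable instance : NormedSpace ℂ (WeightedBdd u) := NormedSpace.ofCore core

@[simp] lemma sum_apply {ι : Type*} (s : Finset ι) (φ : ι → WeightedBdd u) (x : Ω) :
    (∑ i ∈ s, φ i) x = ∑ i ∈ s, φ i x := by
  classical
  induction s using Finset.induction_on with
  | empty => simp
  | insert a s ha ih => rw [Finset.sum_insert ha, Finset.sum_insert ha, add_apply, ih]

end WeightedBdd

end Weighted

section Hermite

open Polynomial

lemma exists_polynomial_bound (p : ℝ[X]) {τ : ℝ} (hτ : 0 < τ) :
    ∃ C > 0, ∀ u : ℝ, |p.eval u| ≤ C * Real.exp (τ * u ^ 2) := by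
  induction p using Polynomial.induction_on' with
  | add p q hp hq =>
    obtain ⟨C, hC, h⟩ := hp
    obtain ⟨D, hD, h'⟩ := hq
    refine ⟨C + D, by positivity, fun u => ?_⟩
    rw [eval_add, add_mul]
    exact (abs_add_le _ _).trans (add_le_add (h u) (h' u))
  | monomial n a =>
    refine ⟨(|a| + 1) * (1 + n.factorial / τ ^ n), by positivity, fun u => ?_⟩
    have h1 : |u| ^ n ≤ 1 + (u ^ 2) ^ n := by
      rw [← sq_abs u, pow_right_comm]
      nlinarith [sq_nonneg (|u| ^ n - 1), sq_nonneg (|u| ^ n)]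
    have h2 := Real.pow_div_factorial_le_exp (τ * u ^ 2) (by positivity) n
    have h3 : (u ^ 2) ^ n ≤ n.factorial / τ ^ n * Real.exp (τ * u ^ 2) := by
      rw [div_le_iff₀ (by positivity), mul_pow] at h2
      rw [div_mul_eq_mul_div, le_div_iff₀ (by positivity)]
      linarith
    have h4 : 1 ≤ Real.exp (τ * u ^ 2) := Real.one_le_exp (by positivity)
    rw [eval_monomial, abs_mul, abs_pow, mul_assoc]
    refine mul_le_mul (by linarith) ?_ (by positivity) (by positivity)
    linarith

lemma integrable_polynomial_mul_gaussian (p : ℝ[X]) {b : ℝ} (hb : 0 < b) (m : ℝ) :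
    Integrable (fun u => p.eval u * Real.exp (-b * (u - m) ^ 2)) := by
  have h0 : ∀ q : ℝ[X], Integrable (fun u => q.eval u * Real.exp (-b * u ^ 2)) := by
    intro q
    induction q using Polynomial.induction_on' with
    | add p q hp hq =>
      simp only [eval_add, add_mul]
      exact hp.add hq
    | monomial n a =>
      have h := (integrable_rpow_mul_exp_neg_mul_sq hb (s := n)
        (by linarith [n.cast_nonneg (α := ℝ)])).const_mul a
      simpa [mul_assoc] using h
  have h := (h0 (p.comp (X + C m))).comp_sub_right m
  simpa using h

/-- Integration by parts against a Gaussian. -/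
lemma integral_polynomial_deriv_gaussian (p : ℝ[X]) {b : ℝ} (hb : 0 < b) (m : ℝ) :
    ∫ u, (derivative p).eval u * Real.exp (-b * (u - m) ^ 2) =
      2 * b * ∫ u, ((X - C m) * p).eval u * Real.exp (-b * (u - m) ^ 2) := by
  have h1 := integrable_polynomial_mul_gaussian (derivative p) hb m
  have h2 := (integrable_polynomial_mul_gaussian ((X - C m) * p) hb m).const_mul (2 * b)
  have h := integral_eq_zero_of_hasDerivAt_of_integrable
    (f := fun u => p.eval u * Real.exp (-b * (u - m) ^ 2))
    (f' := fun u => (derivative p).eval u * Real.exp (-b * (u - m) ^ 2) -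
      2 * b * (((X - C m) * p).eval u * Real.exp (-b * (u - m) ^ 2)))
    (fun u => by
      have hd : HasDerivAt (fun u => Real.exp (-b * (u - m) ^ 2))
          (Real.exp (-b * (u - m) ^ 2) * (-b * (2 * (u - m)))) u := by
        have := (((hasDerivAt_id u).sub_const m).pow 2).const_mul (-b)
        simpa using this.exp
      convert! (p.hasDerivAt u).mul hd using 1
      simp only [eval_mul, eval_sub, eval_X, eval_C]
      ring)
    (h1.sub h2) (integrable_polynomial_mul_gaussian p hb m)
  rw [integral_sub h1 h2, integral_const_mul] at h
  linarith

/-- The physicists' Hermite polynomials. -/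
noncomputable def physHermite (n : ℕ) : ℝ[X] :=
  C (Real.sqrt 2 ^ n) * ((hermite n).map (Int.castRingHom ℝ)).comp (C (Real.sqrt 2) * X)

lemma hermiteH_eq_eval (n : ℕ) (x : ℝ) : hermiteH n x = (physHermite n).eval x := by
  simp [hermiteH, physHermite, aeval_def, eval_comp, eval_map]

lemma physHermite_zero : physHermite 0 = 1 := by
  simp [physHermite]

lemma physHermite_succ (n : ℕ) :
    physHermite (n + 1) = C 2 * X * physHermite n - derivative (physHermite n) := by
  have h2 : (C (Real.sqrt 2) : ℝ[X]) * C (Real.sqrt 2) = C 2 := by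
    rw [← C_mul, Real.mul_self_sqrt (by norm_num)]
  simp only [physHermite, hermite_succ, Polynomial.map_sub, Polynomial.map_mul, map_X, sub_comp,
    mul_comp, X_comp, derivative_map, derivative_comp, derivative_mul,
    derivative_X, derivative_C, pow_succ, C_mul, ← h2]
  ring

lemma derivative_physHermite_succ (n : ℕ) :
    derivative (physHermite (n + 1)) = C (2 * (n + 1) : ℝ) * physHermite n := by
  induction n with
  | zero =>
    rw [physHermite_succ, physHermite_zero]
    simp
  | succ n ih =>
    rw [physHermite_succ (n + 1), derivative_sub, derivative_mul, ih, derivative_mul]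
    simp only [derivative_C, derivative_X, derivative_mul]
    rw [physHermite_succ n]
    simp only [Nat.cast_add, Nat.cast_one, C_mul, C_add, C_1]
    ring

lemma natDegree_physHermite_le (n : ℕ) : (physHermite n).natDegree ≤ n := by
  induction n with
  | zero => simp [physHermite_zero]
  | succ n ih =>
    rw [physHermite_succ]
    refine (natDegree_sub_le _ _).trans (max_le ?_ ?_)
    · refine natDegree_mul_le.trans ?_
      have := natDegree_C_mul_le (2 : ℝ) X
      rw [natDegree_X] at this
      omega
    · exact (natDegree_derivative_le _).trans (by omega)

lemma coeff_physHermite_self (n : ℕ) : (physHermite n).coeff n = 2 ^ n := by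
  induction n with
  | zero => simp [physHermite_zero]
  | succ n ih =>
    rw [physHermite_succ, coeff_sub, mul_assoc, coeff_C_mul, coeff_X_mul, ih,
      coeff_eq_zero_of_natDegree_lt]
    · ring
    · have := (natDegree_derivative_le (physHermite n)).trans
        (Nat.sub_le_sub_right (natDegree_physHermite_le n) 1)
      omega

lemma exists_eval_eq_sum_physHermite (n : ℕ) (p : ℂ[X]) (hp : p.natDegree ≤ n) :
    ∃ a : ℕ → ℂ, ∀ y : ℝ, p.eval (y : ℂ) =
      ∑ i ∈ Finset.range (n + 1), a i * (((physHermite i).eval y : ℝ) : ℂ) := by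
  induction n generalizing p with
  | zero =>
    rw [Nat.le_zero, natDegree_eq_zero] at hp
    obtain ⟨a, rfl⟩ := hp
    exact ⟨fun _ => a, fun y => by simp [physHermite_zero]⟩
  | succ n ih =>
    obtain ⟨b, hb⟩ : ∃ b, b = p.coeff (n + 1) / 2 ^ (n + 1) := ⟨_, rfl⟩
    have hq : (p - C b * (physHermite (n + 1)).map (algebraMap ℝ ℂ)).natDegree ≤ n := by
      rw [natDegree_le_iff_coeff_eq_zero]
      intro k hk
      rw [coeff_sub, coeff_C_mul, coeff_map]
      rcases (Nat.succ_le_of_lt hk).eq_or_lt with h | h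
      · rw [← h, Nat.succ_eq_add_one, coeff_physHermite_self, hb]
        simp
      · rw [coeff_eq_zero_of_natDegree_lt (lt_of_le_of_lt hp h),
          coeff_eq_zero_of_natDegree_lt (lt_of_le_of_lt (natDegree_physHermite_le _) h)]
        simp
    obtain ⟨a, ha⟩ := ih _ hq
    refine ⟨Function.update a (n + 1) b, fun y => ?_⟩
    have h1 := ha y
    rw [eval_sub, eval_mul, eval_C, eval_map_algebraMap, sub_eq_iff_eq_add] at h1
    rw [Finset.sum_range_succ, Function.update_self, h1]
    congr 1
    · refine Finset.sum_congr rfl fun i hi => ?_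
      rw [Function.update_of_ne (by have := Finset.mem_range.1 hi; omega)]
    · congr 1
      exact (aeval_algebraMap_apply ℂ y _)

lemma integral_hermite_step (n : ℕ) (p : ℝ[X]) :
    ∫ u, (physHermite (n + 1) * p).eval u * Real.exp (-u ^ 2) =
      ∫ u, (physHermite n * derivative p).eval u * Real.exp (-u ^ 2) := by
  have h := integral_polynomial_deriv_gaussian (physHermite n * p) one_pos 0
  have e : ∀ u : ℝ, -1 * (u - 0) ^ 2 = -u ^ 2 := fun u => by ring
  have hi : ∀ q : ℝ[X], Integrable fun u => q.eval u * Real.exp (-u ^ 2) := by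
    intro q
    simpa only [e] using integrable_polynomial_mul_gaussian q one_pos 0
  simp only [e] at h
  rw [← integral_const_mul] at h
  have h1 : ∀ u : ℝ, (physHermite (n + 1) * p).eval u * Real.exp (-u ^ 2) =
      2 * 1 * (((X - C 0) * (physHermite n * p)).eval u * Real.exp (-u ^ 2)) -
      (derivative (physHermite n) * p).eval u * Real.exp (-u ^ 2) := by
    intro u
    rw [physHermite_succ]
    simp only [eval_mul, eval_sub, eval_X, eval_C]
    ring
  simp only [h1]
  rw [integral_sub ((hi _).const_mul _) (hi _), ← h, ← integral_sub (hi _) (hi _)]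
  refine integral_congr_ae (Eventually.of_forall fun u => ?_)
  simp only [derivative_mul, eval_add, eval_mul]
  ring

lemma integral_physHermite_mul_of_lt {n : ℕ} {p : ℝ[X]} (hp : p.natDegree < n) :
    ∫ u, (physHermite n * p).eval u * Real.exp (-u ^ 2) = 0 := by
  induction n generalizing p with
  | zero => omega
  | succ n ih =>
    rw [integral_hermite_step]
    rcases Nat.eq_zero_or_pos p.natDegree with h | h
    · rw [natDegree_eq_zero] at h
      obtain ⟨a, rfl⟩ := h
      simp
    · exact ih (lt_of_lt_of_le (natDegree_derivative_lt h.ne') (by omega))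

lemma integral_physHermite_mul_ne {m n : ℕ} (h : m ≠ n) :
    ∫ u, (physHermite m * physHermite n).eval u * Real.exp (-u ^ 2) = 0 := by
  rcases lt_or_gt_of_ne h with h | h
  · rw [mul_comm]
    exact integral_physHermite_mul_of_lt ((natDegree_physHermite_le m).trans_lt h)
  · exact integral_physHermite_mul_of_lt ((natDegree_physHermite_le n).trans_lt h)

lemma integral_physHermite_sq_pos (n : ℕ) :
    0 < ∫ u, (physHermite n * physHermite n).eval u * Real.exp (-u ^ 2) := by
  induction n with
  | zero =>
    have := integral_gaussian 1
    simp only [physHermite_zero, mul_one, eval_one, one_mul]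
    simp only [neg_mul, one_mul, div_one] at this
    rw [this]
    positivity
  | succ n ih =>
    rw [integral_hermite_step, derivative_physHermite_succ]
    have : ∀ u : ℝ, (physHermite n * (C (2 * (n + 1) : ℝ) * physHermite n)).eval u *
        Real.exp (-u ^ 2) =
        (2 * (n + 1)) * ((physHermite n * physHermite n).eval u * Real.exp (-u ^ 2)) := by
      intro u
      simp only [eval_mul, eval_C]
      ring
    simp only [this]
    rw [integral_const_mul]
    positivity

/-- The transition density of the stationary autoregressive Gaussian chain with correlation `c` and
stationary density proportional to `exp (-u ^ 2)`. -/
noncomputable def mehlerKernel (c y u : ℝ) : ℝ :=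
  (Real.sqrt (Real.pi * (1 - c ^ 2)))⁻¹ * Real.exp (-(1 - c ^ 2)⁻¹ * (u - c * y) ^ 2)

lemma mehlerKernel_nonneg (c y u : ℝ) : 0 ≤ mehlerKernel c y u := by
  unfold mehlerKernel; positivity

lemma one_sub_sq_pos {c : ℝ} (hc : |c| < 1) : 0 < 1 - c ^ 2 := by
  have := (sq_lt_one_iff_abs_lt_one c).2 hc
  linarith

lemma mehlerKernel_symm {c : ℝ} (hc : |c| < 1) (y u : ℝ) :
    Real.exp (-y ^ 2) * mehlerKernel c y u = Real.exp (-u ^ 2) * mehlerKernel c u y := by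
  have := one_sub_sq_pos hc
  unfold mehlerKernel
  rw [mul_left_comm, mul_left_comm (Real.exp (-u ^ 2)), ← Real.exp_add, ← Real.exp_add]
  congr 2
  field_simp
  ring

lemma integrable_polynomial_mul_mehlerKernel {c : ℝ} (hc : |c| < 1) (p : ℝ[X]) (y : ℝ) :
    Integrable fun u => p.eval u * mehlerKernel c y u := by
  have h := (integrable_polynomial_mul_gaussian p (inv_pos.2 (one_sub_sq_pos hc)) (c * y)).const_mul
    (Real.sqrt (Real.pi * (1 - c ^ 2)))⁻¹
  refine h.congr (Eventually.of_forall fun u => ?_)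
  simp only [mehlerKernel]
  ring

lemma integral_mehlerKernel {c : ℝ} (hc : |c| < 1) (y : ℝ) : ∫ u, mehlerKernel c y u = 1 := by
  have h0 := one_sub_sq_pos hc
  unfold mehlerKernel
  rw [integral_const_mul, integral_sub_right_eq_self
    (fun u => Real.exp (-(1 - c ^ 2)⁻¹ * u ^ 2)) (c * y), integral_gaussian, div_inv_eq_mul]
  exact inv_mul_cancel₀ (Real.sqrt_ne_zero'.2 (mul_pos Real.pi_pos h0))

lemma integral_deriv_mehlerKernel {c : ℝ} (hc : |c| < 1) (p : ℝ[X]) (y : ℝ) :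
    (1 - c ^ 2) * ∫ u, (derivative p).eval u * mehlerKernel c y u =
      2 * ∫ u, ((X - C (c * y)) * p).eval u * mehlerKernel c y u := by
  have h0 := one_sub_sq_pos hc
  have h := integral_polynomial_deriv_gaussian p (inv_pos.2 h0) (c * y)
  have e : ∀ q : ℝ[X], ∫ u, q.eval u * mehlerKernel c y u =
      (Real.sqrt (Real.pi * (1 - c ^ 2)))⁻¹ *
        ∫ u, q.eval u * Real.exp (-(1 - c ^ 2)⁻¹ * (u - c * y) ^ 2) := by
    intro q
    rw [← integral_const_mul]
    refine integral_congr_ae (Eventually.of_forall fun u => ?_)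
    simp only [mehlerKernel]
    ring
  rw [e, e, h]
  field_simp

/-- Hermite polynomials are eigenfunctions of the Mehler kernel. -/
lemma integral_physHermite_mehlerKernel {c : ℝ} (hc : |c| < 1) (n : ℕ) (y : ℝ) :
    ∫ u, (physHermite n).eval u * mehlerKernel c y u = c ^ n * (physHermite n).eval y := by
  have hi := integrable_polynomial_mul_mehlerKernel hc (y := y)
  induction n using Nat.strong_induction_on with
  | _ n ih =>
    cases n with
    | zero => simp [physHermite_zero, integral_mehlerKernel hc]
    | succ n =>
      have hder : c * ∫ u, (derivative (physHermite n)).eval u * mehlerKernel c y u =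
          c ^ n * (derivative (physHermite n)).eval y := by
        cases n with
        | zero => simp [physHermite_zero]
        | succ m =>
          rw [derivative_physHermite_succ]
          have : ∀ u : ℝ, (C (2 * (m + 1) : ℝ) * physHermite m).eval u * mehlerKernel c y u =
              (2 * (m + 1)) * ((physHermite m).eval u * mehlerKernel c y u) := by
            intro u
            simp only [eval_mul, eval_C]
            ring
          simp only [this]
          rw [integral_const_mul, ih m (by omega), eval_mul, eval_C, pow_succ]
          ring
      have h1 : ∀ u : ℝ, (physHermite (n + 1)).eval u * mehlerKernel c y u =
          2 * (((X - C (c * y)) * physHermite n).eval u * mehlerKernel c y u) +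
          2 * c * y * ((physHermite n).eval u * mehlerKernel c y u) -
          (derivative (physHermite n)).eval u * mehlerKernel c y u := by
        intro u
        rw [physHermite_succ]
        simp only [eval_mul, eval_sub, eval_X, eval_C]
        ring
      simp only [h1]
      have hs : Integrable fun u => 2 * (((X - C (c * y)) * physHermite n).eval u *
          mehlerKernel c y u) + 2 * c * y * ((physHermite n).eval u * mehlerKernel c y u) :=
        ((hi _).const_mul _).add ((hi _).const_mul _)
      rw [integral_sub hs (hi _),
        integral_add ((hi _).const_mul _) ((hi _).const_mul _), integral_const_mul,
        integral_const_mul, ← integral_deriv_mehlerKernel hc, ih n (by omega), physHermite_succ]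
      simp only [eval_mul, eval_sub, eval_X, eval_C]
      have : (1 - c ^ 2) * (∫ u, (derivative (physHermite n)).eval u * mehlerKernel c y u) -
          ∫ u, (derivative (physHermite n)).eval u * mehlerKernel c y u =
          - (c * (c ^ n * (derivative (physHermite n)).eval y)) := by
        rw [← hder]
        ring
      rw [pow_succ]
      linear_combination this

/-- Chapman–Kolmogorov equation. -/
lemma integral_mehlerKernel_mul {a b : ℝ} (ha : |a| < 1) (hb : |b| < 1) (y u : ℝ) :
    ∫ z, mehlerKernel a y z * mehlerKernel b z u = mehlerKernel (a * b) y u := by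
  have ha' := one_sub_sq_pos ha
  have hb' := one_sub_sq_pos hb
  have hab : |a * b| < 1 := by
    rw [abs_mul]
    exact mul_lt_one_of_nonneg_of_lt_one_left (abs_nonneg _) ha hb.le
  have hab' := one_sub_sq_pos hab
  obtain ⟨A, hA⟩ : ∃ A, A = (1 - (a * b) ^ 2) / ((1 - a ^ 2) * (1 - b ^ 2)) := ⟨_, rfl⟩
  have hA0 : 0 < A := by rw [hA]; positivity
  obtain ⟨m, hm⟩ : ∃ m, m = (a * y * (1 - b ^ 2) + b * u * (1 - a ^ 2)) / (1 - (a * b) ^ 2) :=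
    ⟨_, rfl⟩
  have h1 : ∀ z, mehlerKernel a y z * mehlerKernel b z u =
      ((Real.sqrt (Real.pi * (1 - a ^ 2)))⁻¹ * (Real.sqrt (Real.pi * (1 - b ^ 2)))⁻¹ *
        Real.exp (-(1 - (a * b) ^ 2)⁻¹ * (u - a * b * y) ^ 2)) * Real.exp (-A * (z - m) ^ 2) := by
    intro z
    unfold mehlerKernel
    have : -(1 - a ^ 2)⁻¹ * (z - a * y) ^ 2 + -(1 - b ^ 2)⁻¹ * (u - b * z) ^ 2 =
        -(1 - (a * b) ^ 2)⁻¹ * (u - a * b * y) ^ 2 + -A * (z - m) ^ 2 := by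
      have hne : 1 - a ^ 2 * b ^ 2 ≠ 0 := by rw [← mul_pow]; exact hab'.ne'
      rw [hA, hm]
      simp only [mul_pow]
      field_simp
      ring
    rw [mul_mul_mul_comm, ← Real.exp_add, this, Real.exp_add]
    ring
  simp only [h1]
  rw [integral_const_mul, integral_sub_right_eq_self (fun z => Real.exp (-A * z ^ 2)) m,
    integral_gaussian]
  unfold mehlerKernel
  have h2 : (Real.sqrt (Real.pi * (1 - a ^ 2)))⁻¹ * (Real.sqrt (Real.pi * (1 - b ^ 2)))⁻¹ *
      Real.sqrt (Real.pi / A) = (Real.sqrt (Real.pi * (1 - (a * b) ^ 2)))⁻¹ := by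
    rw [← Real.sqrt_inv, ← Real.sqrt_inv, ← Real.sqrt_inv, ← Real.sqrt_mul (by positivity),
      ← Real.sqrt_mul (by positivity)]
    congr 1
    rw [hA]
    field_simp
  rw [← h2]
  ring

end Hermite

section Mehler

lemma sq_mul_add_le {θ : ℝ} (hθ : 0 < θ) (hθ1 : θ < 1) (a b : ℝ) :
    (θ * a + b) ^ 2 ≤ θ * a ^ 2 + b ^ 2 / (1 - θ) := by
  have h : 0 < 1 - θ := by linarith
  have : θ * a ^ 2 + b ^ 2 / (1 - θ) - (θ * a + b) ^ 2 =
      θ / (1 - θ) * ((1 - θ) * a - b) ^ 2 := by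
    field_simp
    ring
  have h2 : 0 ≤ θ / (1 - θ) * ((1 - θ) * a - b) ^ 2 := by positivity
  linarith

/-- Exponents for which the Mehler kernel improves the weight `exp (κ y ^ 2)`. -/
structure WeightParams (θ κ κ₂ : ℝ) : Prop where
  theta_pos : 0 < θ
  theta_lt : θ < 1
  pos : 0 < κ
  lower : θ * κ₂ < κ
  upper : κ < κ₂
  small : κ₂ ≤ (1 - θ) / 2

variable {c θ κ κ₂ : ℝ}

lemma mehlerKernel_le (hP : WeightParams θ κ κ₂) (hc : |c| ≤ θ) (y u : ℝ) :
    mehlerKernel c y u ≤ (Real.sqrt (Real.pi * (1 - c ^ 2)))⁻¹ *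
      Real.exp (θ * κ₂ * y ^ 2 - κ₂ * u ^ 2) := by
  unfold mehlerKernel
  refine mul_le_mul_of_nonneg_left (Real.exp_le_exp.2 ?_) (by positivity)
  have h0 := one_sub_sq_pos (hc.trans_lt hP.theta_lt)
  have h1 : 1 ≤ (1 - c ^ 2)⁻¹ := by
    rw [one_le_inv₀ h0]
    nlinarith [sq_nonneg c]
  have h2 := sq_mul_add_le hP.theta_pos hP.theta_lt |y| |u - c * y|
  have hθ : 0 < 1 - θ := by linarith [hP.theta_lt]
  have h3 : u ^ 2 ≤ (θ * |y| + |u - c * y|) ^ 2 := by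
    rw [← sq_abs u]
    refine pow_le_pow_left₀ (abs_nonneg _) ?_ 2
    have h4 : |u| ≤ |c * y| + |u - c * y| := by
      have := abs_add_le (c * y) (u - c * y)
      rwa [add_sub_cancel] at this
    rw [abs_mul] at h4
    have := mul_le_mul_of_nonneg_right hc (abs_nonneg y)
    linarith
  rw [sq_abs, sq_abs] at h2
  have hκ : 0 < κ₂ := hP.pos.trans hP.upper
  have h5 : κ₂ * u ^ 2 ≤ κ₂ * (θ * y ^ 2 + (u - c * y) ^ 2 / (1 - θ)) :=
    mul_le_mul_of_nonneg_left (h3.trans h2) hκ.le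
  have h6 : κ₂ * ((u - c * y) ^ 2 / (1 - θ)) ≤ (u - c * y) ^ 2 := by
    rw [mul_div_assoc', div_le_iff₀ hθ]
    nlinarith [sq_nonneg (u - c * y), hP.small]
  have h7 : (u - c * y) ^ 2 ≤ (1 - c ^ 2)⁻¹ * (u - c * y) ^ 2 :=
    le_mul_of_one_le_left (sq_nonneg _) h1
  linarith

lemma continuous_mehlerKernel (c : ℝ) : Continuous (fun q : ℝ × ℝ => mehlerKernel c q.1 q.2) := by
  unfold mehlerKernel
  fun_prop

/-- The space of functions on the line of growth at most `exp (κ y ^ 2)`. -/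
abbrev GaussBdd (κ : ℝ) : Type := WeightedBdd (fun y : ℝ => κ * y ^ 2)

lemma GaussBdd.integrable_mul (g : GaussBdd κ) {k : ℝ → ℂ} (hk : Measurable k) {C : ℝ}
    (hκ : κ < κ₂) (hb : ∀ u, ‖k u‖ ≤ C * Real.exp (-κ₂ * u ^ 2)) :
    Integrable (fun u => g u * k u) ∧
      ‖∫ u, g u * k u‖ ≤ ‖g‖ * C * ∫ u, Real.exp (-(κ₂ - κ) * u ^ 2) := by
  have hi : Integrable fun u : ℝ => ‖g‖ * C * Real.exp (-(κ₂ - κ) * u ^ 2) :=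
    (integrable_exp_neg_mul_sq (sub_pos.2 hκ)).const_mul _
  have hbd : ∀ u, ‖g u * k u‖ ≤ ‖g‖ * C * Real.exp (-(κ₂ - κ) * u ^ 2) := by
    intro u
    rw [norm_mul]
    calc ‖g u‖ * ‖k u‖ ≤ (‖g‖ * Real.exp (κ * u ^ 2)) * (C * Real.exp (-κ₂ * u ^ 2)) :=
          mul_le_mul (g.norm_apply_le u) (hb u) (norm_nonneg _) (by positivity)
      _ = ‖g‖ * C * (Real.exp (κ * u ^ 2) * Real.exp (-κ₂ * u ^ 2)) := by ring
      _ = _ := by rw [← Real.exp_add]; ring_nf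
  refine ⟨hi.mono' (g.measurable.mul hk).aestronglyMeasurable (Eventually.of_forall hbd), ?_⟩
  rw [← integral_const_mul]
  exact norm_integral_le_of_norm_le hi (Eventually.of_forall hbd)

lemma norm_mehlerKernel_le (hP : WeightParams θ κ κ₂) (hc : |c| ≤ θ) (y u : ℝ) :
    ‖(mehlerKernel c y u : ℂ)‖ ≤ ((Real.sqrt (Real.pi * (1 - c ^ 2)))⁻¹ *
      Real.exp (θ * κ₂ * y ^ 2)) * Real.exp (-κ₂ * u ^ 2) := by
  rw [Complex.norm_real, Real.norm_of_nonneg (mehlerKernel_nonneg _ _ _), mul_assoc,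
    ← Real.exp_add, neg_mul, ← sub_eq_add_neg]
  exact mehlerKernel_le hP hc y u

lemma measurable_mehlerKernel (c y : ℝ) : Measurable fun u => (mehlerKernel c y u : ℂ) :=
  Complex.measurable_ofReal.comp
    ((continuous_mehlerKernel c).comp (by fun_prop : Continuous fun u : ℝ => (y, u))).measurable

lemma norm_integral_mehlerKernel_le (hP : WeightParams θ κ κ₂) (hc : |c| ≤ θ) (g : GaussBdd κ)
    (y : ℝ) :
    ‖∫ u, g u * (mehlerKernel c y u : ℂ)‖ ≤ ((Real.sqrt (Real.pi * (1 - c ^ 2)))⁻¹ *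
      ∫ u, Real.exp (-(κ₂ - κ) * u ^ 2)) * ‖g‖ * Real.exp (θ * κ₂ * y ^ 2) := by
  refine (g.integrable_mul (measurable_mehlerKernel c y) hP.upper
    (norm_mehlerKernel_le hP hc y)).2.trans (le_of_eq ?_)
  ring

/-- The Ornstein–Uhlenbeck transition operator on functions of growth at most `exp (κ y ^ 2)`. -/
noncomputable def mehlerOp (hP : WeightParams θ κ κ₂) (hc : |c| ≤ θ) :
    GaussBdd κ →L[ℂ] GaussBdd κ :=
  LinearMap.mkContinuous
    { toFun := fun g => WeightedBdd.mk (fun y => ∫ u, g u * (mehlerKernel c y u : ℂ))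
        (by
          have h : StronglyMeasurable (Function.uncurry fun (y u : ℝ) =>
              g u * (mehlerKernel c y u : ℂ)) :=
            ((g.measurable.comp measurable_snd).mul (Complex.measurable_ofReal.comp
              (continuous_mehlerKernel c).measurable)).stronglyMeasurable
          exact h.integral_prod_right.measurable)
        (((Real.sqrt (Real.pi * (1 - c ^ 2)))⁻¹ *
          ∫ u, Real.exp (-(κ₂ - κ) * u ^ 2)) * ‖g‖)
        (fun y => (norm_integral_mehlerKernel_le hP hc g y).trans
          (mul_le_mul_of_nonneg_left (Real.exp_le_exp.2
            (mul_le_mul_of_nonneg_right hP.lower.le (sq_nonneg y))) (by positivity)))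
      map_add' := fun g g' => by
        ext y
        have h := fun g : GaussBdd κ => (g.integrable_mul (measurable_mehlerKernel c y) hP.upper
          (norm_mehlerKernel_le hP hc y)).1
        simp only [WeightedBdd.mk_apply, WeightedBdd.add_apply, add_mul]
        exact integral_add (h g) (h g')
      map_smul' := fun a g => by
        ext y
        simp only [WeightedBdd.mk_apply, WeightedBdd.smul_apply, RingHom.id_apply, mul_assoc]
        exact integral_const_mul _ _ }
    ((Real.sqrt (Real.pi * (1 - c ^ 2)))⁻¹ * ∫ u, Real.exp (-(κ₂ - κ) * u ^ 2))
    (fun g => WeightedBdd.norm_le (by positivity) fun y =>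
      (norm_integral_mehlerKernel_le hP hc g y).trans
          (mul_le_mul_of_nonneg_left (Real.exp_le_exp.2
            (mul_le_mul_of_nonneg_right hP.lower.le (sq_nonneg y))) (by positivity)))

lemma mehlerOp_apply (hP : WeightParams θ κ κ₂) (hc : |c| ≤ θ) (g : GaussBdd κ) (y : ℝ) :
    mehlerOp hP hc g y = ∫ u, g u * (mehlerKernel c y u : ℂ) := rfl

lemma abs_pow_le_of_le (hc : |c| ≤ θ) (hθ1 : θ < 1) (m : ℕ) : |c ^ (m + 1)| ≤ θ := by
  rw [abs_pow, pow_succ]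
  exact (mul_le_of_le_one_left (abs_nonneg _)
    (pow_le_one₀ (abs_nonneg _) (hc.trans hθ1.le))).trans hc

/-- Fubini for a weighted function against two Gaussian-bounded kernels. -/
lemma GaussBdd.integral_swap (g : GaussBdd κ) {F : ℝ × ℝ → ℂ} (hF : Measurable F) {a b C : ℝ}
    (ha : 0 < a) (hb : κ < b)
    (hbd : ∀ z u, ‖F (z, u)‖ ≤ C * (Real.exp (-a * z ^ 2) * Real.exp (-b * u ^ 2))) :
    ∫ z, ∫ u, g u * F (z, u) = ∫ u, ∫ z, g u * F (z, u) := by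
  refine integral_integral_swap ?_
  have h1 : Integrable (fun q : ℝ × ℝ => Real.exp (-a * q.1 ^ 2) *
      (‖g‖ * C * Real.exp (-(b - κ) * q.2 ^ 2))) (volume.prod volume) :=
    (integrable_exp_neg_mul_sq ha).mul_prod
      ((integrable_exp_neg_mul_sq (sub_pos.2 hb)).const_mul _)
  refine h1.mono' ?_ (Eventually.of_forall fun q => ?_)
  · exact ((g.measurable.comp measurable_snd).mul hF).aestronglyMeasurable
  · obtain ⟨z, u⟩ := q
    simp only [Function.uncurry_apply_pair, norm_mul]
    calc ‖g u‖ * ‖F (z, u)‖ ≤ (‖g‖ * Real.exp (κ * u ^ 2)) *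
          (C * (Real.exp (-a * z ^ 2) * Real.exp (-b * u ^ 2))) :=
          mul_le_mul (g.norm_apply_le u) (hbd z u) (norm_nonneg _) (by positivity)
      _ = Real.exp (-a * z ^ 2) * (‖g‖ * C * (Real.exp (κ * u ^ 2) * Real.exp (-b * u ^ 2))) := by
          ring
      _ = _ := by rw [← Real.exp_add]; ring_nf

lemma mehlerOp_pow_apply (hP : WeightParams θ κ κ₂) (hc : |c| ≤ θ) (m : ℕ) (g : GaussBdd κ)
    (y : ℝ) :
    (mehlerOp hP hc ^ (m + 1)) g y = ∫ u, g u * (mehlerKernel (c ^ (m + 1)) y u : ℂ) := by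
  induction m generalizing y with
  | zero => rw [zero_add, pow_one, pow_one, mehlerOp_apply]
  | succ m ih =>
    have hcm := abs_pow_le_of_le hc hP.theta_lt m
    rw [pow_succ', mul_apply_eq_comp, mehlerOp_apply]
    simp only [ih]
    have h1 : ∀ z, (∫ u, g u * (mehlerKernel (c ^ (m + 1)) z u : ℂ)) * (mehlerKernel c y z : ℂ) =
        ∫ u, g u * ((mehlerKernel c y z * mehlerKernel (c ^ (m + 1)) z u : ℝ) : ℂ) := by
      intro z
      rw [← integral_mul_const]
      refine integral_congr_ae (Eventually.of_forall fun u => ?_)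
      push_cast
      ring
    simp only [h1]
    have hsw := g.integral_swap
      (F := fun q => ((mehlerKernel c y q.1 * mehlerKernel (c ^ (m + 1)) q.1 q.2 : ℝ) : ℂ))
      (a := (1 - θ) * κ₂) (b := κ₂)
      (C := (Real.sqrt (Real.pi * (1 - c ^ 2)))⁻¹ * Real.exp (θ * κ₂ * y ^ 2) *
        (Real.sqrt (Real.pi * (1 - (c ^ (m + 1)) ^ 2)))⁻¹) ?_
      (mul_pos (by linarith [hP.theta_lt]) (hP.pos.trans hP.upper)) hP.upper ?_
    · rw [hsw]
      refine integral_congr_ae (Eventually.of_forall fun u => ?_)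
      simp only
      rw [integral_const_mul, integral_complex_ofReal,
        integral_mehlerKernel_mul (hc.trans_lt hP.theta_lt) (hcm.trans_lt hP.theta_lt), ← pow_succ']
    · refine Complex.measurable_ofReal.comp (Measurable.mul ?_ ?_)
      · exact ((continuous_mehlerKernel c).comp
          (by fun_prop : Continuous fun q : ℝ × ℝ => (y, q.1))).measurable
      · exact (continuous_mehlerKernel _).measurable
    · intro z u
      have e1 := norm_mehlerKernel_le hP hc y z
      have e2 := norm_mehlerKernel_le hP hcm z u
      simp only [Complex.ofReal_mul, norm_mul]
      refine (mul_le_mul e1 e2 (norm_nonneg _) (by positivity)).trans (le_of_eq ?_)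
      have : Real.exp (-((1 - θ) * κ₂) * z ^ 2) =
          Real.exp (-κ₂ * z ^ 2) * Real.exp (θ * κ₂ * z ^ 2) := by
        rw [← Real.exp_add]
        ring_nf
      rw [this]
      ring

end Mehler

section MehlerSpectrum

variable {c θ κ κ₂ : ℝ}

lemma hermiteFun_eq (n : ℕ) (u : ℝ) :
    hermiteFun n u = (physHermite n).eval u * Real.exp (-u ^ 2) := by
  rw [hermiteFun, hermiteH_eq_eval, mul_comm]

lemma continuous_hermiteFun (n : ℕ) : Continuous (hermiteFun n) := by
  have : hermiteFun n = fun u => (physHermite n).eval u * Real.exp (-u ^ 2) :=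
    funext (hermiteFun_eq n)
  rw [this]
  exact (physHermite n).continuous.mul (by fun_prop)

lemma measurable_ofReal_hermiteFun (n : ℕ) : Measurable fun u => (hermiteFun n u : ℂ) :=
  Complex.measurable_ofReal.comp (continuous_hermiteFun n).measurable

lemma exists_hermiteFun_bound (n : ℕ) {b : ℝ} (hb : b < 1) :
    ∃ C > 0, ∀ u, |hermiteFun n u| ≤ C * Real.exp (-b * u ^ 2) := by
  obtain ⟨C, hC, h⟩ := exists_polynomial_bound (physHermite n) (sub_pos.2 hb)
  refine ⟨C, hC, fun u => ?_⟩
  rw [hermiteFun_eq, abs_mul, abs_of_pos (Real.exp_pos _)]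
  calc _ ≤ C * Real.exp ((1 - b) * u ^ 2) * Real.exp (-u ^ 2) :=
        mul_le_mul_of_nonneg_right (h u) (Real.exp_pos _).le
    _ = _ := by rw [mul_assoc, ← Real.exp_add]; ring_nf

lemma WeightParams.upper_lt_one (hP : WeightParams θ κ κ₂) : κ₂ < 1 := by
  linarith [hP.small, hP.theta_pos]

/-- The squared norm of the `n`-th Hermite polynomial in `L²(exp (-u ^ 2))`. -/
noncomputable def hermiteNormSq (n : ℕ) : ℝ :=
  ∫ u, (physHermite n * physHermite n).eval u * Real.exp (-u ^ 2)

lemma hermiteNormSq_pos (n : ℕ) : 0 < hermiteNormSq n := integral_physHermite_sq_pos n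

/-- The Hermite polynomial `H_n` as an element of `GaussBdd κ`. -/
noncomputable def hermiteVec (hP : WeightParams θ κ κ₂) (n : ℕ) : GaussBdd κ :=
  WeightedBdd.mk (fun y => (((physHermite n).eval y : ℝ) : ℂ))
    (Complex.measurable_ofReal.comp (physHermite n).continuous.measurable)
    (exists_polynomial_bound (physHermite n) hP.pos).choose
    (fun y => by
      rw [Complex.norm_real]
      exact (exists_polynomial_bound (physHermite n) hP.pos).choose_spec.2 y)

lemma hermiteVec_apply (hP : WeightParams θ κ κ₂) (n : ℕ) (y : ℝ) :
    hermiteVec hP n y = (((physHermite n).eval y : ℝ) : ℂ) := rfl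

lemma integrable_mul_hermiteFun (hP : WeightParams θ κ κ₂) (n : ℕ) (g : GaussBdd κ) :
    Integrable (fun u => g u * (hermiteFun n u : ℂ)) := by
  obtain ⟨C, hC, h⟩ := exists_hermiteFun_bound n hP.upper_lt_one
  exact (g.integrable_mul (C := C) (measurable_ofReal_hermiteFun n)
    hP.upper (fun u => by rw [Complex.norm_real]; exact h u)).1

/-- The functional `g ↦ ∫ g h_n`, normalized so that it takes the value `1` at `H_n`. -/
noncomputable def hermiteFunctional (hP : WeightParams θ κ κ₂) (n : ℕ) : GaussBdd κ →L[ℂ] ℂ :=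
  LinearMap.mkContinuous
    { toFun := fun g => (hermiteNormSq n : ℂ)⁻¹ * ∫ u, g u * (hermiteFun n u : ℂ)
      map_add' := fun g g' => by
        rw [← mul_add, ← integral_add (integrable_mul_hermiteFun hP n g)
          (integrable_mul_hermiteFun hP n g')]
        simp only [WeightedBdd.add_apply, add_mul]
      map_smul' := fun a g => by
        simp only [WeightedBdd.smul_apply, RingHom.id_apply, mul_assoc, integral_const_mul,
          smul_eq_mul]
        ring }
    (‖(hermiteNormSq n : ℂ)⁻¹‖ * ((exists_hermiteFun_bound n hP.upper_lt_one).choose *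
      ∫ u, Real.exp (-(κ₂ - κ) * u ^ 2)))
    (fun g => by
      have h := (exists_hermiteFun_bound n hP.upper_lt_one).choose_spec.2
      have := (g.integrable_mul (measurable_ofReal_hermiteFun n)
        hP.upper (fun u => by rw [Complex.norm_real]; exact h u)).2
      simp only [LinearMap.coe_mk, AddHom.coe_mk, norm_mul]
      rw [mul_assoc]
      refine mul_le_mul_of_nonneg_left (this.trans (le_of_eq ?_)) (norm_nonneg _)
      ring)

lemma hermiteFunctional_apply (hP : WeightParams θ κ κ₂) (n : ℕ) (g : GaussBdd κ) :
    hermiteFunctional hP n g = (hermiteNormSq n : ℂ)⁻¹ * ∫ u, g u * (hermiteFun n u : ℂ) := rfl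

lemma mehlerOp_hermiteVec (hP : WeightParams θ κ κ₂) (hc : |c| ≤ θ) (n : ℕ) :
    mehlerOp hP hc (hermiteVec hP n) = ((c : ℂ) ^ n) • hermiteVec hP n := by
  ext y
  rw [mehlerOp_apply, WeightedBdd.smul_apply]
  simp only [hermiteVec_apply, ← Complex.ofReal_mul, ← Complex.ofReal_pow]
  rw [integral_complex_ofReal, integral_physHermite_mehlerKernel (hc.trans_lt hP.theta_lt)]

lemma integral_hermiteFun_mehlerKernel (hc : |c| < 1) (n : ℕ) (u : ℝ) :
    ∫ y, hermiteFun n y * mehlerKernel c y u = c ^ n * hermiteFun n u := by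
  have h : ∀ y, hermiteFun n y * mehlerKernel c y u =
      Real.exp (-u ^ 2) * ((physHermite n).eval y * mehlerKernel c u y) := by
    intro y
    rw [hermiteFun_eq, mul_assoc, mehlerKernel_symm hc]
    ring
  simp only [h]
  rw [integral_const_mul, integral_physHermite_mehlerKernel hc, hermiteFun_eq]
  ring

lemma hermiteFunctional_mehlerOp (hP : WeightParams θ κ κ₂) (hc : |c| ≤ θ) (n : ℕ)
    (g : GaussBdd κ) :
    hermiteFunctional hP n (mehlerOp hP hc g) = (c : ℂ) ^ n * hermiteFunctional hP n g := by
  rw [hermiteFunctional_apply, hermiteFunctional_apply, mul_left_comm]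
  congr 1
  simp only [mehlerOp_apply]
  have h1 : ∀ z, (∫ u, g u * (mehlerKernel c z u : ℂ)) * (hermiteFun n z : ℂ) =
      ∫ u, g u * ((hermiteFun n z * mehlerKernel c z u : ℝ) : ℂ) := by
    intro z
    rw [← integral_mul_const]
    refine integral_congr_ae (Eventually.of_forall fun u => ?_)
    push_cast
    ring
  simp only [h1]
  obtain ⟨C, hC, hb⟩ := exists_hermiteFun_bound n hP.upper_lt_one
  rw [g.integral_swap (F := fun q => ((hermiteFun n q.1 * mehlerKernel c q.1 q.2 : ℝ) : ℂ))
    (a := (1 - θ) * κ₂) (b := κ₂) (C := C * (Real.sqrt (Real.pi * (1 - c ^ 2)))⁻¹)]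
  · simp only [integral_const_mul, integral_complex_ofReal,
      integral_hermiteFun_mehlerKernel (hc.trans_lt hP.theta_lt)]
    rw [← integral_const_mul]
    refine integral_congr_ae (Eventually.of_forall fun u => ?_)
    push_cast
    ring
  · refine Complex.measurable_ofReal.comp (Measurable.mul ?_ ?_)
    · exact (continuous_hermiteFun n).measurable.comp measurable_fst
    · exact (continuous_mehlerKernel c).measurable
  · exact mul_pos (by linarith [hP.theta_lt]) (hP.pos.trans hP.upper)
  · exact hP.upper
  · intro z u
    have e1 := hb z
    have e2 := norm_mehlerKernel_le hP hc z u
    simp only [Complex.ofReal_mul, norm_mul]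
    rw [Complex.norm_real (hermiteFun n z)]
    refine (mul_le_mul e1 e2 (norm_nonneg _) (by positivity)).trans (le_of_eq ?_)
    have : Real.exp (-((1 - θ) * κ₂) * z ^ 2) =
        Real.exp (-κ₂ * z ^ 2) * Real.exp (θ * κ₂ * z ^ 2) := by
      rw [← Real.exp_add]
      ring_nf
    rw [this]
    ring

lemma integral_hermiteVec_mul (hP : WeightParams θ κ κ₂) (m n : ℕ) :
    ∫ u, hermiteVec hP m u * (hermiteFun n u : ℂ) =
      ((∫ u, (physHermite m * physHermite n).eval u * Real.exp (-u ^ 2) : ℝ) : ℂ) := by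
  rw [← integral_complex_ofReal]
  refine integral_congr_ae (Eventually.of_forall fun u => ?_)
  simp only [hermiteVec_apply, hermiteFun_eq, Polynomial.eval_mul]
  push_cast
  ring

lemma hermiteFunctional_self (hP : WeightParams θ κ κ₂) (n : ℕ) :
    hermiteFunctional hP n (hermiteVec hP n) = 1 := by
  rw [hermiteFunctional_apply, integral_hermiteVec_mul]
  exact inv_mul_cancel₀ (Complex.ofReal_ne_zero.2 (hermiteNormSq_pos n).ne')

lemma hermiteFunctional_of_ne (hP : WeightParams θ κ κ₂) {m n : ℕ} (h : m ≠ n) :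
    hermiteFunctional hP m (hermiteVec hP n) = 0 := by
  rw [hermiteFunctional_apply, integral_hermiteVec_mul, integral_physHermite_mul_ne h.symm]
  simp

/-- Taylor expansion of the Mehler kernel in its correlation. -/
lemma mehlerKernel_eq_exp (c y u : ℝ) :
    mehlerKernel c y u = mehlerKernel c 0 u *
      Real.exp ((1 - c ^ 2)⁻¹ * (2 * c * u * y - c ^ 2 * y ^ 2)) := by
  unfold mehlerKernel
  rw [mul_assoc, ← Real.exp_add]
  congr 2
  ring

lemma abs_exp_sub_sum_le (w : ℝ) (J : ℕ) :
    |Real.exp w - ∑ j ∈ Finset.range J, w ^ j / j.factorial| ≤ |w| ^ J * Real.exp |w| := by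
  have h := Complex.norm_exp_sub_sum_le_norm_mul_exp (w : ℂ) J
  have e : Complex.exp (w : ℂ) - ∑ m ∈ Finset.range J, (w : ℂ) ^ m / (m.factorial : ℂ) =
      ((Real.exp w - ∑ j ∈ Finset.range J, w ^ j / j.factorial : ℝ) : ℂ) := by
    push_cast
    rfl
  rw [e, Complex.norm_real, Complex.norm_real] at h
  exact h

lemma exists_integral_eq_eval (hP : WeightParams θ κ κ₂) {b : ℝ} (hc : |c| ≤ θ)
    (g : GaussBdd κ) (j : ℕ) :
    ∃ p : Polynomial ℂ, p.natDegree ≤ 2 * j ∧ ∀ y : ℝ,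
      Integrable (fun u => g u * ((mehlerKernel c 0 u *
        (b * (2 * c * u * y - c ^ 2 * y ^ 2)) ^ j : ℝ) : ℂ)) ∧
      ∫ u, g u * ((mehlerKernel c 0 u * (b * (2 * c * u * y - c ^ 2 * y ^ 2)) ^ j : ℝ) : ℂ) =
        p.eval (y : ℂ) := by
  have hint : ∀ i, Integrable fun u => g u * ((mehlerKernel c 0 u * u ^ i : ℝ) : ℂ) := by
    intro i
    obtain ⟨C, hC, h⟩ := exists_polynomial_bound (Polynomial.X ^ i)
      (show 0 < (κ₂ - κ) / 2 by linarith [hP.upper])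
    refine (g.integrable_mul (κ₂ := (κ₂ + κ) / 2)
      (C := (Real.sqrt (Real.pi * (1 - c ^ 2)))⁻¹ * C) ?_ (by linarith [hP.upper]) ?_).1
    · simp only [Complex.ofReal_mul, Complex.ofReal_pow]
      exact (measurable_mehlerKernel c 0).mul (Complex.measurable_ofReal.pow_const i)
    · intro u
      have h1 := norm_mehlerKernel_le hP hc 0 u
      have h2 := h u
      rw [Polynomial.eval_pow, Polynomial.eval_X] at h2
      rw [Complex.ofReal_mul, norm_mul, Complex.norm_real (u ^ i)]
      refine (mul_le_mul h1 h2 (abs_nonneg _) (by positivity)).trans (le_of_eq ?_)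
      have : Real.exp (-((κ₂ + κ) / 2) * u ^ 2) =
          Real.exp (-κ₂ * u ^ 2) * Real.exp ((κ₂ - κ) / 2 * u ^ 2) := by
        rw [← Real.exp_add]
        ring_nf
      rw [this]
      simp
      ring
  refine ⟨∑ i ∈ Finset.range (j + 1), Polynomial.C (((b ^ j * (2 * c) ^ i * (-c ^ 2) ^ (j - i) *
    j.choose i : ℝ) : ℂ) * ∫ u, g u * ((mehlerKernel c 0 u * u ^ i : ℝ) : ℂ)) *
      Polynomial.X ^ (i + 2 * (j - i)), ?_, fun y => ?_⟩
  · refine Polynomial.natDegree_sum_le_of_forall_le _ _ fun i hi => ?_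
    refine (Polynomial.natDegree_C_mul_X_pow_le _ _).trans ?_
    have := Finset.mem_range.1 hi
    omega
  · have e : ∀ u, g u * ((mehlerKernel c 0 u *
        (b * (2 * c * u * y - c ^ 2 * y ^ 2)) ^ j : ℝ) : ℂ) =
        ∑ i ∈ Finset.range (j + 1), ((b ^ j * (2 * c) ^ i * (-c ^ 2) ^ (j - i) *
          j.choose i * y ^ (i + 2 * (j - i)) : ℝ) : ℂ) *
            (g u * ((mehlerKernel c 0 u * u ^ i : ℝ) : ℂ)) := by
      intro u
      have : (b * (2 * c * u * y - c ^ 2 * y ^ 2)) ^ j = ∑ i ∈ Finset.range (j + 1),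
          (b ^ j * (2 * c) ^ i * (-c ^ 2) ^ (j - i) * j.choose i * y ^ (i + 2 * (j - i))) *
            u ^ i := by
        rw [mul_pow, sub_eq_add_neg, add_pow, Finset.mul_sum]
        refine Finset.sum_congr rfl fun i _ => ?_
        rw [← neg_mul, mul_pow (-c ^ 2), pow_add y i, pow_mul y 2, mul_pow (2 * c * u),
          mul_pow (2 * c)]
        ring
      rw [this, Finset.mul_sum, Complex.ofReal_sum, Finset.mul_sum]
      refine Finset.sum_congr rfl fun i _ => ?_
      push_cast
      ring
    simp only [e]
    constructor
    · exact integrable_finsetSum _ fun i _ => (hint i).const_mul _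
    · rw [integral_finsetSum _ fun i _ => (hint i).const_mul _]
      simp only [integral_const_mul, Polynomial.eval_finsetSum, Polynomial.eval_mul,
        Polynomial.eval_C, Polynomial.eval_pow, Polynomial.eval_X]
      refine Finset.sum_congr rfl fun i _ => ?_
      push_cast
      ring

end MehlerSpectrum

section MehlerModel

variable {c θ κ κ₂ : ℝ}

lemma mehlerKernel_taylor_bound (hP : WeightParams θ κ κ₂) (hc : |c| ≤ θ) (J : ℕ) {y u : ℝ}
    (hsmall : (1 - θ ^ 2)⁻¹ * |c| ≤ κ / 4) :
    |mehlerKernel c y u - mehlerKernel c 0 u * ∑ j ∈ Finset.range J,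
      ((1 - c ^ 2)⁻¹ * (2 * c * u * y - c ^ 2 * y ^ 2)) ^ j / j.factorial| ≤
    (Real.sqrt (Real.pi * (1 - θ ^ 2)))⁻¹ * ((1 - θ ^ 2)⁻¹ ^ J * (J.factorial / (κ / 4) ^ J)) *
      |c| ^ J * Real.exp (κ * y ^ 2) * Real.exp (-(1 - κ / 2) * u ^ 2) := by
  have hκ := hP.pos
  have hθ : 0 < 1 - θ ^ 2 := one_sub_sq_pos (by rw [abs_of_pos hP.theta_pos]; exact hP.theta_lt)
  have hc1 : 0 < 1 - c ^ 2 := one_sub_sq_pos (hc.trans_lt hP.theta_lt)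
  have hcθ : c ^ 2 ≤ θ ^ 2 := by
    rw [← sq_abs c]
    exact pow_le_pow_left₀ (abs_nonneg _) hc 2
  obtain ⟨w, hw⟩ : ∃ w, w = (1 - c ^ 2)⁻¹ * (2 * c * u * y - c ^ 2 * y ^ 2) := ⟨_, rfl⟩
  obtain ⟨D, hD⟩ : ∃ D, D = (1 - θ ^ 2)⁻¹ := ⟨_, rfl⟩
  have hD0 : 0 < D := hD ▸ inv_pos.2 hθ
  have hDc : (1 - c ^ 2)⁻¹ ≤ D := hD ▸ inv_anti₀ hθ (by linarith)
  obtain ⟨s, hs⟩ : ∃ s, s = u ^ 2 + 2 * y ^ 2 := ⟨_, rfl⟩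
  have hs0 : 0 ≤ s := by rw [hs]; positivity
  rw [mehlerKernel_eq_exp, ← hw, ← mul_sub, abs_mul, abs_of_nonneg (mehlerKernel_nonneg _ _ _),
    ← hD]
  rw [← hD] at hsmall
  have hwb : |w| ≤ D * |c| * s := by
    have h1 : |2 * c * u * y - c ^ 2 * y ^ 2| ≤ |c| * s := by
      have h2 : |c| ≤ 1 := hc.trans hP.theta_lt.le
      have h3 : |2 * c * u * y| ≤ |c| * (u ^ 2 + y ^ 2) := by
        rw [show 2 * c * u * y = c * (2 * u * y) by ring, abs_mul]
        refine mul_le_mul_of_nonneg_left ?_ (abs_nonneg _)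
        rw [abs_le]
        constructor <;> nlinarith [sq_nonneg (u + y), sq_nonneg (u - y)]
      have h4 : |c ^ 2 * y ^ 2| ≤ |c| * y ^ 2 := by
        rw [abs_of_nonneg (by positivity), ← sq_abs c]
        refine mul_le_mul_of_nonneg_right ?_ (sq_nonneg y)
        nlinarith [abs_nonneg c]
      have := abs_sub (2 * c * u * y) (c ^ 2 * y ^ 2)
      rw [hs]
      linarith
    rw [hw, abs_mul, abs_of_pos (inv_pos.2 hc1), mul_assoc D]
    exact mul_le_mul hDc h1 (abs_nonneg _) hD0.le
  have hexp : |Real.exp w - ∑ j ∈ Finset.range J, w ^ j / j.factorial| ≤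
      D ^ J * (J.factorial / (κ / 4) ^ J) * |c| ^ J * Real.exp (κ / 2 * s) := by
    have h1 : |w| ^ J ≤ D ^ J * |c| ^ J * s ^ J := by
      rw [← mul_pow, ← mul_pow]
      exact pow_le_pow_left₀ (abs_nonneg _) hwb J
    have h2 : s ^ J ≤ J.factorial / (κ / 4) ^ J * Real.exp (κ / 4 * s) := by
      have h := Real.pow_div_factorial_le_exp (κ / 4 * s) (by positivity) J
      rw [div_le_iff₀ (by positivity), mul_pow] at h
      rw [div_mul_eq_mul_div, le_div_iff₀ (by positivity)]
      linarith
    have h3 : Real.exp |w| ≤ Real.exp (κ / 4 * s) :=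
      Real.exp_le_exp.2 (hwb.trans (mul_le_mul_of_nonneg_right hsmall hs0))
    calc _ ≤ |w| ^ J * Real.exp |w| := abs_exp_sub_sum_le w J
      _ ≤ (D ^ J * |c| ^ J * (J.factorial / (κ / 4) ^ J * Real.exp (κ / 4 * s))) *
          Real.exp (κ / 4 * s) :=
        mul_le_mul (h1.trans (mul_le_mul_of_nonneg_left h2 (by positivity))) h3
          (Real.exp_pos _).le (by positivity)
      _ = D ^ J * (J.factorial / (κ / 4) ^ J) * |c| ^ J *
          (Real.exp (κ / 4 * s) * Real.exp (κ / 4 * s)) := by ring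
      _ = _ := by rw [← Real.exp_add]; ring_nf
  have hK : mehlerKernel c 0 u ≤ (Real.sqrt (Real.pi * (1 - θ ^ 2)))⁻¹ * Real.exp (-u ^ 2) := by
    unfold mehlerKernel
    refine mul_le_mul ?_ (Real.exp_le_exp.2 ?_) (Real.exp_pos _).le (by positivity)
    · refine inv_anti₀ (Real.sqrt_pos.2 (by positivity)) (Real.sqrt_le_sqrt ?_)
      exact mul_le_mul_of_nonneg_left (by linarith) Real.pi_pos.le
    · have : 1 ≤ (1 - c ^ 2)⁻¹ := by
        rw [one_le_inv₀ hc1]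
        nlinarith [sq_nonneg c]
      rw [mul_zero, sub_zero]
      nlinarith [sq_nonneg u]
  refine (mul_le_mul hK hexp (abs_nonneg _) (by positivity)).trans (le_of_eq ?_)
  have : Real.exp (κ * y ^ 2) * Real.exp (-(1 - κ / 2) * u ^ 2) =
      Real.exp (-u ^ 2) * Real.exp (κ / 2 * s) := by
    rw [← Real.exp_add, ← Real.exp_add, hs]
    ring_nf
  rw [mul_assoc (_ * |c| ^ J), this]
  ring

/-- Large powers of the Mehler operator are polynomial up to a small error. -/
lemma mehlerOp_pow_near_polynomial (hP : WeightParams θ κ κ₂) (hc : |c| ≤ θ) (J : ℕ) :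
    ∃ C > 0, ∀ m : ℕ, (1 - θ ^ 2)⁻¹ * |c ^ (m + 1)| ≤ κ / 4 → ∀ g : GaussBdd κ,
      ∃ p : Polynomial ℂ, p.natDegree ≤ 2 * J ∧ ∀ y : ℝ,
        ‖(mehlerOp hP hc ^ (m + 1)) g y - p.eval (y : ℂ)‖ ≤
          C * (|c| ^ (J + 1)) ^ (m + 1) * ‖g‖ * Real.exp (κ * y ^ 2) := by
  have hκ := hP.pos
  have hκ1 := hP.upper_lt_one
  have hκu := hP.upper
  have hκs := hP.small
  have hθ0 := hP.theta_pos
  obtain ⟨E, hE⟩ : ∃ E, E = (Real.sqrt (Real.pi * (1 - θ ^ 2)))⁻¹ *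
    ((1 - θ ^ 2)⁻¹ ^ (J + 1) * ((J + 1).factorial / (κ / 4) ^ (J + 1))) := ⟨_, rfl⟩
  have hθ : 0 < 1 - θ ^ 2 := one_sub_sq_pos (by rw [abs_of_pos hP.theta_pos]; exact hP.theta_lt)
  have hE0 : 0 ≤ E := by rw [hE]; positivity
  have hI : 0 ≤ ∫ u, Real.exp (-((1 - κ / 2) - κ) * u ^ 2) :=
    integral_nonneg fun u => (Real.exp_pos _).le
  refine ⟨E * (∫ u, Real.exp (-((1 - κ / 2) - κ) * u ^ 2)) + 1, by positivity, ?_⟩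
  intro m hm g
  have hcm := abs_pow_le_of_le hc hP.theta_lt m
  obtain ⟨a, ha⟩ : ∃ a, a = c ^ (m + 1) := ⟨_, rfl⟩
  rw [← ha] at hm hcm
  choose p hpdeg hp using exists_integral_eq_eval hP (b := (1 - a ^ 2)⁻¹) hcm g
  refine ⟨∑ j ∈ Finset.range (J + 1), Polynomial.C (((j.factorial : ℝ)⁻¹ : ℝ) : ℂ) * p j, ?_,
    fun y => ?_⟩
  · refine Polynomial.natDegree_sum_le_of_forall_le _ _ fun j hj => ?_
    refine (Polynomial.natDegree_C_mul_le _ _).trans ((hpdeg j).trans ?_)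
    have := Finset.mem_range.1 hj
    omega
  obtain ⟨k, hk⟩ : ∃ k : ℝ → ℝ, k = fun u => mehlerKernel a y u -
    mehlerKernel a 0 u * ∑ j ∈ Finset.range (J + 1),
      ((1 - a ^ 2)⁻¹ * (2 * a * u * y - a ^ 2 * y ^ 2)) ^ j / j.factorial := ⟨_, rfl⟩
  have hi1 : Integrable fun u => g u * (mehlerKernel a y u : ℂ) :=
    (g.integrable_mul (measurable_mehlerKernel a y) hP.upper (norm_mehlerKernel_le hP hcm y)).1
  have hi2 : ∀ j ∈ Finset.range (J + 1), Integrable fun u => (((j.factorial : ℝ)⁻¹ : ℝ) : ℂ) *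
      (g u * ((mehlerKernel a 0 u *
        ((1 - a ^ 2)⁻¹ * (2 * a * u * y - a ^ 2 * y ^ 2)) ^ j : ℝ) : ℂ)) := fun j _ =>
    ((hp j y).1).const_mul _
  have hrep : (mehlerOp hP hc ^ (m + 1)) g y - (∑ j ∈ Finset.range (J + 1),
      Polynomial.C (((j.factorial : ℝ)⁻¹ : ℝ) : ℂ) * p j).eval (y : ℂ) =
      ∫ u, g u * (k u : ℂ) := by
    rw [mehlerOp_pow_apply, ← ha, Polynomial.eval_finsetSum]
    simp only [Polynomial.eval_mul, Polynomial.eval_C, ← (hp _ y).2, ← integral_const_mul]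
    rw [← integral_finsetSum _ hi2, ← integral_sub hi1 (integrable_finsetSum _ hi2)]
    refine integral_congr_ae (Eventually.of_forall fun u => ?_)
    simp only [hk, Finset.mul_sum, Complex.ofReal_sub, Complex.ofReal_sum, mul_sub]
    congr 1
    refine Finset.sum_congr rfl fun j _ => ?_
    push_cast
    ring
  rw [hrep]
  have hkb : ∀ u, ‖(k u : ℂ)‖ ≤ E * |a| ^ (J + 1) * Real.exp (κ * y ^ 2) *
      Real.exp (-(1 - κ / 2) * u ^ 2) := by
    intro u
    rw [Complex.norm_real, hk, hE]
    exact mehlerKernel_taylor_bound hP hcm (J + 1) hm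
  have hkm : Measurable fun u => (k u : ℂ) := by
    refine Complex.measurable_ofReal.comp ?_
    rw [hk]
    have h1 : Continuous fun u => mehlerKernel a y u :=
      (continuous_mehlerKernel a).comp (by fun_prop : Continuous fun u : ℝ => (y, u))
    have h2 : Continuous fun u => mehlerKernel a 0 u :=
      (continuous_mehlerKernel a).comp (by fun_prop : Continuous fun u : ℝ => ((0 : ℝ), u))
    exact (h1.sub (h2.mul (by fun_prop))).measurable
  refine (g.integrable_mul hkm (by linarith) hkb).2.trans ?_
  have e : |a| ^ (J + 1) = (|c| ^ (J + 1)) ^ (m + 1) := by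
    rw [ha, abs_pow, ← pow_mul, ← pow_mul, mul_comm]
  rw [e]
  have : 0 ≤ (|c| ^ (J + 1)) ^ (m + 1) * ‖g‖ * Real.exp (κ * y ^ 2) := by positivity
  nlinarith

/-- The Hermite functions provide a spectral model for the Mehler operator, up to any prescribed
spectral radius. -/
theorem exists_mehler_spectralModel (hP : WeightParams θ κ κ₂) (hc : |c| ≤ θ) {r : ℝ}
    (hr : 0 < r) :
    ∃ N : ℕ, Function.Injective (fun i : Fin (N + 1) => (c : ℂ) ^ (i : ℕ)) ∧
      (∀ j, N < j → |c| ^ j < r) ∧ ∃ (M : ℝ) (n : ℕ),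
        SpectralModel (mehlerOp hP hc) (fun i : Fin (N + 1) => (c : ℂ) ^ (i : ℕ))
          (fun i => hermiteVec hP i) (fun i => hermiteFunctional hP i) M r (n + 1) := by
  have hc1 : |c| < 1 := hc.trans_lt hP.theta_lt
  obtain ⟨J, hJ, hJ0⟩ : ∃ J : ℕ, |c| ^ (J + 1) < r ∧ (c = 0 → J = 0) := by
    by_cases h0 : c = 0
    · exact ⟨0, by simpa [h0] using hr, fun _ => rfl⟩
    · obtain ⟨J, hJ⟩ := exists_pow_lt_of_lt_one hr hc1
      exact ⟨J, (pow_le_pow_of_le_one (abs_nonneg _) hc1.le (Nat.le_succ J)).trans_lt hJ,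
        fun h => absurd h h0⟩
  refine ⟨2 * J, ?_, ?_, ?_⟩
  · intro i k hik
    by_cases h0 : c = 0
    · have hi := i.2
      have hk := k.2
      have := hJ0 h0
      ext
      omega
    · have h1 : |c| ^ (i : ℕ) = |c| ^ (k : ℕ) := by
        have := congrArg norm hik
        simpa using this
      exact Fin.ext (pow_right_injective₀ (abs_pos.2 h0) hc1.ne h1)
  · intro j hj
    exact (pow_le_pow_of_le_one (abs_nonneg _) hc1.le (by omega)).trans_lt hJ
  obtain ⟨C, hC, hpow⟩ := mehlerOp_pow_near_polynomial hP hc J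
  obtain ⟨M₁, hM₁⟩ : ∃ M₁ : ℝ, ∀ i : Fin (2 * J + 1), ‖hermiteVec hP i‖ ≤ M₁ := by
    obtain ⟨M₁, h⟩ := (Set.finite_range fun i : Fin (2 * J + 1) => ‖hermiteVec hP i‖).bddAbove
    exact ⟨M₁, fun i => h ⟨i, rfl⟩⟩
  obtain ⟨M₂, hM₂⟩ : ∃ M₂ : ℝ, ∀ i : Fin (2 * J + 1), ‖hermiteFunctional hP i‖ ≤ M₂ := by
    obtain ⟨M₂, h⟩ :=
      (Set.finite_range fun i : Fin (2 * J + 1) => ‖hermiteFunctional hP i‖).bddAbove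
    exact ⟨M₂, fun i => h ⟨i, rfl⟩⟩
  obtain ⟨M, hM⟩ : ∃ M : ℝ, M = max (max 1 ‖mehlerOp hP hc‖) (max M₁ M₂) := ⟨_, rfl⟩
  have hM0 : 0 < M := by rw [hM]; exact one_pos.trans_le ((le_max_left _ _).trans (le_max_left _ _))
  have hMe : ∀ i : Fin (2 * J + 1), ‖hermiteVec hP i‖ ≤ M := fun i =>
    (hM₁ i).trans (by rw [hM]; exact (le_max_left _ _).trans (le_max_right _ _))
  have hMl : ∀ i : Fin (2 * J + 1), ‖hermiteFunctional hP i‖ ≤ M := fun i =>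
    (hM₂ i).trans (by rw [hM]; exact (le_max_right _ _).trans (le_max_right _ _))
  have hθ : 0 < 1 - θ ^ 2 := one_sub_sq_pos (by rw [abs_of_pos hP.theta_pos]; exact hP.theta_lt)
  obtain ⟨n, hn1, hn2⟩ : ∃ n : ℕ, (1 - θ ^ 2)⁻¹ * |c ^ (n + 1)| ≤ κ / 4 ∧
      (1 + (2 * J + 1 : ℕ) * M ^ 2) * (C * (|c| ^ (J + 1)) ^ (n + 1)) ≤ r ^ (n + 1) / 2 := by
    have t1 : Tendsto (fun n : ℕ => (1 - θ ^ 2)⁻¹ * |c| ^ (n + 1)) atTop (𝓝 0) := by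
      have := ((tendsto_pow_atTop_nhds_zero_of_lt_one (abs_nonneg c) hc1).comp
        (tendsto_add_atTop_nat 1)).const_mul (1 - θ ^ 2)⁻¹
      simpa using this
    have t2 : Tendsto (fun n : ℕ => ((1 + (2 * J + 1 : ℕ) * M ^ 2) * C) *
        (|c| ^ (J + 1) / r) ^ (n + 1)) atTop (𝓝 0) := by
      have := ((tendsto_pow_atTop_nhds_zero_of_lt_one (by positivity : 0 ≤ |c| ^ (J + 1) / r)
        ((div_lt_one hr).2 hJ)).comp
        (tendsto_add_atTop_nat 1)).const_mul ((1 + (2 * J + 1 : ℕ) * M ^ 2) * C)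
      simpa using this
    have hκ4 : 0 < κ / 4 := by linarith [hP.pos]
    obtain ⟨n, h1, h2⟩ := ((t1.eventually (ge_mem_nhds hκ4)).and
      (t2.eventually (ge_mem_nhds (by norm_num : (0 : ℝ) < 1 / 2)))).exists
    refine ⟨n, by rwa [abs_pow], ?_⟩
    rw [div_pow, mul_div_assoc', div_le_iff₀ (by positivity)] at h2
    linarith
  have hcoeig := fun (i : Fin (2 * J + 1)) g => hermiteFunctional_mehlerOp hP hc (i : ℕ) g
  have hself := fun i : Fin (2 * J + 1) => hermiteFunctional_self hP (i : ℕ)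
  have hne : ∀ i k : Fin (2 * J + 1), i ≠ k → hermiteFunctional hP i (hermiteVec hP k) = 0 :=
    fun i k hik => hermiteFunctional_of_ne hP (fun h => hik (Fin.ext h))
  refine ⟨M, n, fun i => mehlerOp_hermiteVec hP hc i, hcoeig, hself, hne,
    by rw [hM]; exact (le_max_left _ _).trans (le_max_left _ _),
    by rw [hM]; exact (le_max_right _ _).trans (le_max_left _ _), hMe, hMl, fun g => ?_⟩
  obtain ⟨p, hpdeg, hp⟩ := hpow n hn1 g
  obtain ⟨a, ha⟩ := exists_eval_eq_sum_physHermite (2 * J) p hpdeg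
  obtain ⟨G, hG⟩ : ∃ G, G = (mehlerOp hP hc ^ (n + 1)) g := ⟨_, rfl⟩
  obtain ⟨R, hR⟩ : ∃ R, R = G - ∑ i : Fin (2 * J + 1), a i • hermiteVec hP i := ⟨_, rfl⟩
  have hRn : ‖R‖ ≤ C * (|c| ^ (J + 1)) ^ (n + 1) * ‖g‖ := by
    refine WeightedBdd.norm_le (by positivity) fun y => ?_
    have h1 : R y = G y - p.eval (y : ℂ) := by
      rw [hR, ha, WeightedBdd.sub_apply, WeightedBdd.sum_apply, Finset.sum_range]
      rfl
    rw [h1, hG]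
    exact hp y
  have hcl : ∀ i : Fin (2 * J + 1), hermiteFunctional hP i G =
      ((c : ℂ) ^ (i : ℕ)) ^ (n + 1) * hermiteFunctional hP i g := by
    intro i
    rw [hG]
    have : ∀ m : ℕ, ∀ g, hermiteFunctional hP i ((mehlerOp hP hc ^ m) g) =
        ((c : ℂ) ^ (i : ℕ)) ^ m * hermiteFunctional hP i g := by
      intro m
      induction m with
      | zero => simp
      | succ m ih =>
        intro g
        rw [pow_succ, mul_apply_eq_comp, ih, hcoeig, pow_succ]
        ring
    exact this _ _
  have hcv : ∀ i : Fin (2 * J + 1), (mehlerOp hP hc ^ (n + 1)) (hermiteVec hP i) =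
      ((c : ℂ) ^ (i : ℕ)) ^ (n + 1) • hermiteVec hP i := by
    intro i
    induction n + 1 with
    | zero => simp
    | succ m ih =>
      rw [pow_succ, mul_apply_eq_comp, mehlerOp_hermiteVec, map_smul, ih, smul_smul, pow_succ']
  have hmain : (mehlerOp hP hc ^ (n + 1)) (g - ∑ i : Fin (2 * J + 1),
      hermiteFunctional hP i g • hermiteVec hP i) =
      R - ∑ i : Fin (2 * J + 1), hermiteFunctional hP i R • hermiteVec hP i := by
    have h1 : ∀ i : Fin (2 * J + 1), hermiteFunctional hP i R =
        hermiteFunctional hP i G - a i := by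
      intro i
      rw [hR, map_sub, map_sum, Finset.sum_eq_single i]
      · rw [map_smul, hself, smul_eq_mul, mul_one]
      · intro k _ hk
        rw [map_smul, hne i k hk.symm, smul_zero]
      · simp
    simp only [h1, sub_smul, Finset.sum_sub_distrib, map_sub, map_sum, map_smul, hcv, hcl]
    rw [hR, ← hG]
    simp only [mul_smul, smul_comm (hermiteFunctional hP _ g)]
    abel
  rw [hmain]
  have hsum : ‖∑ i : Fin (2 * J + 1), hermiteFunctional hP i R • hermiteVec hP i‖ ≤
      (2 * J + 1 : ℕ) * (M ^ 2 * ‖R‖) := by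
    refine (norm_sum_le _ _).trans ?_
    have : ∀ i ∈ Finset.univ, ‖hermiteFunctional hP (i : Fin (2 * J + 1)) R • hermiteVec hP i‖ ≤
        M ^ 2 * ‖R‖ := by
      intro i _
      rw [norm_smul]
      calc _ ≤ (M * ‖R‖) * M := mul_le_mul (((hermiteFunctional hP i).le_opNorm R).trans
            (mul_le_mul_of_nonneg_right (hMl i) (norm_nonneg _))) (hMe i) (norm_nonneg _)
            (by positivity)
        _ = _ := by ring
    refine (Finset.sum_le_card_nsmul _ _ _ this).trans ?_
    rw [nsmul_eq_mul, Finset.card_univ, Fintype.card_fin]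
  calc _ ≤ ‖R‖ + ‖∑ i : Fin (2 * J + 1), hermiteFunctional hP i R • hermiteVec hP i‖ :=
        norm_sub_le _ _
    _ ≤ (1 + (2 * J + 1 : ℕ) * M ^ 2) * ‖R‖ := by linarith
    _ ≤ (1 + (2 * J + 1 : ℕ) * M ^ 2) * (C * (|c| ^ (J + 1)) ^ (n + 1) * ‖g‖) :=
        mul_le_mul_of_nonneg_left hRn (by positivity)
    _ = (1 + (2 * J + 1 : ℕ) * M ^ 2) * (C * (|c| ^ (J + 1)) ^ (n + 1)) * ‖g‖ := by ring
    _ ≤ _ := mul_le_mul_of_nonneg_right hn2 (norm_nonneg _)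

end MehlerModel

section Circle

lemma norm_coe_le_abs (t : ℝ) : ‖(t : S1)‖ ≤ |t| := by
  rcases le_or_gt |t| Real.pi with h | h
  · refine le_of_eq ((AddCircle.norm_coe_eq_abs_iff (p := 2 * Real.pi) Real.two_pi_pos.ne').2 ?_)
    rwa [abs_of_pos Real.two_pi_pos, mul_div_cancel_left₀ _ two_ne_zero]
  · refine (AddCircle.norm_le_half_period (2 * Real.pi) Real.two_pi_pos.ne').trans ?_
    rw [abs_of_pos Real.two_pi_pos, mul_div_cancel_left₀ _ two_ne_zero]
    exact h.le

lemma norm_coe_eq_abs {t : ℝ} (ht : |t| ≤ Real.pi) : ‖(t : S1)‖ = |t| := by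
  refine (AddCircle.norm_coe_eq_abs_iff (p := 2 * Real.pi) Real.two_pi_pos.ne').2 ?_
  rwa [abs_of_pos Real.two_pi_pos, mul_div_cancel_left₀ _ two_ne_zero]

lemma coe_displacement (x₀ x : S1) : x₀ + (displacement x₀ x : S1) = x := by
  rw [displacement, AddCircle.coe_equivIoc]
  abel

lemma displacement_mem (x₀ x : S1) :
    displacement x₀ x ∈ Set.Ioc (-Real.pi) (-Real.pi + 2 * Real.pi) :=
  (AddCircle.equivIoc (2 * Real.pi) (-Real.pi) (x - x₀)).2

lemma abs_displacement (x₀ x : S1) : |displacement x₀ x| = ‖x - x₀‖ := by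
  obtain ⟨h1, h2⟩ := displacement_mem x₀ x
  have h : |displacement x₀ x| ≤ Real.pi := abs_le.2 ⟨h1.le, by linarith⟩
  rw [← norm_coe_eq_abs h]
  congr 1
  rw [eq_sub_iff_add_eq', coe_displacement]

lemma displacement_coe_add (x₀ : S1) {t : ℝ} (ht : |t| < Real.pi) :
    displacement x₀ (x₀ + (t : S1)) = t := by
  obtain ⟨h1, h2⟩ := abs_lt.1 ht
  rw [displacement, add_sub_cancel_left]
  exact AddCircle.equivIoc_coe_of_mem (a := -Real.pi) (p := 2 * Real.pi) ⟨h1, by linarith⟩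

lemma measurable_displacement (x₀ : S1) : Measurable (displacement x₀) := by
  have h := (AddCircle.measurableEquivIoc (2 * Real.pi) (-Real.pi)).measurable
  exact measurable_subtype_coe.comp (h.comp (measurable_id.sub_const x₀))

lemma exists_lipschitz_Icc {G : ℝ → ℝ} (hG : ContDiff ℝ 1 G) (a b : ℝ) :
    ∃ C > 0, ∀ x ∈ Set.Icc a b, ∀ y ∈ Set.Icc a b, |G y - G x| ≤ C * |y - x| := by
  have hd : Continuous (deriv G) := hG.continuous_deriv le_rfl
  obtain ⟨C, hC⟩ := (isCompact_Icc (a := a) (b := b)).exists_bound_of_continuousOn hd.continuousOn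
  refine ⟨max C 1, by positivity, fun x hx y hy => ?_⟩
  exact Convex.norm_image_sub_le_of_norm_deriv_le (𝕜 := ℝ)
    (fun z _ => (hG.differentiable (by norm_num)).differentiableAt)
    (fun z hz => (hC z hz).trans (le_max_left _ _)) (convex_Icc a b) hx hy

lemma exists_quadratic_remainder {G : ℝ → ℝ} (hG : ContDiff ℝ ∞ G) (s : ℝ) :
    ∃ C > 0, ∀ x, |x| ≤ 1 → |G (s + x) - G s - deriv G s * x| ≤ C * x ^ 2 := by
  have hG' : ContDiff ℝ ∞ (deriv G) := (contDiff_infty_iff_deriv.1 hG).2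
  have hdiff : Differentiable ℝ G := (contDiff_infty_iff_deriv.1 hG).1
  obtain ⟨C, hC, h⟩ := exists_lipschitz_Icc (hG'.of_le (by exact_mod_cast le_top)) (s - 1) (s + 1)
  refine ⟨C, hC, fun x hx => ?_⟩
  have hd : ∀ t, HasDerivAt (fun t => G (s + t) - deriv G s * t) (deriv G (s + t) - deriv G s) t := by
    intro t
    have h1 : HasDerivAt (fun t => G (s + t)) (deriv G (s + t)) t :=
      (hdiff (s + t)).hasDerivAt.comp_const_add s t
    have h2 : HasDerivAt (fun t => deriv G s * t) (deriv G s) t := by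
      simpa using (hasDerivAt_id t).const_mul (deriv G s)
    exact h1.sub h2
  have hx' := abs_le.1 hx
  have key := Convex.norm_image_sub_le_of_norm_deriv_le (𝕜 := ℝ)
    (f := fun t => G (s + t) - deriv G s * t) (C := C * |x|) (s := Set.Icc (-|x|) |x|) (x := 0)
    (y := x) (fun t _ => (hd t).differentiableAt)
    (fun t ht => by
      have ht' := abs_le.2 ht
      rw [(hd t).deriv, Real.norm_eq_abs]
      have h2 := abs_le.1 (ht'.trans hx)
      have := h s ⟨by linarith, by linarith⟩ (s + t) ⟨by linarith, by linarith⟩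
      rw [add_sub_cancel_left] at this
      exact this.trans (mul_le_mul_of_nonneg_left ht' hC.le))
    (convex_Icc _ _) ⟨by linarith [abs_nonneg x], abs_nonneg x⟩ (abs_le.1 le_rfl)
  simp only [Real.norm_eq_abs, add_zero, mul_zero, sub_zero] at key
  rw [mul_assoc, abs_mul_abs_self, ← sq] at key
  convert key using 2
  ring

lemma exists_lipschitz_circle (f : C(S1, S1)) (F : ℝ → ℝ) (hF : ContDiff ℝ ∞ F)
    (hfF : ∀ t : ℝ, f (t : S1) = (F t : S1)) :
    ∃ C > 0, ∀ x t : S1, ‖f (x + t) - f x‖ ≤ C * ‖t‖ := by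
  obtain ⟨C, hC, h⟩ := exists_lipschitz_Icc (hF.of_le (by exact_mod_cast le_top))
    (-Real.pi - Real.pi) (Real.pi + Real.pi)
  refine ⟨C, hC, fun x t => ?_⟩
  have hx := coe_displacement 0 x
  have ht := coe_displacement 0 t
  have hx1 := displacement_mem 0 x
  have ht1 := displacement_mem 0 t
  have ht2 := abs_displacement 0 t
  rw [zero_add] at hx ht
  rw [sub_zero] at ht2
  obtain ⟨a, ha⟩ : ∃ a, a = displacement 0 x := ⟨_, rfl⟩
  obtain ⟨b, hb⟩ : ∃ b, b = displacement 0 t := ⟨_, rfl⟩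
  rw [← ha] at hx hx1
  rw [← hb] at ht ht1 ht2
  rw [← hx, ← ht2, ← ht, ← AddCircle.coe_add, hfF, hfF, ← AddCircle.coe_sub]
  refine (norm_coe_le_abs _).trans ?_
  have hpi := Real.pi_pos
  have := h a ⟨by linarith [hx1.1], by linarith [hx1.2]⟩ (a + b)
    ⟨by linarith [hx1.1, ht1.1], by linarith [hx1.2, ht1.2]⟩
  rwa [add_sub_cancel_left] at this

/-- The maximum of `θ⁻ⁿ d(fⁿ x, x₀)` over `n ≤ k`. -/
noncomputable def adaptedDist (f : C(S1, S1)) (x₀ : S1) (θ : ℝ) : ℕ → S1 → ℝ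
  | 0, x => ‖x - x₀‖
  | k + 1, x => max ‖x - x₀‖ (θ⁻¹ * adaptedDist f x₀ θ k (f x))

lemma le_adaptedDist (f : C(S1, S1)) (x₀ : S1) (θ : ℝ) (k : ℕ) (x : S1) :
    ‖x - x₀‖ ≤ adaptedDist f x₀ θ k x := by
  cases k with
  | zero => exact le_rfl
  | succ k => exact le_max_left _ _

lemma adaptedDist_lipschitz {f : C(S1, S1)} {K : ℝ}
    (hf : ∀ x t : S1, ‖f (x + t) - f x‖ ≤ K * ‖t‖) (x₀ : S1) {θ : ℝ} (hθ : 0 < θ) (k : ℕ) :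
    ∃ b, 1 ≤ b ∧ ∀ x t : S1, adaptedDist f x₀ θ k (x + t) ≤ adaptedDist f x₀ θ k x + b * ‖t‖ := by
  have h0 : ∀ x t : S1, ‖x + t - x₀‖ ≤ ‖x - x₀‖ + ‖t‖ := by
    intro x t
    have := norm_add_le (x - x₀) t
    rwa [sub_add_eq_add_sub] at this
  induction k with
  | zero => exact ⟨1, le_rfl, fun x t => by simpa [adaptedDist] using h0 x t⟩
  | succ k ih =>
    obtain ⟨b, hb, h⟩ := ih
    refine ⟨max 1 (θ⁻¹ * (b * K)), le_max_left _ _, fun x t => max_le ?_ ?_⟩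
    · exact (h0 x t).trans (add_le_add (le_max_left _ _)
        (le_mul_of_one_le_left (norm_nonneg _) (le_max_left _ _)))
    · have h1 := h (f x) (f (x + t) - f x)
      rw [add_sub_cancel] at h1
      have h2 := mul_le_mul_of_nonneg_left (hf x t) (zero_le_one.trans hb)
      have h3 := mul_le_mul_of_nonneg_left (h1.trans (add_le_add le_rfl h2)) (inv_nonneg.2 hθ.le)
      refine h3.trans ?_
      rw [mul_add]
      refine add_le_add (le_max_right _ _) ?_
      calc θ⁻¹ * (b * (K * ‖t‖)) = θ⁻¹ * (b * K) * ‖t‖ := by ring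
        _ ≤ _ := mul_le_mul_of_nonneg_right (le_max_right _ _) (norm_nonneg _)

lemma adaptedDist_succ_le (f : C(S1, S1)) (x₀ : S1) {θ : ℝ} (hθ : 0 < θ) (k : ℕ) (x : S1) :
    adaptedDist f x₀ θ (k + 1) x ≤
      max (adaptedDist f x₀ θ k x) ((θ ^ (k + 1))⁻¹ * ‖f^[k + 1] x - x₀‖) := by
  induction k generalizing x with
  | zero => simp [adaptedDist]
  | succ k ih =>
    refine max_le ((le_max_left _ _).trans (le_max_left _ _)) ?_
    refine (mul_le_mul_of_nonneg_left (ih (f x)) (inv_nonneg.2 hθ.le)).trans ?_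
    rw [mul_max_of_nonneg _ _ (inv_nonneg.2 hθ.le)]
    refine max_le_max (le_max_right _ _) (le_of_eq ?_)
    rw [← Function.iterate_succ_apply, pow_succ θ (k + 1), mul_inv]
    ring

lemma adaptedDist_eq {f : C(S1, S1)} {x₀ : S1} {θ r : ℝ} (hθ : 0 < θ) (hθ1 : θ < 1)
    (hf : ∀ x, ‖x - x₀‖ < r → ‖f x - x₀‖ ≤ θ * ‖x - x₀‖) (k : ℕ) {x : S1} (hx : ‖x - x₀‖ < r) :
    adaptedDist f x₀ θ k x = ‖x - x₀‖ := by
  induction k generalizing x with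
  | zero => rfl
  | succ k ih =>
    have h1 := hf x hx
    have h2 : ‖f x - x₀‖ < r :=
      (h1.trans (mul_le_of_le_one_left (norm_nonneg _) hθ1.le)).trans_lt hx
    rw [adaptedDist, ih h2]
    refine max_eq_left ?_
    rw [inv_mul_le_iff₀ hθ]
    exact h1

/-- The data of the local dynamics near the stable fixed point that the spectral estimates use. -/
structure AdaptedMetric (f : C(S1, S1)) (F : ℝ → ℝ) (σ : C(S1, ℝ)) (s δ : ℝ) (θ b r₀ D : ℝ)
    (ρ : S1 → ℝ) : Prop where
  theta_pos : 0 < θ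
  theta_lt : θ < 1
  abs_deriv_le : |deriv F s| ≤ θ
  one_le : 1 ≤ b
  radius_pos : 0 < r₀
  radius_le : r₀ ≤ δ
  radius_lt_pi : r₀ < Real.pi
  const_pos : 0 < D
  le : ∀ x, ‖x - (s : S1)‖ ≤ ρ x
  eq : ∀ x, ‖x - (s : S1)‖ < r₀ → ρ x = ‖x - (s : S1)‖
  lipschitz : ∀ x t : S1, ρ (x + t) ≤ ρ x + b * ‖t‖
  contract : ∀ x ∈ Metric.ball (s : S1) δ, ρ (f x) ≤ θ * ρ x
  lift_contract : ∀ x, |x| < r₀ → |F (s + x) - F s| ≤ θ * |x|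
  lift_taylor : ∀ x, |x| < r₀ → |F (s + x) - F s - deriv F s * x| ≤ D * x ^ 2
  noise_lipschitz : ∀ x : ℝ, |x| < r₀ →
    |σ ((s : S1) + (x : S1)) - σ (s : S1)| ≤ D * |x|

theorem exists_adaptedMetric (f : C(S1, S1)) (F : ℝ → ℝ) (hF : ContDiff ℝ ∞ F)
    (hfF : ∀ t : ℝ, f (t : S1) = (F t : S1))
    (σ : C(S1, ℝ)) (hσ : ContDiff ℝ ∞ (fun t : ℝ => σ (t : S1)))
    (s u : ℝ) (hs : f (s : S1) = (s : S1)) (hcs : |deriv F s| < 1)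
    (hattr : ∀ x : S1, x ≠ (u : S1) → Tendsto (fun n : ℕ => f^[n] x) atTop (𝓝 (s : S1)))
    (δ η : ℝ) (hδ : 0 < δ) (hη : 0 < η) (huV : (u : S1) ∉ Metric.ball (s : S1) δ)
    (hV : ∀ x ∈ Metric.ball (s : S1) δ, η < Metric.infDist (f x) (Metric.ball (s : S1) δ)ᶜ) :
    ∃ (θ b r₀ D : ℝ) (ρ : S1 → ℝ), AdaptedMetric f F σ s δ θ b r₀ D ρ := by
  obtain ⟨θ', hθ'1, hθ'2⟩ := exists_between hcs
  obtain ⟨θ, hθ1, hθ2⟩ := exists_between hθ'2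
  have hθ'0 : 0 < θ' := (abs_nonneg _).trans_lt hθ'1
  have hθ0 : 0 < θ := hθ'0.trans hθ1
  obtain ⟨D₁, hD₁, hquad⟩ := exists_quadratic_remainder hF s
  obtain ⟨D₂, hD₂, hlipσ⟩ := exists_lipschitz_Icc (hσ.of_le (by exact_mod_cast le_top))
    (s - 1) (s + 1)
  obtain ⟨K, hK, hlip⟩ := exists_lipschitz_circle f F hF hfF
  obtain ⟨r₀, hr₀⟩ : ∃ r₀, r₀ = min (min 1 δ) ((θ' - |deriv F s|) / D₁) := ⟨_, rfl⟩
  have hr0 : 0 < r₀ := by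
    rw [hr₀]
    exact lt_min (lt_min one_pos hδ) (div_pos (sub_pos.2 hθ'1) hD₁)
  have hr1 : r₀ ≤ 1 := by rw [hr₀]; exact (min_le_left _ _).trans (min_le_left _ _)
  have hrδ : r₀ ≤ δ := by rw [hr₀]; exact (min_le_left _ _).trans (min_le_right _ _)
  have hrD : D₁ * r₀ ≤ θ' - |deriv F s| := by
    rw [mul_comm, ← le_div_iff₀ hD₁, hr₀]
    exact min_le_right _ _
  have hrpi : r₀ < Real.pi := hr1.trans_lt (by linarith [Real.pi_gt_three])
  have hliftc : ∀ x, |x| < r₀ → |F (s + x) - F s| ≤ θ' * |x| := by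
    intro x hx
    have h1 := hquad x (hx.le.trans hr1)
    have h2 : |F (s + x) - F s| ≤ |F (s + x) - F s - deriv F s * x| + |deriv F s * x| := by
      have := abs_add_le (F (s + x) - F s - deriv F s * x) (deriv F s * x)
      rwa [sub_add_cancel] at this
    rw [abs_mul] at h2
    have h3 : D₁ * x ^ 2 ≤ (θ' - |deriv F s|) * |x| := by
      rw [← sq_abs x, sq, ← mul_assoc]
      exact mul_le_mul_of_nonneg_right
        ((mul_le_mul_of_nonneg_left hx.le hD₁.le).trans hrD) (abs_nonneg x)
    linarith
  have hloc : ∀ x : S1, ‖x - s‖ < r₀ → ‖f x - s‖ ≤ θ' * ‖x - s‖ := by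
    intro x hx
    rw [← abs_displacement] at hx
    rw [← abs_displacement (s : S1) x]
    refine le_trans ?_ (hliftc _ hx)
    have h1 : f x - s = ((F (s + displacement s x) - F s : ℝ) : S1) := by
      rw [AddCircle.coe_sub, ← hfF, ← hfF, hs, AddCircle.coe_add, coe_displacement]
    rw [h1]
    exact norm_coe_le_abs _
  have hball : ∀ x : S1, ‖x - s‖ < r₀ → ‖f x - s‖ < r₀ := fun x hx =>
    ((hloc x hx).trans (mul_le_of_le_one_left (norm_nonneg _) hθ'2.le)).trans_lt hx
  -- points of the arc enter the small ball after a uniform number of steps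
  obtain ⟨p, hp⟩ : ∃ p : ℕ, ∀ x ∈ Metric.ball (s : S1) δ, ‖f^[p] x - s‖ < r₀ := by
    obtain ⟨E, hE⟩ : ∃ E : Set S1, E = {y | η ≤ Metric.infDist y (Metric.ball (s : S1) δ)ᶜ} :=
      ⟨_, rfl⟩
    have hEc : IsCompact E := by
      rw [hE]
      exact (isClosed_le continuous_const (Metric.continuous_infDist_pt _)).isCompact
    have hEu : ∀ y ∈ E, y ≠ (u : S1) := by
      rintro y hy rfl
      rw [hE, Set.mem_ofPred_eq, Metric.infDist_zero_of_mem huV] at hy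
      linarith
    have hopen : ∀ n : ℕ, IsOpen {y : S1 | ‖f^[n] y - s‖ < r₀} := fun n =>
      isOpen_lt (((f.continuous.iterate n).sub continuous_const).norm) continuous_const
    have hmono : Monotone fun n : ℕ => {y : S1 | ‖f^[n] y - s‖ < r₀} := by
      refine monotone_nat_of_le_succ fun n y hy => ?_
      rw [Set.mem_ofPred_eq, Function.iterate_succ_apply']
      exact hball _ hy
    have hcover : E ⊆ ⋃ n : ℕ, {y : S1 | ‖f^[n] y - s‖ < r₀} := by
      intro y hy
      have h1 := (hattr y (hEu y hy)).eventually (Metric.ball_mem_nhds _ hr0)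
      obtain ⟨n, hn⟩ := h1.exists
      refine Set.mem_iUnion.2 ⟨n, ?_⟩
      rwa [dist_eq_norm] at hn
    obtain ⟨n, hn⟩ := hEc.elim_directed_cover _ hopen hcover hmono.directed_le
    refine ⟨n + 1, fun x hx => ?_⟩
    rw [Function.iterate_succ_apply]
    exact hn (by rw [hE]; exact (hV x hx).le)
  have hiter : ∀ n : ℕ, ∀ x : S1, ‖f^[n] x - s‖ ≤ K ^ n * ‖x - s‖ := by
    intro n
    induction n with
    | zero => intro x; simp
    | succ n ih =>
      intro x
      rw [Function.iterate_succ_apply']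
      have h1 := hlip (s : S1) (f^[n] x - s)
      rw [add_sub_cancel, hs] at h1
      refine h1.trans ?_
      rw [pow_succ', mul_assoc]
      exact mul_le_mul_of_nonneg_left (ih x) hK.le
  have hiter2 : ∀ q : ℕ, ∀ x : S1, ‖x - s‖ < r₀ →
      ‖f^[q] x - s‖ < r₀ ∧ ‖f^[q] x - s‖ ≤ θ' ^ q * ‖x - s‖ := by
    intro q
    induction q with
    | zero => intro x hx; simpa using hx
    | succ q ih =>
      intro x hx
      obtain ⟨h1, h2⟩ := ih x hx
      rw [Function.iterate_succ_apply']
      refine ⟨hball _ h1, (hloc _ h1).trans ?_⟩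
      rw [pow_succ', mul_assoc]
      exact mul_le_mul_of_nonneg_left h2 hθ'0.le
  obtain ⟨q, hq⟩ : ∃ q : ℕ, (θ' / θ) ^ q < θ ^ (p + 1) / (K ^ p * 1) :=
    exists_pow_lt_of_lt_one (by positivity) ((div_lt_one hθ0).2 hθ1)
  have hfinal : ∀ x ∈ Metric.ball (s : S1) δ,
      ‖f^[p + q + 1] x - s‖ ≤ θ ^ (p + q + 1) * ‖x - s‖ := by
    intro x hx
    have h1 : f^[p + q + 1] x = f^[q + 1] (f^[p] x) := by
      rw [← Function.iterate_add_apply, add_comm (q + 1) p, add_assoc]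
    have h2 := (hiter2 (q + 1) _ (hp x hx)).2
    rw [h1]
    refine h2.trans ((mul_le_mul_of_nonneg_left (hiter p x) (by positivity)).trans ?_)
    rw [← mul_assoc]
    refine mul_le_mul_of_nonneg_right ?_ (norm_nonneg _)
    rw [mul_one, div_pow, div_lt_div_iff₀ (by positivity) (by positivity)] at hq
    calc θ' ^ (q + 1) * K ^ p ≤ θ' ^ q * K ^ p := by
          refine mul_le_mul_of_nonneg_right ?_ (by positivity)
          exact pow_le_pow_of_le_one hθ'0.le hθ'2.le (Nat.le_succ q)
      _ ≤ θ ^ (p + 1) * θ ^ q := hq.le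
      _ = _ := by rw [← pow_add]; congr 1; omega
  obtain ⟨b, hb, hρlip⟩ := adaptedDist_lipschitz hlip (s : S1) hθ0 (p + q)
  have hloc' : ∀ x : S1, ‖x - s‖ < r₀ → ‖f x - s‖ ≤ θ * ‖x - s‖ := fun x hx =>
    (hloc x hx).trans (mul_le_mul_of_nonneg_right hθ1.le (norm_nonneg _))
  refine ⟨θ, b, r₀, max D₁ D₂, adaptedDist f s θ (p + q), hθ0, hθ2, (hθ'1.trans hθ1).le, hb, hr0,
    hrδ, hrpi, hD₁.trans_le (le_max_left _ _), le_adaptedDist _ _ _ _,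
    fun x hx => adaptedDist_eq hθ0 hθ2 hloc' _ hx, hρlip, fun x hx => ?_,
    fun x hx => (hliftc x hx).trans (mul_le_mul_of_nonneg_right hθ1.le (abs_nonneg _)),
    fun x hx => (hquad x (hx.le.trans hr1)).trans
      (mul_le_mul_of_nonneg_right (le_max_left _ _) (sq_nonneg _)), fun x hx => ?_⟩
  · have h1 := adaptedDist_succ_le f s hθ0 (p + q) x
    have h2 : (θ ^ (p + q + 1))⁻¹ * ‖f^[p + q + 1] x - s‖ ≤ adaptedDist f s θ (p + q) x := by
      rw [inv_mul_le_iff₀ (by positivity)]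
      exact (hfinal x hx).trans
        (mul_le_mul_of_nonneg_left (le_adaptedDist _ _ _ _ _) (by positivity))
    rw [max_eq_left h2] at h1
    have h3 : θ⁻¹ * adaptedDist f s θ (p + q) (f x) ≤ adaptedDist f s θ (p + q + 1) x :=
      le_max_right _ _
    exact (inv_mul_le_iff₀ hθ0).1 (h3.trans h1)
  · have h1 := abs_le.1 (hx.le.trans hr1)
    have := hlipσ s ⟨by linarith, by linarith⟩ (s + x) ⟨by linarith, by linarith⟩
    rw [add_sub_cancel_left, AddCircle.coe_add] at this
    exact this.trans (mul_le_mul_of_nonneg_right (le_max_right _ _) (abs_nonneg _))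

end Circle

section Wrapping

lemma exists_lintegral_wrap_le {β : ℝ} (hβ : 0 < β) :
    ∃ C > (0 : ℝ), ∀ (H : S1 → ENNReal) (a : S1),
      ∫⁻ t : ℝ, H (a + (t : S1)) * ENNReal.ofReal (Real.exp (-β * t ^ 2)) ≤
        ENNReal.ofReal C * ∫⁻ x, H x := by
  have hsum : Summable fun n : ℤ => Real.exp (-β * |(n : ℝ)|) := by
    have h := Real.summable_pow_mul_exp_neg_nat_mul 0 hβ
    simp only [pow_zero, one_mul] at h
    refine Summable.of_nat_of_neg ?_ ?_ <;> simpa using h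
  refine ⟨∑' n : ℤ, Real.exp (-β * |(n : ℝ)|),
    hsum.tsum_pos (fun n => (Real.exp_pos _).le) 0 (Real.exp_pos _), fun H a => ?_⟩
  have hcov := iUnion_Ioc_add_zsmul Real.two_pi_pos (-Real.pi)
  have hdis := Set.pairwise_disjoint_Ioc_add_zsmul (-Real.pi) (2 * Real.pi)
  rw [← setLIntegral_univ, ← hcov, lintegral_iUnion (fun _ => measurableSet_Ioc) hdis,
    ENNReal.ofReal_tsum_of_nonneg (fun _ => (Real.exp_pos _).le) hsum, ← ENNReal.tsum_mul_right]
  refine ENNReal.tsum_le_tsum fun n => ?_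
  have hpi := Real.pi_gt_three
  have hpt : ∀ t ∈ Set.Ioc (-Real.pi + n • (2 * Real.pi)) (-Real.pi + (n + 1) • (2 * Real.pi)),
      H (a + (t : S1)) * ENNReal.ofReal (Real.exp (-β * t ^ 2)) ≤
        ENNReal.ofReal (Real.exp (-β * |(n : ℝ)|)) * H (a + (t : S1)) := by
    rintro t ⟨h1, h2⟩
    rw [mul_comm]
    refine mul_le_mul_left (ENNReal.ofReal_le_ofReal (Real.exp_le_exp.2 ?_)) _
    rw [neg_mul, neg_mul, neg_le_neg_iff]
    refine mul_le_mul_of_nonneg_left ?_ hβ.le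
    simp only [zsmul_eq_mul, Int.cast_add, Int.cast_one] at h1 h2
    rcases lt_trichotomy n 0 with hn | hn | hn
    · have h3 : (n : ℝ) ≤ -1 := by exact_mod_cast Int.le_sub_one_of_lt hn
      rw [abs_of_neg (by linarith)]
      have h4 : t ≤ n := by nlinarith
      nlinarith
    · rw [hn]
      simp [sq_nonneg]
    · have h3 : (1 : ℝ) ≤ n := by exact_mod_cast hn
      rw [abs_of_pos (by linarith)]
      have h4 : (n : ℝ) ≤ t := by nlinarith
      nlinarith
  refine (setLIntegral_mono' measurableSet_Ioc hpt).trans ?_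
  rw [lintegral_const_mul' _ _ ENNReal.ofReal_ne_top]
  refine mul_le_mul_right (le_of_eq ?_) _
  have e : -Real.pi + (n + 1) • (2 * Real.pi) = (-Real.pi + n • (2 * Real.pi)) + 2 * Real.pi := by
    rw [add_smul, one_smul, add_assoc]
  rw [e, AddCircle.lintegral_preimage (2 * Real.pi) _ (fun b => H (a + b)),
    lintegral_add_left_eq_self]

/-- Folding a Gaussian-weighted integral over the line to an integral over the circle. -/
lemma exists_integral_wrap_le {β : ℝ} (hβ : 0 < β) :
    ∃ C > (0 : ℝ), ∀ (H : S1 → ℝ), Measurable H → (∀ x, 0 ≤ H x) → (∃ B, ∀ x, H x ≤ B) →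
      ∀ (a : S1) (ε : ℝ), 0 < ε → ε ≤ 1 →
        Integrable (fun u : ℝ => H (a + ((ε * u : ℝ) : S1)) * Real.exp (-β * u ^ 2)) ∧
        ∫ u : ℝ, H (a + ((ε * u : ℝ) : S1)) * Real.exp (-β * u ^ 2) ≤ C * (ε⁻¹ * ∫ x, H x) := by
  obtain ⟨C, hC, h⟩ := exists_lintegral_wrap_le hβ
  refine ⟨C, hC, fun H hH h0 hB a ε hε hε1 => ?_⟩
  obtain ⟨B, hB⟩ := hB
  have hcoe : Measurable fun t : ℝ => a + (t : S1) :=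
    (continuous_const.add (AddCircle.continuous_mk' _)).measurable
  have hint : ∀ b > 0, Integrable fun t : ℝ => H (a + (t : S1)) * Real.exp (-b * t ^ 2) := by
    intro b hb
    refine ((integrable_exp_neg_mul_sq hb).const_mul B).mono'
      ((hH.comp hcoe).mul (by fun_prop)).aestronglyMeasurable (Eventually.of_forall fun t => ?_)
    rw [Real.norm_of_nonneg (mul_nonneg (h0 _) (Real.exp_pos _).le)]
    exact mul_le_mul_of_nonneg_right (hB _) (Real.exp_pos _).le
  have hH1 : Integrable H := by
    refine Integrable.of_bound hH.aestronglyMeasurable B (Eventually.of_forall fun x => ?_)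
    rw [Real.norm_of_nonneg (h0 x)]
    exact hB x
  have e : ∀ u : ℝ, H (a + ((ε * u : ℝ) : S1)) * Real.exp (-β * u ^ 2) =
      (fun t : ℝ => H (a + (t : S1)) * Real.exp (-(β / ε ^ 2) * t ^ 2)) (ε * u) := by
    intro u
    simp only
    congr 2
    field_simp
  simp only [e]
  refine ⟨(hint _ (by positivity)).comp_mul_left' hε.ne', ?_⟩
  rw [Measure.integral_comp_mul_left
    (fun t : ℝ => H (a + (t : S1)) * Real.exp (-(β / ε ^ 2) * t ^ 2)) ε, abs_of_pos (inv_pos.2 hε), smul_eq_mul, mul_left_comm C]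
  refine mul_le_mul_of_nonneg_left ?_ (inv_pos.2 hε).le
  have h1 : ∫ t : ℝ, H (a + (t : S1)) * Real.exp (-(β / ε ^ 2) * t ^ 2) ≤
      ∫ t : ℝ, H (a + (t : S1)) * Real.exp (-β * t ^ 2) := by
    refine integral_mono (hint _ (by positivity)) (hint _ hβ) fun t => ?_
    refine mul_le_mul_of_nonneg_left (Real.exp_le_exp.2 ?_) (h0 _)
    have : β ≤ β / ε ^ 2 := le_div_self hβ.le (by positivity) (pow_le_one₀ hε.le hε1)
    nlinarith [sq_nonneg t]
  refine h1.trans ?_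
  have h2 := h (fun x => ENNReal.ofReal (H x)) a
  simp only [← ENNReal.ofReal_mul (h0 _)] at h2
  rw [← ofReal_integral_eq_lintegral_ofReal (hint _ hβ)
    (Eventually.of_forall fun t => mul_nonneg (h0 _) (Real.exp_pos _).le),
    ← ofReal_integral_eq_lintegral_ofReal hH1 (Eventually.of_forall h0),
    ← ENNReal.ofReal_mul hC.le] at h2
  exact (ENNReal.ofReal_le_ofReal_iff (mul_nonneg hC.le (integral_nonneg h0))).1 h2

/-- The centred Gaussian density with standard deviation `σ`. -/
noncomputable def gaussDensity (σ v : ℝ) : ℝ :=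
  (σ * Real.sqrt (2 * Real.pi))⁻¹ * Real.exp (-v ^ 2 / (2 * σ ^ 2))

lemma gaussDensity_nonneg {σ : ℝ} (hσ : 0 < σ) (v : ℝ) : 0 ≤ gaussDensity σ v := by
  unfold gaussDensity; positivity

lemma continuous_gaussDensity (σ : ℝ) : Continuous (gaussDensity σ) := by
  unfold gaussDensity; fun_prop

lemma mehlerKernel_eq_gaussDensity {c σ : ℝ} (hσ : 0 < σ) (h : σ ^ 2 = (1 - c ^ 2) / 2)
    (y u : ℝ) : mehlerKernel c y u = gaussDensity σ (u - c * y) := by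
  have h1 : 1 - c ^ 2 = 2 * σ ^ 2 := by linarith
  unfold mehlerKernel gaussDensity
  rw [h1, show Real.pi * (2 * σ ^ 2) = σ ^ 2 * (2 * Real.pi) by ring,
    Real.sqrt_mul (sq_nonneg σ), Real.sqrt_sq hσ.le]
  congr 2
  field_simp

lemma transition_eq_integral (f : C(S1, S1)) (σ : C(S1, ℝ)) (ε : ℝ) (φ : S1 → ℂ)
    (hφ : Measurable φ) (x : S1) (hσ : 0 < σ x) :
    transition f σ ε φ x =
      ∫ v : ℝ, φ (f x + ((ε * v : ℝ) : S1)) * (gaussDensity (σ x) v : ℂ) := by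
  have hv : NNReal.mk (σ x ^ 2) (sq_nonneg _) ≠ 0 := fun h =>
    (pow_pos hσ 2).ne' (congrArg NNReal.toReal h)
  have hm : Measurable fun v : ℝ => φ (f x + ((ε * v : ℝ) : S1)) := by
    refine hφ.comp (Continuous.measurable ?_)
    exact continuous_const.add ((AddCircle.continuous_mk' _).comp (by fun_prop))
  have hmap := gaussianReal_map_const_mul (μ := 0) (v := 1) (σ x)
  rw [mul_zero, mul_one] at hmap
  have h1 : transition f σ ε φ x =
      ∫ v, φ (f x + ((ε * v : ℝ) : S1)) ∂(gaussianReal 0 (.mk (σ x ^ 2) (sq_nonneg _))) := by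
    rw [← hmap, integral_map (by fun_prop) hm.aestronglyMeasurable]
    simp only [transition, mul_assoc]
  rw [h1, integral_gaussianReal_eq_integral_smul hv]
  refine integral_congr_ae (Eventually.of_forall fun v => ?_)
  simp only [gaussianPDFReal, gaussDensity, Complex.real_smul, sub_zero]
  rw [mul_comm]
  congr 3
  change (Real.sqrt (2 * Real.pi * σ x ^ 2))⁻¹ = _
  rw [mul_comm, Real.sqrt_mul (sq_nonneg _), Real.sqrt_sq hσ.le]

end Wrapping

section GaussianComparison

lemma abs_exp_neg_sub_exp_neg_le (a b : ℝ) :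
    |Real.exp (-a) - Real.exp (-b)| ≤ |a - b| * (Real.exp (-a) + Real.exp (-b)) := by
  wlog h : a ≤ b generalizing a b
  · have := this b a (le_of_not_ge h)
    rwa [abs_sub_comm, abs_sub_comm b a, add_comm] at this
  have h1 : Real.exp (-b) ≤ Real.exp (-a) := Real.exp_le_exp.2 (by linarith)
  rw [abs_of_nonneg (sub_nonneg.2 h1), abs_of_nonpos (by linarith)]
  have h2 : Real.exp (-b) = Real.exp (-a) * Real.exp (a - b) := by
    rw [← Real.exp_add]; ring_nf
  have h3 := Real.add_one_le_exp (a - b)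
  have h4 := Real.exp_pos (-a)
  have h5 := Real.exp_pos (-b)
  have h6 : Real.exp (-a) - Real.exp (-b) ≤ Real.exp (-a) * (b - a) := by
    rw [h2]
    nlinarith
  nlinarith

lemma exists_sq_one_add_le {τ : ℝ} (hτ : 0 < τ) :
    ∃ C > 0, ∀ s : ℝ, 0 ≤ s → (1 + s) ^ 2 ≤ C * Real.exp (τ * s) := by
  refine ⟨max 1 (2 / τ) ^ 2, by positivity, fun s hs => ?_⟩
  have h1 : 1 + s ≤ max 1 (2 / τ) * (1 + τ / 2 * s) := by
    have ha := le_max_left 1 (2 / τ)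
    have hb := mul_le_mul_of_nonneg_right (le_max_right 1 (2 / τ)) (by positivity : 0 ≤ τ / 2 * s)
    have hc : 2 / τ * (τ / 2 * s) = s := by field_simp
    rw [hc] at hb
    linarith
  have h2 : 1 + τ / 2 * s ≤ Real.exp (τ / 2 * s) := by
    linarith [Real.add_one_le_exp (τ / 2 * s)]
  have h3 : 1 + s ≤ max 1 (2 / τ) * Real.exp (τ / 2 * s) :=
    h1.trans (mul_le_mul_of_nonneg_left h2 (by positivity))
  refine (pow_le_pow_left₀ (by positivity) h3 2).trans (le_of_eq ?_)
  rw [mul_pow, ← Real.exp_nat_mul]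
  congr 2
  push_cast
  ring

/-- Two Gaussian densities with nearby parameters. -/
lemma abs_gaussDensity_sub_le {m S σ₁ σ₀ v₁ v₀ A : ℝ} (hm : 0 < m) (h₁ : m ≤ σ₁) (h₀ : m ≤ σ₀)
    (h₁' : σ₁ ≤ S) (h₀' : σ₀ ≤ S) (hA₁ : Real.exp (-v₁ ^ 2 / (2 * σ₁ ^ 2)) ≤ A)
    (hA₀ : Real.exp (-v₀ ^ 2 / (2 * σ₀ ^ 2)) ≤ A) :
    |gaussDensity σ₁ v₁ - gaussDensity σ₀ v₀| ≤
      (m⁻¹ ^ 2 * |σ₁ - σ₀| + m⁻¹ * (m⁻¹ ^ 2 * (|v₁ - v₀| * (|v₁| + |v₀|)) +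
        m⁻¹ ^ 4 * (2 * S) * (|σ₁ - σ₀| * v₀ ^ 2))) * (2 * A) := by
  have p₁ : 0 < σ₁ := hm.trans_le h₁
  have p₀ : 0 < σ₀ := hm.trans_le h₀
  have hA : 0 < A := (Real.exp_pos _).trans_le hA₁
  have hS : 0 < S := p₁.trans_le h₁'
  have i₁ : σ₁⁻¹ ≤ m⁻¹ := inv_anti₀ hm h₁
  have i₀ : σ₀⁻¹ ≤ m⁻¹ := inv_anti₀ hm h₀
  have hk : 1 ≤ Real.sqrt (2 * Real.pi) := Real.one_le_sqrt.2 (by linarith [Real.pi_gt_three])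
  have hk' : (Real.sqrt (2 * Real.pi))⁻¹ ≤ 1 := inv_le_one_of_one_le₀ hk
  obtain ⟨w, hw⟩ : ∃ w, w = (Real.sqrt (2 * Real.pi))⁻¹ := ⟨_, rfl⟩
  have hw0 : 0 ≤ w := by rw [hw]; positivity
  rw [← hw] at hk'
  have hdec : gaussDensity σ₁ v₁ - gaussDensity σ₀ v₀ =
      w * ((σ₁⁻¹ - σ₀⁻¹) * Real.exp (-v₀ ^ 2 / (2 * σ₀ ^ 2)) +
        σ₁⁻¹ * (Real.exp (-v₁ ^ 2 / (2 * σ₁ ^ 2)) - Real.exp (-v₀ ^ 2 / (2 * σ₀ ^ 2)))) := by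
    unfold gaussDensity
    rw [mul_inv, mul_inv, ← hw]
    ring
  have e1 : |σ₁⁻¹ - σ₀⁻¹| ≤ m⁻¹ ^ 2 * |σ₁ - σ₀| := by
    have : σ₁⁻¹ - σ₀⁻¹ = (σ₁⁻¹ * σ₀⁻¹) * (σ₀ - σ₁) := by field_simp
    rw [this, abs_mul, abs_of_nonneg (by positivity), abs_sub_comm, sq]
    exact mul_le_mul_of_nonneg_right (mul_le_mul i₁ i₀ (by positivity) (by positivity))
      (abs_nonneg _)
  have e2 : |v₁ ^ 2 / (2 * σ₁ ^ 2) - v₀ ^ 2 / (2 * σ₀ ^ 2)| ≤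
      m⁻¹ ^ 2 * (|v₁ - v₀| * (|v₁| + |v₀|)) + m⁻¹ ^ 4 * (2 * S) * (|σ₁ - σ₀| * v₀ ^ 2) := by
    have : v₁ ^ 2 / (2 * σ₁ ^ 2) - v₀ ^ 2 / (2 * σ₀ ^ 2) =
        (σ₁⁻¹ ^ 2 / 2) * ((v₁ - v₀) * (v₁ + v₀)) +
        (σ₁⁻¹ ^ 2 * σ₀⁻¹ ^ 2 / 2 * (σ₁ + σ₀)) * ((σ₀ - σ₁) * v₀ ^ 2) := by
      field_simp
      ring
    rw [this]
    refine (abs_add_le _ _).trans (add_le_add ?_ ?_)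
    · rw [abs_mul, abs_of_nonneg (by positivity), abs_mul]
      refine mul_le_mul ?_ (mul_le_mul_of_nonneg_left (abs_add_le _ _) (abs_nonneg _))
        (by positivity) (by positivity)
      have := pow_le_pow_left₀ (by positivity) i₁ 2
      have h0 : 0 ≤ σ₁⁻¹ ^ 2 := by positivity
      linarith
    · rw [abs_mul, abs_of_nonneg (by positivity), abs_mul, abs_sub_comm σ₀,
        abs_of_nonneg (sq_nonneg v₀)]
      refine mul_le_mul_of_nonneg_right ?_ (by positivity)
      have h2 : σ₁⁻¹ ^ 2 * σ₀⁻¹ ^ 2 ≤ m⁻¹ ^ 4 := by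
        rw [show m⁻¹ ^ 4 = m⁻¹ ^ 2 * m⁻¹ ^ 2 by ring]
        exact mul_le_mul (pow_le_pow_left₀ (by positivity) i₁ 2)
          (pow_le_pow_left₀ (by positivity) i₀ 2) (by positivity) (by positivity)
      refine mul_le_mul ?_ (by linarith) (by positivity) (by positivity)
      have h0 : 0 ≤ σ₁⁻¹ ^ 2 * σ₀⁻¹ ^ 2 := by positivity
      linarith
  have e3 := abs_exp_neg_sub_exp_neg_le (v₁ ^ 2 / (2 * σ₁ ^ 2)) (v₀ ^ 2 / (2 * σ₀ ^ 2))
  rw [← neg_div, ← neg_div] at e3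
  rw [hdec, abs_mul, abs_of_nonneg hw0]
  refine (mul_le_of_le_one_left (abs_nonneg _) hk').trans ((abs_add_le _ _).trans ?_)
  rw [abs_mul, abs_mul, abs_of_pos (Real.exp_pos _), abs_of_pos (inv_pos.2 p₁), add_mul]
  refine add_le_add ?_ ?_
  · exact mul_le_mul e1 (by linarith) (Real.exp_pos _).le (by positivity)
  · rw [mul_assoc m⁻¹]
    refine mul_le_mul i₁ (e3.trans ?_) (abs_nonneg _) (by positivity)
    exact mul_le_mul e2 (by linarith) (by positivity) (by positivity)

end GaussianComparison

section LocalEstimates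

/-- A stable fixed point with its adapted metric, normalised so that the linearised process has
invariant density proportional to `exp (-y ^ 2)`, together with admissible weight exponents. -/
structure StableData (f : C(S1, S1)) (F : ℝ → ℝ) (σ : C(S1, ℝ)) (s δ θ b r₀ D : ℝ) (ρ : S1 → ℝ)
    (m S κ κ₁ κ₂ : ℝ) : Prop where
  metric : AdaptedMetric f F σ s δ θ b r₀ D ρ
  weight : WeightParams θ κ κ₂
  lt_mid : κ < κ₁
  mid_lt : κ₁ < κ₂
  lift : ∀ t : ℝ, f (t : S1) = (F t : S1)
  fix : f (s : S1) = (s : S1)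
  pos : 0 < m
  le_noise : ∀ x, m ≤ σ x
  noise_le : ∀ x, σ x ≤ S
  var : σ (s : S1) ^ 2 = (1 - deriv F s ^ 2) / 2
  spread : κ₂ * b ^ 2 / (1 - θ) ≤ 1 / (8 * S ^ 2)

/-- The mass of `φ` against the weight `exp (-κ (ρ / ε) ^ 2)`, in the variable `x / ε`. -/
noncomputable def scaledMass (ρ : S1 → ℝ) (κ ε : ℝ) (φ : S1 → ℂ) : ℝ :=
  ε⁻¹ * ∫ x, ‖φ x‖ * Real.exp (-(κ * (ρ x / ε) ^ 2))

lemma scaledMass_nonneg (ρ : S1 → ℝ) (κ : ℝ) {ε : ℝ} (hε : 0 < ε) (φ : S1 → ℂ) :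
    0 ≤ scaledMass ρ κ ε φ :=
  mul_nonneg (inv_pos.2 hε).le (integral_nonneg fun _ => by positivity)

/-- The mass of `g` against the weight `exp (-κ u ^ 2)`. -/
noncomputable def gaussMass (κ : ℝ) (g : ℝ → ℂ) : ℝ := ∫ u, ‖g u‖ * Real.exp (-κ * u ^ 2)

lemma gaussMass_nonneg (κ : ℝ) (g : ℝ → ℂ) : 0 ≤ gaussMass κ g :=
  integral_nonneg fun _ => by positivity

lemma GaussBdd.integrable_norm {κ κ₁ : ℝ} (h : κ < κ₁) (g : GaussBdd κ) :
    Integrable fun u => ‖g u‖ * Real.exp (-κ₁ * u ^ 2) := by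
  have h1 := (g.integrable_mul (k := fun u => ((Real.exp (-κ₁ * u ^ 2) : ℝ) : ℂ)) (C := 1)
    (by fun_prop) h fun u => by
      rw [Complex.norm_real, Real.norm_of_nonneg (Real.exp_pos _).le, one_mul]).1.norm
  refine h1.congr (Eventually.of_forall fun u => ?_)
  simp only [norm_mul]
  rw [Complex.norm_real, Real.norm_of_nonneg (Real.exp_pos _).le]

lemma exp_neg_div_sq_le {a ε : ℝ} (ha : 0 < a) (hε : 0 < ε) (hε1 : ε ≤ 1) :
    Real.exp (-(a / ε ^ 2)) ≤ a⁻¹ * ε := by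
  have h1 : 0 < a / ε ^ 2 := by positivity
  have h2 : a / ε ^ 2 ≤ Real.exp (a / ε ^ 2) := by linarith [Real.add_one_le_exp (a / ε ^ 2)]
  rw [Real.exp_neg]
  refine (inv_anti₀ h1 h2).trans ?_
  rw [inv_div, div_eq_inv_mul]
  exact mul_le_mul_of_nonneg_left (by nlinarith) (inv_pos.2 ha).le

namespace StableData

variable {f : C(S1, S1)} {F : ℝ → ℝ} {σ : C(S1, ℝ)} {s δ θ b r₀ D : ℝ} {ρ : S1 → ℝ}
  {m S κ κ₁ κ₂ : ℝ}

lemma S_pos (h : StableData f F σ s δ θ b r₀ D ρ m S κ κ₁ κ₂) : 0 < S :=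
  h.pos.trans_le ((h.le_noise s).trans (h.noise_le s))

lemma noise_pos (h : StableData f F σ s δ θ b r₀ D ρ m S κ κ₁ κ₂) (x : S1) : 0 < σ x :=
  h.pos.trans_le (h.le_noise x)

lemma mid_pos (h : StableData f F σ s δ θ b r₀ D ρ m S κ κ₁ κ₂) : 0 < κ₁ :=
  h.weight.pos.trans h.lt_mid

lemma rho_nonneg (h : StableData f F σ s δ θ b r₀ D ρ m S κ κ₁ κ₂) (x : S1) : 0 ≤ ρ x :=
  (norm_nonneg _).trans (h.metric.le x)

lemma continuous_rho (h : StableData f F σ s δ θ b r₀ D ρ m S κ κ₁ κ₂) : Continuous ρ := by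
  have hb : 0 ≤ b := zero_le_one.trans h.metric.one_le
  refine (LipschitzWith.of_le_add_mul ⟨b, hb⟩ fun x y => ?_).continuous
  have := h.metric.lipschitz y (x - y)
  rw [add_sub_cancel] at this
  rw [dist_eq_norm]
  exact this

lemma rho_le (h : StableData f F σ s δ θ b r₀ D ρ m S κ κ₁ κ₂) (x : S1) : ρ x ≤ b * Real.pi := by
  have hb : 0 ≤ b := zero_le_one.trans h.metric.one_le
  have h1 := h.metric.lipschitz (s : S1) (x - s)
  rw [add_sub_cancel, h.metric.eq (s : S1) (by simpa using h.metric.radius_pos), sub_self,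
    norm_zero, zero_add] at h1
  refine h1.trans (mul_le_mul_of_nonneg_left ?_ hb)
  refine (AddCircle.norm_le_half_period (2 * Real.pi) Real.two_pi_pos.ne').trans ?_
  rw [abs_of_pos Real.two_pi_pos, mul_div_cancel_left₀ _ two_ne_zero]

/-- The image of the weight under one step of the dynamics with noise `ε v`. -/
lemma weight_step (h : StableData f F σ s δ θ b r₀ D ρ m S κ κ₁ κ₂) {x : S1}
    (hx : x ∈ Metric.ball (s : S1) δ) {ε : ℝ} (hε : 0 < ε) (v : ℝ) :
    κ₁ * (ρ (f x + ((ε * v : ℝ) : S1)) / ε) ^ 2 ≤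
      θ * κ₂ * (ρ x / ε) ^ 2 + v ^ 2 / (8 * S ^ 2) := by
  have hb : 0 < b := zero_lt_one.trans_le h.metric.one_le
  have hκ := h.mid_pos
  have hκ2 := h.mid_lt
  have hS := h.S_pos
  have hθ : 0 < 1 - θ := sub_pos.2 h.metric.theta_lt
  have h1 : ρ (f x + ((ε * v : ℝ) : S1)) / ε ≤ θ * (ρ x / ε) + b * |v| := by
    rw [div_le_iff₀ hε]
    have h2 := h.metric.lipschitz (f x) ((ε * v : ℝ) : S1)
    have h3 := h.metric.contract x hx
    have h4 := mul_le_mul_of_nonneg_left (norm_coe_le_abs (ε * v)) hb.le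
    rw [abs_mul, abs_of_pos hε] at h4
    have h5 : (θ * (ρ x / ε) + b * |v|) * ε = θ * ρ x + b * (ε * |v|) := by
      field_simp
    linarith
  have h0 : 0 ≤ ρ (f x + ((ε * v : ℝ) : S1)) / ε := div_nonneg (h.rho_nonneg _) hε.le
  have h2 := (pow_le_pow_left₀ h0 h1 2).trans
    (sq_mul_add_le h.metric.theta_pos h.metric.theta_lt (ρ x / ε) (b * |v|))
  rw [mul_pow, sq_abs] at h2
  have h3 : κ₂ * (b ^ 2 * v ^ 2 / (1 - θ)) ≤ v ^ 2 / (8 * S ^ 2) := by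
    have := mul_le_mul_of_nonneg_right h.spread (sq_nonneg v)
    calc κ₂ * (b ^ 2 * v ^ 2 / (1 - θ)) = κ₂ * b ^ 2 / (1 - θ) * v ^ 2 := by ring
      _ ≤ _ := this
      _ = _ := by ring
  have h4 := mul_le_mul_of_nonneg_left h2 (hκ.trans hκ2).le
  have h5 := mul_le_mul_of_nonneg_right hκ2.le (sq_nonneg (ρ (f x + ((ε * v : ℝ) : S1)) / ε))
  calc _ ≤ _ := h5
    _ ≤ _ := h4
    _ = θ * κ₂ * (ρ x / ε) ^ 2 + κ₂ * (b ^ 2 * v ^ 2 / (1 - θ)) := by ring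
    _ ≤ _ := by linarith

lemma gaussDensity_le (h : StableData f F σ s δ θ b r₀ D ρ m S κ κ₁ κ₂) (x : S1) (v : ℝ) :
    gaussDensity (σ x) v ≤ m⁻¹ * Real.exp (-v ^ 2 / (2 * S ^ 2)) := by
  have hσ := h.noise_pos x
  have hk : 1 ≤ Real.sqrt (2 * Real.pi) := Real.one_le_sqrt.2 (by linarith [Real.pi_gt_three])
  unfold gaussDensity
  refine mul_le_mul (inv_anti₀ h.pos ?_) (Real.exp_le_exp.2 ?_) (Real.exp_pos _).le
    (inv_pos.2 h.pos).le
  · exact (h.le_noise x).trans (le_mul_of_one_le_right hσ.le hk)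
  · rw [neg_div, neg_div, neg_le_neg_iff]
    refine div_le_div_of_nonneg_left (sq_nonneg v) (by positivity) ?_
    have := pow_le_pow_left₀ hσ.le (h.noise_le x) 2
    linarith

lemma exists_integral_step_le (h : StableData f F σ s δ θ b r₀ D ρ m S κ κ₁ κ₂) :
    ∃ C > (0 : ℝ), ∀ (φ : S1 → ℂ), Measurable φ → (∃ B, ∀ x, ‖φ x‖ ≤ B) →
      ∀ ε, 0 < ε → ε ≤ 1 → ∀ x ∈ Metric.ball (s : S1) δ,
        Integrable (fun v : ℝ => ‖φ (f x + ((ε * v : ℝ) : S1))‖ * Real.exp (-v ^ 2 / (4 * S ^ 2))) ∧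
        ∫ v : ℝ, ‖φ (f x + ((ε * v : ℝ) : S1))‖ * Real.exp (-v ^ 2 / (4 * S ^ 2)) ≤
          C * scaledMass ρ κ₁ ε φ * Real.exp (θ * κ₂ * (ρ x / ε) ^ 2) := by
  have hS := h.S_pos
  obtain ⟨C, hC, hw⟩ := exists_integral_wrap_le (β := 1 / (8 * S ^ 2)) (by positivity)
  refine ⟨C, hC, fun φ hφ hB ε hε hε1 x hx => ?_⟩
  obtain ⟨B, hB⟩ := hB
  have hρ := h.continuous_rho
  have hκ := h.mid_pos
  obtain ⟨hi, hle⟩ := hw (fun y => ‖φ y‖ * Real.exp (-(κ₁ * (ρ y / ε) ^ 2)))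
    (hφ.norm.mul (by fun_prop)) (fun y => by positivity)
    ⟨B, fun y => (mul_le_of_le_one_right (norm_nonneg _)
      (Real.exp_le_one_iff.2 (neg_nonpos.2 (by positivity)))).trans (hB y)⟩ (f x) ε hε hε1
  have hpt : ∀ v : ℝ, ‖φ (f x + ((ε * v : ℝ) : S1))‖ * Real.exp (-v ^ 2 / (4 * S ^ 2)) ≤
      Real.exp (θ * κ₂ * (ρ x / ε) ^ 2) * (‖φ (f x + ((ε * v : ℝ) : S1))‖ *
        Real.exp (-(κ₁ * (ρ (f x + ((ε * v : ℝ) : S1)) / ε) ^ 2)) *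
        Real.exp (-(1 / (8 * S ^ 2)) * v ^ 2)) := by
    intro v
    rw [mul_comm (Real.exp (θ * κ₂ * (ρ x / ε) ^ 2)), mul_assoc, mul_assoc, ← Real.exp_add,
      ← Real.exp_add]
    refine mul_le_mul_of_nonneg_left (Real.exp_le_exp.2 ?_) (norm_nonneg _)
    have h1 := h.weight_step hx hε v
    have h2 : -v ^ 2 / (4 * S ^ 2) = -(v ^ 2 / (8 * S ^ 2)) + -(1 / (8 * S ^ 2)) * v ^ 2 := by
      field_simp
      ring
    linarith
  have hcoe : Measurable fun v : ℝ => f x + ((ε * v : ℝ) : S1) :=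
    (continuous_const.add ((AddCircle.continuous_mk' _).comp (by fun_prop))).measurable
  have hi' : Integrable fun v : ℝ =>
      ‖φ (f x + ((ε * v : ℝ) : S1))‖ * Real.exp (-v ^ 2 / (4 * S ^ 2)) := by
    refine (hi.const_mul (Real.exp (θ * κ₂ * (ρ x / ε) ^ 2))).mono'
      ((hφ.comp hcoe).norm.mul (by fun_prop)).aestronglyMeasurable (Eventually.of_forall fun v => ?_)
    rw [Real.norm_of_nonneg (by positivity)]
    exact hpt v
  refine ⟨hi', (integral_mono hi' (hi.const_mul _) hpt).trans ?_⟩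
  rw [integral_const_mul, mul_comm]
  exact mul_le_mul_of_nonneg_right hle (Real.exp_pos _).le

/-- Away from the fixed point the transition operator is small in the weighted norm. -/
lemma exists_norm_transition_le (h : StableData f F σ s δ θ b r₀ D ρ m S κ κ₁ κ₂) :
    ∃ C > (0 : ℝ), ∀ (φ : S1 → ℂ), Measurable φ → (∃ B, ∀ x, ‖φ x‖ ≤ B) →
      ∀ ε, 0 < ε → ε ≤ 1 → ∀ x ∈ Metric.ball (s : S1) δ,
        ‖transition f σ ε φ x‖ ≤
          C * scaledMass ρ κ₁ ε φ * Real.exp (θ * κ₂ * (ρ x / ε) ^ 2) := by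
  obtain ⟨C, hC, hstep⟩ := h.exists_integral_step_le
  have hm := h.pos
  have hS := h.S_pos
  refine ⟨m⁻¹ * C, by positivity, fun φ hφ hB ε hε hε1 x hx => ?_⟩
  obtain ⟨hi, hle⟩ := hstep φ hφ hB ε hε hε1 x hx
  rw [transition_eq_integral f σ ε φ hφ x (h.noise_pos x)]
  calc _ ≤ ∫ v : ℝ, m⁻¹ * (‖φ (f x + ((ε * v : ℝ) : S1))‖ * Real.exp (-v ^ 2 / (4 * S ^ 2))) := by
        refine norm_integral_le_of_norm_le (hi.const_mul _) (Eventually.of_forall fun v => ?_)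
        rw [norm_mul, Complex.norm_real, Real.norm_of_nonneg (gaussDensity_nonneg (h.noise_pos x) v),
          mul_left_comm]
        refine mul_le_mul_of_nonneg_left ((h.gaussDensity_le x v).trans ?_) (norm_nonneg _)
        refine mul_le_mul_of_nonneg_left (Real.exp_le_exp.2 ?_) (by positivity)
        rw [neg_div, neg_div, neg_le_neg_iff]
        exact div_le_div_of_nonneg_left (sq_nonneg v) (by positivity) (by nlinarith)
    _ ≤ m⁻¹ * (C * scaledMass ρ κ₁ ε φ * Real.exp (θ * κ₂ * (ρ x / ε) ^ 2)) := by
        rw [integral_const_mul]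
        exact mul_le_mul_of_nonneg_left hle (by positivity)
    _ = _ := by ring

lemma exp_far_le (h : StableData f F σ s δ θ b r₀ D ρ m S κ κ₁ κ₂) {ε : ℝ} (hε : 0 < ε)
    (hε1 : ε ≤ 1) {y : ℝ} (hy : r₀ / ε ≤ y) :
    Real.exp (θ * κ₂ * y ^ 2) ≤
      ((κ - θ * κ₂) * r₀ ^ 2)⁻¹ * ε * Real.exp (κ * y ^ 2) := by
  have hr := h.metric.radius_pos
  have hκ := sub_pos.2 h.weight.lower
  have h1 := exp_neg_div_sq_le (a := (κ - θ * κ₂) * r₀ ^ 2) (by positivity) hε hε1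
  refine le_trans ?_ (mul_le_mul_of_nonneg_right h1 (Real.exp_pos _).le)
  rw [← Real.exp_add]
  refine Real.exp_le_exp.2 ?_
  have h2 : r₀ ^ 2 / ε ^ 2 ≤ y ^ 2 := by
    rw [← div_pow]
    exact pow_le_pow_left₀ (by positivity) hy 2
  have h3 := mul_le_mul_of_nonneg_left h2 hκ.le
  have h4 : (κ - θ * κ₂) * r₀ ^ 2 / ε ^ 2 = (κ - θ * κ₂) * (r₀ ^ 2 / ε ^ 2) := by ring
  rw [h4]
  linarith

lemma exists_norm_mehlerOp_le (h : StableData f F σ s δ θ b r₀ D ρ m S κ κ₁ κ₂) :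
    ∃ C > (0 : ℝ), ∀ (g : GaussBdd κ) (y : ℝ),
      ‖mehlerOp h.weight h.metric.abs_deriv_le g y‖ ≤
        C * gaussMass κ₁ g * Real.exp (θ * κ₂ * y ^ 2) := by
  have h0 := one_sub_sq_pos (h.metric.abs_deriv_le.trans_lt h.weight.theta_lt)
  have hpi := Real.pi_pos
  refine ⟨(Real.sqrt (Real.pi * (1 - deriv F s ^ 2)))⁻¹, by positivity, fun g y => ?_⟩
  rw [mehlerOp_apply]
  calc _ ≤ ∫ u, (Real.sqrt (Real.pi * (1 - deriv F s ^ 2)))⁻¹ * Real.exp (θ * κ₂ * y ^ 2) *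
        (‖g u‖ * Real.exp (-κ₁ * u ^ 2)) := by
        refine norm_integral_le_of_norm_le ((GaussBdd.integrable_norm h.lt_mid g).const_mul _)
          (Eventually.of_forall fun u => ?_)
        rw [norm_mul, mul_left_comm]
        refine mul_le_mul_of_nonneg_left
          ((norm_mehlerKernel_le h.weight h.metric.abs_deriv_le y u).trans ?_) (norm_nonneg _)
        refine mul_le_mul_of_nonneg_left (Real.exp_le_exp.2 ?_) (by positivity)
        nlinarith [h.mid_lt, sq_nonneg u]
    _ = _ := by rw [integral_const_mul, gaussMass]; ring

end StableData

end LocalEstimates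

section Comparison

namespace StableData

variable {f : C(S1, S1)} {F : ℝ → ℝ} {σ : C(S1, ℝ)} {s δ θ b r₀ D : ℝ} {ρ : S1 → ℝ}
  {m S κ κ₁ κ₂ : ℝ}

lemma exp_weight_le (h : StableData f F σ s δ θ b r₀ D ρ m S κ κ₁ κ₂) {y u a τ : ℝ}
    (ha : |a| ≤ θ * |y|) (hτ : 0 < τ) (hτS : τ ≤ S) :
    Real.exp (-(u - a) ^ 2 / (2 * τ ^ 2)) ≤ Real.exp (θ * κ₂ * y ^ 2 - κ₂ * u ^ 2) := by
  have hS := h.S_pos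
  have hθ : 0 < 1 - θ := sub_pos.2 h.metric.theta_lt
  have hκ := h.mid_pos.trans h.mid_lt
  refine Real.exp_le_exp.2 ?_
  have h1 : |u| ≤ θ * |y| + |u - a| := by
    have := abs_add_le a (u - a)
    rw [add_sub_cancel] at this
    linarith
  have h2 := (pow_le_pow_left₀ (abs_nonneg _) h1 2).trans
    (sq_mul_add_le h.metric.theta_pos h.metric.theta_lt |y| |u - a|)
  rw [sq_abs, sq_abs, sq_abs] at h2
  have h3 : κ₂ / (1 - θ) ≤ 1 / (2 * S ^ 2) := by
    have e1 : κ₂ / (1 - θ) ≤ κ₂ * b ^ 2 / (1 - θ) := by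
      refine div_le_div_of_nonneg_right ?_ hθ.le
      exact le_mul_of_one_le_right hκ.le (one_le_pow₀ h.metric.one_le)
    refine e1.trans (h.spread.trans ?_)
    exact one_div_le_one_div_of_le (by positivity) (by nlinarith)
  have h4 : 1 / (2 * S ^ 2) ≤ 1 / (2 * τ ^ 2) :=
    one_div_le_one_div_of_le (by positivity)
      (by have := pow_le_pow_left₀ hτ.le hτS 2; linarith)
  have h5 := mul_le_mul_of_nonneg_right (h3.trans h4) (sq_nonneg (u - a))
  have h6 := mul_le_mul_of_nonneg_left h2 hκ.le
  have h7 : κ₂ * (θ * y ^ 2 + (u - a) ^ 2 / (1 - θ)) =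
      θ * κ₂ * y ^ 2 + κ₂ / (1 - θ) * (u - a) ^ 2 := by ring
  have h8 : -(u - a) ^ 2 / (2 * τ ^ 2) = -(1 / (2 * τ ^ 2) * (u - a) ^ 2) := by ring
  rw [h8]
  linarith

lemma abs_lift_div_le (h : StableData f F σ s δ θ b r₀ D ρ m S κ κ₁ κ₂) {ε y : ℝ} (hε : 0 < ε)
    (hy : |ε * y| < r₀) : |(F (s + ε * y) - F s) / ε| ≤ θ * |y| := by
  rw [abs_div, abs_of_pos hε, div_le_iff₀ hε]
  have := h.metric.lift_contract _ hy
  rw [abs_mul, abs_of_pos hε] at this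
  linarith

set_option maxHeartbeats 1000000 in
/-- The rescaled transition density is close to the Mehler kernel. -/
lemma exists_density_compare (h : StableData f F σ s δ θ b r₀ D ρ m S κ κ₁ κ₂) :
    ∃ C > (0 : ℝ), ∀ ε, 0 < ε → ∀ y, |ε * y| < r₀ → ∀ u,
      |gaussDensity (σ ((s : S1) + ((ε * y : ℝ) : S1))) (u - (F (s + ε * y) - F s) / ε) -
        mehlerKernel (deriv F s) y u| ≤ C * ε * Real.exp (κ * y ^ 2 - κ₁ * u ^ 2) := by
  have hS := h.S_pos
  have hm := h.pos
  have hD := h.metric.const_pos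
  obtain ⟨τ, hτ⟩ : ∃ τ, τ = min (κ - θ * κ₂) (κ₂ - κ₁) := ⟨_, rfl⟩
  have hτ0 : 0 < τ := by
    rw [hτ]; exact lt_min (sub_pos.2 h.weight.lower) (sub_pos.2 h.mid_lt)
  have hτ1 : τ ≤ κ - θ * κ₂ := by rw [hτ]; exact min_le_left _ _
  have hτ2 : τ ≤ κ₂ - κ₁ := by rw [hτ]; exact min_le_right _ _
  obtain ⟨P, hP, hpoly⟩ := exists_sq_one_add_le hτ0
  refine ⟨(m⁻¹ ^ 2 * D + m⁻¹ * (m⁻¹ ^ 2 * (2 * D) + m⁻¹ ^ 4 * (2 * S) * (2 * D))) * (2 * P),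
    by positivity, fun ε hε y hy u => ?_⟩
  have hc := h.metric.abs_deriv_le
  rw [mehlerKernel_eq_gaussDensity (h.noise_pos s) h.var]
  have ha₁ := h.abs_lift_div_le hε hy
  have ha₀ : |deriv F s * y| ≤ θ * |y| := by
    rw [abs_mul]; exact mul_le_mul_of_nonneg_right hc (abs_nonneg y)
  obtain ⟨a, ha⟩ : ∃ a, a = (F (s + ε * y) - F s) / ε := ⟨_, rfl⟩
  rw [← ha] at ha₁ ⊢
  have hA₁ := h.exp_weight_le (u := u) ha₁ (h.noise_pos ((s : S1) + ((ε * y : ℝ) : S1)))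
    (h.noise_le _)
  have hA₀ := h.exp_weight_le (u := u) ha₀ (h.noise_pos (s : S1)) (h.noise_le _)
  refine (abs_gaussDensity_sub_le h.pos (h.le_noise _) (h.le_noise _) (h.noise_le _)
    (h.noise_le _) hA₁ hA₀).trans ?_
  have hσ := h.metric.noise_lipschitz _ hy
  have htaylor : |u - a - (u - deriv F s * y)| ≤ D * (ε * y ^ 2) := by
    have e1 := h.metric.lift_taylor _ hy
    have e2 : u - a - (u - deriv F s * y) = -((F (s + ε * y) - F s - deriv F s * (ε * y)) / ε) := by
      rw [ha]; field_simp; ring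
    rw [e2, abs_neg, abs_div, abs_of_pos hε, div_le_iff₀ hε]
    refine e1.trans (le_of_eq ?_)
    ring
  rw [abs_mul, abs_of_pos hε] at hσ
  obtain ⟨q, hq⟩ : ∃ q, q = u ^ 2 + y ^ 2 := ⟨_, rfl⟩
  have hq0 : 0 ≤ q := by rw [hq]; positivity
  have hy2 : y ^ 2 ≤ q := by rw [hq]; nlinarith [sq_nonneg u]
  have hθ1 := h.metric.theta_lt
  have hv : ∀ a', |a'| ≤ θ * |y| → |u - a'| ≤ 1 + q ∧ (u - a') ^ 2 ≤ 2 * q := by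
    intro a' ha'
    have e1 : |u - a'| ≤ |u| + |y| := by
      have := abs_sub u a'
      nlinarith [abs_nonneg y]
    have e2 := sq_abs u
    have e3 := sq_abs y
    refine ⟨by nlinarith [sq_nonneg (|u| - 1), sq_nonneg (|y| - 1)], ?_⟩
    have := pow_le_pow_left₀ (abs_nonneg _) e1 2
    rw [sq_abs] at this
    nlinarith [sq_nonneg (|u| - |y|)]
  have hy1 : |y| ≤ 1 + q := by
    have e3 := sq_abs y
    nlinarith [sq_nonneg (|y| - 1)]
  obtain ⟨hv1, -⟩ := hv _ ha₁
  obtain ⟨hv0, hv2⟩ := hv _ ha₀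
  have b1 : |σ ((s : S1) + ((ε * y : ℝ) : S1)) - σ (s : S1)| ≤ D * (ε * (1 + q) ^ 2) :=
    hσ.trans (mul_le_mul_of_nonneg_left (mul_le_mul_of_nonneg_left (by nlinarith) hε.le) hD.le)
  have b2 : |u - a - (u - deriv F s * y)| * (|u - a| + |u - deriv F s * y|) ≤
      2 * D * (ε * (1 + q) ^ 2) := by
    calc _ ≤ D * (ε * y ^ 2) * (2 * (1 + q)) :=
          mul_le_mul htaylor (by linarith) (by positivity) (by positivity)
      _ = 2 * D * (ε * (y ^ 2 * (1 + q))) := by ring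
      _ ≤ _ := by
          refine mul_le_mul_of_nonneg_left (mul_le_mul_of_nonneg_left ?_ hε.le) (by positivity)
          nlinarith
  have b3 : |σ ((s : S1) + ((ε * y : ℝ) : S1)) - σ (s : S1)| * (u - deriv F s * y) ^ 2 ≤
      2 * D * (ε * (1 + q) ^ 2) := by
    calc _ ≤ D * (ε * |y|) * (2 * q) := mul_le_mul hσ hv2 (sq_nonneg _) (by positivity)
      _ = 2 * D * (ε * (|y| * q)) := by ring
      _ ≤ _ := by
          refine mul_le_mul_of_nonneg_left (mul_le_mul_of_nonneg_left ?_ hε.le) (by positivity)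
          nlinarith [abs_nonneg y]
  have hexp : (1 + q) ^ 2 * Real.exp (θ * κ₂ * y ^ 2 - κ₂ * u ^ 2) ≤
      P * Real.exp (κ * y ^ 2 - κ₁ * u ^ 2) := by
    refine (mul_le_mul_of_nonneg_right (hpoly q hq0) (Real.exp_pos _).le).trans ?_
    rw [mul_assoc, ← Real.exp_add]
    refine mul_le_mul_of_nonneg_left (Real.exp_le_exp.2 ?_) hP.le
    rw [hq]
    nlinarith [mul_le_mul_of_nonneg_right hτ1 (sq_nonneg y),
      mul_le_mul_of_nonneg_right hτ2 (sq_nonneg u)]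
  calc _ ≤ (m⁻¹ ^ 2 * (D * (ε * (1 + q) ^ 2)) + m⁻¹ * (m⁻¹ ^ 2 * (2 * D * (ε * (1 + q) ^ 2)) +
        m⁻¹ ^ 4 * (2 * S) * (2 * D * (ε * (1 + q) ^ 2)))) *
        (2 * Real.exp (θ * κ₂ * y ^ 2 - κ₂ * u ^ 2)) := by
        gcongr
    _ = (m⁻¹ ^ 2 * D + m⁻¹ * (m⁻¹ ^ 2 * (2 * D) + m⁻¹ ^ 4 * (2 * S) * (2 * D))) * 2 * ε *
        ((1 + q) ^ 2 * Real.exp (θ * κ₂ * y ^ 2 - κ₂ * u ^ 2)) := by ring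
    _ ≤ (m⁻¹ ^ 2 * D + m⁻¹ * (m⁻¹ ^ 2 * (2 * D) + m⁻¹ ^ 4 * (2 * S) * (2 * D))) * 2 * ε *
        (P * Real.exp (κ * y ^ 2 - κ₁ * u ^ 2)) := mul_le_mul_of_nonneg_left hexp (by positivity)
    _ = _ := by ring

set_option maxHeartbeats 600000 in
/-- Near the fixed point the rescaled transition operator is close to the Ornstein–Uhlenbeck
transition operator. -/
lemma exists_transition_compare (h : StableData f F σ s δ θ b r₀ D ρ m S κ κ₁ κ₂) :
    ∃ C > (0 : ℝ), ∀ (φ : S1 → ℂ), Measurable φ → (∃ B, ∀ x, ‖φ x‖ ≤ B) →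
      ∀ ε, 0 < ε → ε ≤ 1 → ∀ g : GaussBdd κ,
        (∀ u, |ε * u| < r₀ → g u = φ ((s : S1) + ((ε * u : ℝ) : S1))) →
        ∀ y, |ε * y| < r₀ →
          ‖transition f σ ε φ ((s : S1) + ((ε * y : ℝ) : S1)) -
            mehlerOp h.weight h.metric.abs_deriv_le g y‖ ≤
          C * ε * (scaledMass ρ κ₁ ε φ + gaussMass κ₁ g) * Real.exp (κ * y ^ 2) := by
  obtain ⟨C₁, hC₁, hstep⟩ := h.exists_integral_step_le
  obtain ⟨C₂, hC₂, hcomp⟩ := h.exists_density_compare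
  have hm := h.pos
  have hS := h.S_pos
  have hr := h.metric.radius_pos
  have hθ : 0 < 1 - θ := sub_pos.2 h.metric.theta_lt
  have hκ12 := sub_pos.2 h.mid_lt
  have hpi := Real.pi_pos
  have h0 := one_sub_sq_pos (h.metric.abs_deriv_le.trans_lt h.weight.theta_lt)
  obtain ⟨E, hE⟩ : ∃ E, E = (Real.sqrt (Real.pi * (1 - deriv F s ^ 2)))⁻¹ := ⟨_, rfl⟩
  have hE0 : 0 < E := by rw [hE]; positivity
  obtain ⟨a₁, ha₁⟩ : ∃ a₁, a₁ = ((1 - θ) * r₀) ^ 2 / (4 * S ^ 2) := ⟨_, rfl⟩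
  have ha₁0 : 0 < a₁ := by rw [ha₁]; positivity
  obtain ⟨a₂, ha₂⟩ : ∃ a₂, a₂ = (κ₂ - κ₁) * r₀ ^ 2 := ⟨_, rfl⟩
  have ha₂0 : 0 < a₂ := by rw [ha₂]; positivity
  refine ⟨C₂ + E * a₂⁻¹ + m⁻¹ * a₁⁻¹ * C₁, by positivity,
    fun φ hφ hB ε hε hε1 g hg y hy => ?_⟩
  obtain ⟨a, ha⟩ : ∃ a, a = (F (s + ε * y) - F s) / ε := ⟨_, rfl⟩
  have haθ := h.abs_lift_div_le hε hy
  rw [← ha] at haθ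
  obtain ⟨x, hx⟩ : ∃ x, x = (s : S1) + ((ε * y : ℝ) : S1) := ⟨_, rfl⟩
  have hxs : ‖x - s‖ = |ε * y| := by
    rw [hx, add_sub_cancel_left, norm_coe_eq_abs (hy.le.trans h.metric.radius_lt_pi.le)]
  have hxV : x ∈ Metric.ball (s : S1) δ := by
    rw [Metric.mem_ball, dist_eq_norm, hxs]
    exact hy.trans_le h.metric.radius_le
  have hρ : (ρ x / ε) ^ 2 = y ^ 2 := by
    rw [h.metric.eq x (by rwa [hxs]), hxs, abs_mul, abs_of_pos hε,
      mul_div_cancel_left₀ _ hε.ne', sq_abs]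
  have hfx : ∀ v : ℝ, f x + ((ε * (v - a) : ℝ) : S1) = (s : S1) + ((ε * v : ℝ) : S1) := by
    intro v
    have e1 : f x = ((F (s + ε * y) : ℝ) : S1) := by
      rw [hx, ← AddCircle.coe_add, h.lift]
    have e2 : (F s : S1) = (s : S1) := by rw [← h.lift, h.fix]
    have e3 : F (s + ε * y) + ε * (v - a) = F s + ε * v := by
      rw [ha]; field_simp; ring
    rw [e1, ← AddCircle.coe_add, e3, AddCircle.coe_add, e2]
  have hcoe : Measurable fun v : ℝ => (s : S1) + ((ε * v : ℝ) : S1) :=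
    (continuous_const.add ((AddCircle.continuous_mk' _).comp (by fun_prop))).measurable
  have htr : transition f σ ε φ x = ∫ u : ℝ, φ ((s : S1) + ((ε * u : ℝ) : S1)) *
      (gaussDensity (σ x) (u - a) : ℂ) := by
    rw [transition_eq_integral f σ ε φ hφ x (h.noise_pos x),
      ← integral_sub_right_eq_self _ a]
    simp only [hfx]
  obtain ⟨hi, hle⟩ := hstep φ hφ hB ε hε hε1 x hxV
  have hi' := hi.comp_sub_right a
  have hle' : ∫ u : ℝ, ‖φ ((s : S1) + ((ε * u : ℝ) : S1))‖ *
      Real.exp (-(u - a) ^ 2 / (4 * S ^ 2)) ≤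
        C₁ * scaledMass ρ κ₁ ε φ * Real.exp (θ * κ₂ * y ^ 2) := by
    rw [hρ, ← integral_sub_right_eq_self _ a] at hle
    simpa only [hfx] using hle
  simp only [hfx] at hi'
  have hg1 := GaussBdd.integrable_norm h.lt_mid g
  have hfar : ∀ u, |ε * u| < r₀ ∨ r₀ / ε ≤ |u| := by
    intro u
    rw [abs_mul, abs_of_pos hε, div_le_iff₀ hε, mul_comm]
    exact lt_or_ge _ _
  have hy' : |y| < r₀ / ε := by
    have := hy
    rw [abs_mul, abs_of_pos hε, mul_comm] at this
    rwa [lt_div_iff₀ hε]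
  have hpt : ∀ u : ℝ, ‖φ ((s : S1) + ((ε * u : ℝ) : S1)) * (gaussDensity (σ x) (u - a) : ℂ) -
      g u * (mehlerKernel (deriv F s) y u : ℂ)‖ ≤
      (C₂ + E * a₂⁻¹) * ε * Real.exp (κ * y ^ 2) * (‖g u‖ * Real.exp (-κ₁ * u ^ 2)) +
      m⁻¹ * a₁⁻¹ * ε * (‖φ ((s : S1) + ((ε * u : ℝ) : S1))‖ *
        Real.exp (-(u - a) ^ 2 / (4 * S ^ 2))) := by
    intro u
    rcases hfar u with hu | hu
    · have hc := hcomp ε hε y hy u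
      rw [← hx, ← ha] at hc
      rw [← hg u hu, ← mul_sub, ← Complex.ofReal_sub, norm_mul, Complex.norm_real,
        Real.norm_eq_abs]
      have e1 := mul_le_mul_of_nonneg_left hc (norm_nonneg (g u))
      have e2 : Real.exp (κ * y ^ 2 - κ₁ * u ^ 2) =
          Real.exp (κ * y ^ 2) * Real.exp (-κ₁ * u ^ 2) := by
        rw [← Real.exp_add]; ring_nf
      rw [e2] at e1
      have e3 : 0 ≤ E * a₂⁻¹ * ε * Real.exp (κ * y ^ 2) * (‖g u‖ * Real.exp (-κ₁ * u ^ 2)) := by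
        positivity
      have e4 : 0 ≤ m⁻¹ * a₁⁻¹ * ε * (‖g u‖ * Real.exp (-(u - a) ^ 2 / (4 * S ^ 2))) := by
        positivity
      linarith
    · have e1 : ‖(mehlerKernel (deriv F s) y u : ℂ)‖ ≤
          E * a₂⁻¹ * ε * Real.exp (κ * y ^ 2) * Real.exp (-κ₁ * u ^ 2) := by
        refine (norm_mehlerKernel_le h.weight h.metric.abs_deriv_le y u).trans ?_
        rw [← hE]
        have e2 := exp_neg_div_sq_le ha₂0 hε hε1
        have e3 : Real.exp (θ * κ₂ * y ^ 2) ≤ Real.exp (κ * y ^ 2) :=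
          Real.exp_le_exp.2 (mul_le_mul_of_nonneg_right h.weight.lower.le (sq_nonneg y))
        have e4 : Real.exp (-κ₂ * u ^ 2) ≤ Real.exp (-(a₂ / ε ^ 2)) * Real.exp (-κ₁ * u ^ 2) := by
          rw [← Real.exp_add]
          refine Real.exp_le_exp.2 ?_
          have e5 := pow_le_pow_left₀ (by positivity) hu 2
          rw [sq_abs, div_pow] at e5
          have e6 := mul_le_mul_of_nonneg_left e5 hκ12.le
          have e7 : a₂ / ε ^ 2 = (κ₂ - κ₁) * (r₀ ^ 2 / ε ^ 2) := by rw [ha₂]; ring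
          rw [e7]
          linarith
        calc _ ≤ E * Real.exp (κ * y ^ 2) * (a₂⁻¹ * ε * Real.exp (-κ₁ * u ^ 2)) := by
              refine mul_le_mul (mul_le_mul_of_nonneg_left e3 hE0.le) (e4.trans ?_)
                (Real.exp_pos _).le (by positivity)
              exact mul_le_mul_of_nonneg_right e2 (Real.exp_pos _).le
          _ = _ := by ring
      have e8 : gaussDensity (σ x) (u - a) ≤
          m⁻¹ * a₁⁻¹ * ε * Real.exp (-(u - a) ^ 2 / (4 * S ^ 2)) := by
        refine (h.gaussDensity_le x (u - a)).trans ?_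
        have e9 := exp_neg_div_sq_le ha₁0 hε hε1
        rw [mul_assoc, mul_assoc]
        refine mul_le_mul_of_nonneg_left ?_ (by positivity)
        rw [← mul_assoc]
        refine le_trans ?_ (mul_le_mul_of_nonneg_right e9 (Real.exp_pos _).le)
        rw [← Real.exp_add]
        refine Real.exp_le_exp.2 ?_
        have e10 : (1 - θ) * (r₀ / ε) ≤ |u - a| := by
          have := abs_sub_abs_le_abs_sub u a
          have h3 := mul_le_mul_of_nonneg_left hy'.le h.metric.theta_pos.le
          linarith
        have e11 := pow_le_pow_left₀ (by positivity) e10 2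
        rw [sq_abs] at e11
        have e12 : a₁ / ε ^ 2 = ((1 - θ) * (r₀ / ε)) ^ 2 / (4 * S ^ 2) := by
          rw [ha₁]; field_simp
        have e13 : -(u - a) ^ 2 / (2 * S ^ 2) =
            -((u - a) ^ 2 / (4 * S ^ 2)) + -(u - a) ^ 2 / (4 * S ^ 2) := by
          field_simp; ring
        have e14 := div_le_div_of_nonneg_right e11 (by positivity : 0 ≤ 4 * S ^ 2)
        rw [e12, e13]
        linarith
      refine (norm_sub_le _ _).trans ?_
      rw [norm_mul, norm_mul, Complex.norm_real, Real.norm_of_nonneg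
        (gaussDensity_nonneg (h.noise_pos x) _), add_comm]
      refine add_le_add ?_ ?_
      · have e2 := mul_le_mul_of_nonneg_left e1 (norm_nonneg (g u))
        have e3 : 0 ≤ C₂ * ε * Real.exp (κ * y ^ 2) * (‖g u‖ * Real.exp (-κ₁ * u ^ 2)) := by
          positivity
        linarith
      · have e2 := mul_le_mul_of_nonneg_left e8 (norm_nonneg (φ ((s : S1) + ((ε * u : ℝ) : S1))))
        linarith
  have hint1 : Integrable fun u : ℝ => φ ((s : S1) + ((ε * u : ℝ) : S1)) *
      (gaussDensity (σ x) (u - a) : ℂ) := by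
    refine (hi'.const_mul m⁻¹).mono' ((hφ.comp hcoe).mul (Complex.measurable_ofReal.comp
      ((continuous_gaussDensity _).comp (by fun_prop)).measurable)).aestronglyMeasurable
      (Eventually.of_forall fun u => ?_)
    rw [norm_mul, Complex.norm_real, Real.norm_of_nonneg (gaussDensity_nonneg (h.noise_pos x) _),
      mul_left_comm]
    refine mul_le_mul_of_nonneg_left ((h.gaussDensity_le x _).trans ?_) (norm_nonneg _)
    refine mul_le_mul_of_nonneg_left (Real.exp_le_exp.2 ?_) (by positivity)
    rw [neg_div, neg_div, neg_le_neg_iff]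
    exact div_le_div_of_nonneg_left (sq_nonneg _) (by positivity)
      (by linarith [sq_nonneg S])
  have hint2 := (g.integrable_mul (measurable_mehlerKernel (deriv F s) y) h.weight.upper
    (norm_mehlerKernel_le h.weight h.metric.abs_deriv_le y)).1
  rw [← hx, htr, mehlerOp_apply, ← integral_sub hint1 hint2]
  refine (norm_integral_le_of_norm_le ((hg1.const_mul _).add (hi'.const_mul _))
    (Eventually.of_forall hpt)).trans ?_
  rw [integral_add' (hg1.const_mul _) (hi'.const_mul _), integral_const_mul, integral_const_mul]
  have hN1 := scaledMass_nonneg ρ κ₁ hε φ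
  have hN2 := gaussMass_nonneg κ₁ g
  have hexp : Real.exp (θ * κ₂ * y ^ 2) ≤ Real.exp (κ * y ^ 2) :=
    Real.exp_le_exp.2 (mul_le_mul_of_nonneg_right h.weight.lower.le (sq_nonneg y))
  have hle2 := hle'.trans (mul_le_mul_of_nonneg_left hexp (by positivity))
  have e1 := mul_le_mul_of_nonneg_left hle2 (by positivity : 0 ≤ m⁻¹ * a₁⁻¹ * ε)
  change (C₂ + E * a₂⁻¹) * ε * Real.exp (κ * y ^ 2) * gaussMass κ₁ g + _ ≤ _
  have e2 : 0 ≤ (C₂ + E * a₂⁻¹) * ε * Real.exp (κ * y ^ 2) * scaledMass ρ κ₁ ε φ := by positivity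
  have e3 : 0 ≤ m⁻¹ * a₁⁻¹ * C₁ * ε * Real.exp (κ * y ^ 2) * gaussMass κ₁ g := by positivity
  linarith

end StableData

end Comparison

section Gluing

/-- Adding a direction on which the model operator vanishes. -/
lemma SpectralModel.inl {ι Y Z : Type*} [Fintype ι] [NormedAddCommGroup Y] [NormedSpace ℂ Y]
    [NormedAddCommGroup Z] [NormedSpace ℂ Z] {A₀ : Y →L[ℂ] Y} {lam : ι → ℂ} {e : ι → Y}
    {l : ι → Y →L[ℂ] ℂ} {M r : ℝ} {n : ℕ} (hr : 0 ≤ r)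
    (h : SpectralModel A₀ lam e l M r (n + 1)) :
    SpectralModel (ContinuousLinearMap.inl ℂ Y Z ∘L A₀ ∘L ContinuousLinearMap.fst ℂ Y Z) lam
      (fun i => (e i, 0)) (fun i => l i ∘L ContinuousLinearMap.fst ℂ Y Z) M r (n + 1) where
  eig i := by simp [h.eig]
  coeig i g := by simp [h.coeig]
  biorth_self i := by simp [h.biorth_self]
  biorth i k hik := by simp [h.biorth i k hik]
  one_le := h.one_le
  norm_op := by
    refine ContinuousLinearMap.opNorm_le_bound _ (zero_le_one.trans h.one_le) fun g => ?_
    simp only [ContinuousLinearMap.comp_apply, ContinuousLinearMap.inl_apply,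
      ContinuousLinearMap.coe_fst', Prod.norm_mk, norm_zero]
    rw [max_eq_left (norm_nonneg _)]
    exact (A₀.le_opNorm _).trans
      (mul_le_mul h.norm_op (norm_fst_le g) (norm_nonneg _) (zero_le_one.trans h.one_le))
  norm_vec i := by
    simp only [Prod.norm_mk, norm_zero]
    rw [max_eq_left (norm_nonneg _)]
    exact h.norm_vec i
  norm_fun i := by
    refine ContinuousLinearMap.opNorm_le_bound _ (zero_le_one.trans h.one_le) fun g => ?_
    exact ((l i).le_opNorm _).trans
      (mul_le_mul (h.norm_fun i) (norm_fst_le g) (norm_nonneg _) (zero_le_one.trans h.one_le))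
  power g := by
    have hpow : ∀ (k : ℕ) (g : Y × Z), ((ContinuousLinearMap.inl ℂ Y Z ∘L A₀ ∘L
        ContinuousLinearMap.fst ℂ Y Z) ^ (k + 1)) g = ((A₀ ^ (k + 1)) g.1, 0) := by
      intro k
      induction k with
      | zero => intro g; simp
      | succ k ih =>
        intro g
        rw [pow_succ', mul_apply_eq_comp, ih, pow_succ' A₀ (k + 1), mul_apply_eq_comp]
        rfl
    rw [hpow, Prod.norm_mk, norm_zero, max_eq_left (norm_nonneg _)]
    have h1 : (g - ∑ i, (l i ∘L ContinuousLinearMap.fst ℂ Y Z) g • ((e i, 0) : Y × Z)).1 =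
        g.1 - ∑ i, l i g.1 • e i := by
      simp [Prod.fst_sum]
    rw [h1]
    exact (h.power g.1).trans (mul_le_mul_of_nonneg_left (norm_fst_le g) (by positivity))

lemma integral_circle_eq {E : Type*} [NormedAddCommGroup E] [NormedSpace ℝ E] (s : S1)
    (H : S1 → E) : ∫ x, H x = ∫ t in Set.Ioc (-Real.pi) Real.pi, H (s + (t : S1)) := by
  have h := AddCircle.integral_preimage (2 * Real.pi) (-Real.pi) (fun x => H (s + x))
  rw [integral_add_left_eq_self, show -Real.pi + 2 * Real.pi = Real.pi by ring] at h
  exact h.symm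

lemma integral_rescaled_ball {E : Type*} [NormedAddCommGroup E] [NormedSpace ℝ E] (s : S1)
    (H : S1 → E) {r ε : ℝ} (hr : r < Real.pi) (hε : 0 < ε) :
    ∫ u : ℝ, (if |ε * u| < r then H (s + ((ε * u : ℝ) : S1)) else 0) =
      ε⁻¹ • ∫ x : S1, if ‖x - s‖ < r then H x else 0 := by
  rw [Measure.integral_comp_mul_left
    (fun t : ℝ => if |t| < r then H (s + (t : S1)) else 0) ε, abs_of_pos (inv_pos.2 hε),
    integral_circle_eq s, ← integral_indicator measurableSet_Ioc]
  congr 2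
  ext t
  by_cases ht : t ∈ Set.Ioc (-Real.pi) Real.pi
  · rw [Set.indicator_of_mem ht, add_sub_cancel_left, norm_coe_eq_abs (abs_le.2 ⟨ht.1.le, ht.2⟩)]
  · rw [Set.indicator_of_notMem ht, if_neg]
    intro h
    have := abs_lt.1 (h.trans hr)
    exact ht ⟨this.1, this.2.le⟩

lemma integral_gauss_circle_le (s : S1) {a ε : ℝ} (ha : 0 < a) (hε : 0 < ε) :
    ε⁻¹ * ∫ x : S1, Real.exp (-(a * (‖x - s‖ / ε) ^ 2)) ≤ ∫ u : ℝ, Real.exp (-a * u ^ 2) := by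
  rw [integral_circle_eq s]
  have h1 := Measure.integral_comp_mul_left (fun t : ℝ => Real.exp (-(a / ε ^ 2) * t ^ 2)) ε
  rw [abs_of_pos (inv_pos.2 hε), smul_eq_mul] at h1
  have h2 : ∀ u : ℝ, -(a / ε ^ 2) * (ε * u) ^ 2 = -a * u ^ 2 := by
    intro u; field_simp
  simp only [h2] at h1
  rw [h1]
  refine mul_le_mul_of_nonneg_left ?_ (inv_pos.2 hε).le
  have h3 : ∫ t in Set.Ioc (-Real.pi) Real.pi,
      Real.exp (-(a * (‖s + (t : S1) - s‖ / ε) ^ 2)) =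
      ∫ t in Set.Ioc (-Real.pi) Real.pi, Real.exp (-(a / ε ^ 2) * t ^ 2) := by
    refine setIntegral_congr_fun measurableSet_Ioc fun t ht => ?_
    rw [add_sub_cancel_left, norm_coe_eq_abs (abs_le.2 ⟨ht.1.le, ht.2⟩), div_pow, sq_abs]
    ring_nf
  rw [h3]
  exact setIntegral_le_integral (integrable_exp_neg_mul_sq (by positivity))
    (Eventually.of_forall fun t => (Real.exp_pos _).le)

/-- The functions on the line (near the fixed point, in the variable `x / ε`) and on the circle
(far from it) in which a function on the arc is decomposed. -/
abbrev GluedSpace (κ ε : ℝ) (ρ : S1 → ℝ) : Type :=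
  GaussBdd κ × WeightedBdd (fun x : S1 => κ * (ρ x / ε) ^ 2)

/-- Decomposition of a bounded function on the arc. -/
noncomputable def localize (s δ r₀ : ℝ) {κ : ℝ} (hκ : 0 ≤ κ) (ε : ℝ) (ρ : S1 → ℝ) :
    BddMeas (Metric.ball (s : S1) δ) →ₗ[ℂ] GluedSpace κ ε ρ where
  toFun φ :=
    (WeightedBdd.mk (fun u : ℝ => if |ε * u| < r₀ then
        extendZero (Metric.ball (s : S1) δ) φ.1 ((s : S1) + ((ε * u : ℝ) : S1)) else 0)
      (Measurable.ite (measurableSet_lt (by fun_prop) measurable_const)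
        ((extendZero_measurable Metric.isOpen_ball.measurableSet φ.2.1).comp
          (continuous_const.add ((AddCircle.continuous_mk' _).comp (by fun_prop))).measurable)
        measurable_const)
      |φ.2.2.choose|
      (fun u => by
        refine le_trans ?_ (le_mul_of_one_le_right (abs_nonneg _)
          (Real.one_le_exp (mul_nonneg hκ (sq_nonneg u))))
        split_ifs
        · exact extendZero_bound φ.2.2.choose_spec _
        · simp),
     WeightedBdd.mk (fun x : S1 => if ‖x - s‖ < r₀ then 0 else
        extendZero (Metric.ball (s : S1) δ) φ.1 x)
      (Measurable.ite (measurableSet_lt (by fun_prop) measurable_const) measurable_const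
        (extendZero_measurable Metric.isOpen_ball.measurableSet φ.2.1))
      |φ.2.2.choose|
      (fun x => by
        refine le_trans ?_ (le_mul_of_one_le_right (abs_nonneg _)
          (Real.one_le_exp (mul_nonneg hκ (sq_nonneg _))))
        split_ifs
        · simp
        · exact extendZero_bound φ.2.2.choose_spec _))
  map_add' φ ψ := by
    refine Prod.ext (WeightedBdd.ext fun u => ?_) (WeightedBdd.ext fun x => ?_)
    · simp only [WeightedBdd.mk_apply, Prod.fst_add, WeightedBdd.add_apply, Submodule.coe_add,
        extendZero_add]
      split_ifs <;> simp
    · simp only [WeightedBdd.mk_apply, Prod.snd_add, WeightedBdd.add_apply, Submodule.coe_add,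
        extendZero_add]
      split_ifs <;> simp
  map_smul' c φ := by
    refine Prod.ext (WeightedBdd.ext fun u => ?_) (WeightedBdd.ext fun x => ?_)
    · simp only [WeightedBdd.mk_apply, Prod.smul_fst, WeightedBdd.smul_apply, Submodule.coe_smul,
        extendZero_smul, RingHom.id_apply]
      split_ifs <;> simp
    · simp only [WeightedBdd.mk_apply, Prod.smul_snd, WeightedBdd.smul_apply, Submodule.coe_smul,
        extendZero_smul, RingHom.id_apply]
      split_ifs <;> simp

lemma localize_fst_apply (s δ r₀ : ℝ) {κ : ℝ} (hκ : 0 ≤ κ) (ε : ℝ) (ρ : S1 → ℝ)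
    (φ : BddMeas (Metric.ball (s : S1) δ)) (u : ℝ) :
    (localize s δ r₀ hκ ε ρ φ).1 u = if |ε * u| < r₀ then
      extendZero (Metric.ball (s : S1) δ) φ.1 ((s : S1) + ((ε * u : ℝ) : S1)) else 0 := rfl

lemma localize_snd_apply (s δ r₀ : ℝ) {κ : ℝ} (hκ : 0 ≤ κ) (ε : ℝ) (ρ : S1 → ℝ)
    (φ : BddMeas (Metric.ball (s : S1) δ)) (x : S1) :
    (localize s δ r₀ hκ ε ρ φ).2 x = if ‖x - s‖ < r₀ then 0 else
      extendZero (Metric.ball (s : S1) δ) φ.1 x := rfl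

lemma glue_bound {s r₀ κ ε R : ℝ} (hκ : 0 ≤ κ) (hε : 0 < ε) {ρ : S1 → ℝ} (h0 : ∀ x, 0 ≤ ρ x)
    (hR : ∀ x, ρ x ≤ R) (G : GluedSpace κ ε ρ) (x : S1) :
    ‖(if ‖x - s‖ < r₀ then G.1 (displacement s x / ε) else G.2 x)‖ ≤
      ‖G‖ * Real.exp (κ * (r₀ / ε) ^ 2) + ‖G‖ * Real.exp (κ * (R / ε) ^ 2) := by
  split_ifs with hx
  · refine (G.1.norm_apply_le _).trans (le_trans ?_ (le_add_of_nonneg_right (by positivity)))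
    refine mul_le_mul (norm_fst_le G) (Real.exp_le_exp.2 (mul_le_mul_of_nonneg_left ?_ hκ))
      (Real.exp_pos _).le (norm_nonneg _)
    rw [div_pow, div_pow, ← sq_abs (displacement _ _), abs_displacement]
    exact div_le_div_of_nonneg_right (pow_le_pow_left₀ (norm_nonneg _) hx.le 2) (sq_nonneg _)
  · refine (G.2.norm_apply_le _).trans (le_trans ?_ (le_add_of_nonneg_left (by positivity)))
    refine mul_le_mul (norm_snd_le G) (Real.exp_le_exp.2 (mul_le_mul_of_nonneg_left ?_ hκ))
      (Real.exp_pos _).le (norm_nonneg _)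
    exact pow_le_pow_left₀ (div_nonneg (h0 x) hε.le) (div_le_div_of_nonneg_right (hR x) hε.le) 2

/-- Reassembly of the two components to a bounded function on the arc. -/
noncomputable def glue (s δ r₀ : ℝ) {κ ε R : ℝ} (hκ : 0 ≤ κ) (hε : 0 < ε) {ρ : S1 → ℝ}
    (h0 : ∀ x, 0 ≤ ρ x) (hR : ∀ x, ρ x ≤ R) :
    GluedSpace κ ε ρ →ₗ[ℂ] BddMeas (Metric.ball (s : S1) δ) where
  toFun G := ⟨fun x => if ‖x.1 - s‖ < r₀ then G.1 (displacement s x.1 / ε) else G.2 x.1, by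
    refine Measurable.comp (g := fun x : S1 => if ‖x - s‖ < r₀ then G.1 (displacement s x / ε)
      else G.2 x) ?_ measurable_subtype_coe
    exact Measurable.ite (measurableSet_lt (by fun_prop) measurable_const)
      (G.1.measurable.comp ((measurable_displacement s).div_const ε)) G.2.measurable,
    _, fun x => glue_bound hκ hε h0 hR G x.1⟩
  map_add' G H := by
    ext x
    simp only [Prod.fst_add, Prod.snd_add, WeightedBdd.add_apply, Submodule.coe_add, Pi.add_apply]
    split_ifs <;> rfl
  map_smul' c G := by
    ext x
    simp only [Prod.smul_fst, Prod.smul_snd, WeightedBdd.smul_apply, Submodule.coe_smul,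
      Pi.smul_apply, RingHom.id_apply, smul_eq_mul]
    split_ifs <;> rfl

lemma glue_apply (s δ r₀ : ℝ) {κ ε R : ℝ} (hκ : 0 ≤ κ) (hε : 0 < ε) {ρ : S1 → ℝ}
    (h0 : ∀ x, 0 ≤ ρ x) (hR : ∀ x, ρ x ≤ R) (G : GluedSpace κ ε ρ)
    (x : Metric.ball (s : S1) δ) :
    (glue s δ r₀ hκ hε h0 hR G).1 x =
      if ‖x.1 - s‖ < r₀ then G.1 (displacement s x.1 / ε) else G.2 x.1 := rfl

lemma glue_localize (s δ r₀ : ℝ) {κ ε R : ℝ} (hκ : 0 ≤ κ) (hε : 0 < ε) {ρ : S1 → ℝ}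
    (h0 : ∀ x, 0 ≤ ρ x) (hR : ∀ x, ρ x ≤ R) (φ : BddMeas (Metric.ball (s : S1) δ)) :
    glue s δ r₀ hκ hε h0 hR (localize s δ r₀ hκ ε ρ φ) = φ := by
  ext x
  rw [glue_apply, localize_fst_apply, localize_snd_apply, mul_div_cancel₀ _ hε.ne',
    abs_displacement, coe_displacement, extendZero_apply]
  split_ifs <;> rfl

end Gluing

section GluedOperator

namespace StableData

variable {f : C(S1, S1)} {F : ℝ → ℝ} {σ : C(S1, ℝ)} {s δ θ b r₀ D : ℝ} {ρ : S1 → ℝ}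
  {m S κ κ₁ κ₂ : ℝ}

/-- Decomposition of a function on the arc, for the adapted metric. -/
noncomputable def loc (h : StableData f F σ s δ θ b r₀ D ρ m S κ κ₁ κ₂) (ε : ℝ) :
    BddMeas (Metric.ball (s : S1) δ) →ₗ[ℂ] GluedSpace κ ε ρ :=
  localize s δ r₀ h.weight.pos.le ε ρ

/-- Reassembly of a function on the arc, for the adapted metric. -/
noncomputable def asm (h : StableData f F σ s δ θ b r₀ D ρ m S κ κ₁ κ₂) {ε : ℝ} (hε : 0 < ε) :
    GluedSpace κ ε ρ →ₗ[ℂ] BddMeas (Metric.ball (s : S1) δ) :=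
  glue s δ r₀ h.weight.pos.le hε h.rho_nonneg h.rho_le

lemma asm_loc (h : StableData f F σ s δ θ b r₀ D ρ m S κ κ₁ κ₂) {ε : ℝ} (hε : 0 < ε)
    (φ : BddMeas (Metric.ball (s : S1) δ)) : h.asm hε (h.loc ε φ) = φ :=
  glue_localize _ _ _ _ _ _ _ _

lemma loc_injective (h : StableData f F σ s δ θ b r₀ D ρ m S κ κ₁ κ₂) {ε : ℝ} (hε : 0 < ε) :
    Function.Injective (h.loc ε) :=
  Function.LeftInverse.injective (h.asm_loc hε)

/-- The limiting operator on the glued space. -/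
noncomputable def modelOp (h : StableData f F σ s δ θ b r₀ D ρ m S κ κ₁ κ₂) (ε : ℝ) :
    GluedSpace κ ε ρ →L[ℂ] GluedSpace κ ε ρ :=
  ContinuousLinearMap.inl ℂ (GaussBdd κ) (WeightedBdd (fun x : S1 => κ * (ρ x / ε) ^ 2)) ∘L
    mehlerOp h.weight h.metric.abs_deriv_le ∘L
    ContinuousLinearMap.fst ℂ (GaussBdd κ) (WeightedBdd (fun x : S1 => κ * (ρ x / ε) ^ 2))

lemma modelOp_apply (h : StableData f F σ s δ θ b r₀ D ρ m S κ κ₁ κ₂) (ε : ℝ)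
    (G : GluedSpace κ ε ρ) :
    h.modelOp ε G = (mehlerOp h.weight h.metric.abs_deriv_le G.1, 0) := rfl

/-- The mass of a function on the arc. -/
noncomputable def mass (_ : StableData f F σ s δ θ b r₀ D ρ m S κ κ₁ κ₂) (ε : ℝ)
    (φ : BddMeas (Metric.ball (s : S1) δ)) : ℝ :=
  scaledMass ρ κ₁ ε (extendZero (Metric.ball (s : S1) δ) φ.1)

lemma mass_nonneg (h : StableData f F σ s δ θ b r₀ D ρ m S κ κ₁ κ₂) {ε : ℝ} (hε : 0 < ε)
    (φ : BddMeas (Metric.ball (s : S1) δ)) : 0 ≤ h.mass ε φ :=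
  scaledMass_nonneg _ _ hε _

lemma measurable_extend (φ : BddMeas (Metric.ball ((s : ℝ) : S1) δ)) :
    Measurable (extendZero (Metric.ball (s : S1) δ) φ.1) :=
  extendZero_measurable Metric.isOpen_ball.measurableSet φ.2.1

lemma bounded_extend (φ : BddMeas (Metric.ball ((s : ℝ) : S1) δ)) :
    ∃ B, ∀ x, ‖extendZero (Metric.ball (s : S1) δ) φ.1 x‖ ≤ B := by
  obtain ⟨-, C, hC⟩ := φ.2
  exact ⟨_, extendZero_bound hC⟩

lemma norm_extend_asm_le (h : StableData f F σ s δ θ b r₀ D ρ m S κ κ₁ κ₂) {ε : ℝ} (hε : 0 < ε)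
    (G : GluedSpace κ ε ρ) (x : S1) :
    ‖extendZero (Metric.ball (s : S1) δ) (h.asm hε G).1 x‖ ≤
      ‖G‖ * Real.exp (κ * (ρ x / ε) ^ 2) := by
  by_cases hx : x ∈ Metric.ball (s : S1) δ
  · rw [extendZero_apply _ _ ⟨x, hx⟩, asm, glue_apply]
    split_ifs with hxr
    · refine (G.1.norm_apply_le _).trans ?_
      rw [div_pow, ← sq_abs (displacement _ _), abs_displacement, ← h.metric.eq x hxr, ← div_pow]
      exact mul_le_mul_of_nonneg_right (norm_fst_le G) (Real.exp_pos _).le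
    · exact (G.2.norm_apply_le _).trans
        (mul_le_mul_of_nonneg_right (norm_snd_le G) (Real.exp_pos _).le)
  · rw [extendZero_of_notMem _ _ hx, norm_zero]
    positivity

lemma extend_asm_apply (h : StableData f F σ s δ θ b r₀ D ρ m S κ κ₁ κ₂) {ε : ℝ} (hε : 0 < ε)
    (G : GluedSpace κ ε ρ) {u : ℝ} (hu : |ε * u| < r₀) :
    extendZero (Metric.ball (s : S1) δ) (h.asm hε G).1 ((s : S1) + ((ε * u : ℝ) : S1)) = G.1 u := by
  have hpi := hu.trans h.metric.radius_lt_pi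
  have hn : ‖(s : S1) + ((ε * u : ℝ) : S1) - s‖ = |ε * u| := by
    rw [add_sub_cancel_left, norm_coe_eq_abs hpi.le]
  have hx : (s : S1) + ((ε * u : ℝ) : S1) ∈ Metric.ball (s : S1) δ := by
    rw [Metric.mem_ball, dist_eq_norm, hn]
    exact hu.trans_le h.metric.radius_le
  rw [extendZero_apply _ _ ⟨_, hx⟩, asm, glue_apply]
  simp only
  rw [hn, if_pos hu, displacement_coe_add _ hpi, mul_div_cancel_left₀ _ hε.ne']

lemma integrable_mass (h : StableData f F σ s δ θ b r₀ D ρ m S κ κ₁ κ₂) (ε : ℝ)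
    {φ : S1 → ℂ} (hφ : Measurable φ) (hB : ∃ B, ∀ x, ‖φ x‖ ≤ B) :
    Integrable fun x => ‖φ x‖ * Real.exp (-(κ₁ * (ρ x / ε) ^ 2)) := by
  obtain ⟨B, hB⟩ := hB
  have hρ := h.continuous_rho
  have hκ := h.mid_pos
  refine Integrable.of_bound (hφ.norm.mul (by fun_prop)).aestronglyMeasurable B
    (Eventually.of_forall fun x => ?_)
  rw [Real.norm_of_nonneg (by positivity)]
  exact (mul_le_of_le_one_right (norm_nonneg _)
    (Real.exp_le_one_iff.2 (neg_nonpos.2 (by positivity)))).trans (hB x)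

lemma mass_asm_le (h : StableData f F σ s δ θ b r₀ D ρ m S κ κ₁ κ₂) {ε : ℝ} (hε : 0 < ε)
    (G : GluedSpace κ ε ρ) :
    h.mass ε (h.asm hε G) ≤ (∫ u : ℝ, Real.exp (-(κ₁ - κ) * u ^ 2)) * ‖G‖ := by
  have hκ := sub_pos.2 h.lt_mid
  have hi : Integrable fun x : S1 => Real.exp (-((κ₁ - κ) * (‖x - s‖ / ε) ^ 2)) := by
    refine Integrable.of_bound (Measurable.aestronglyMeasurable (by fun_prop)) 1
      (Eventually.of_forall fun x => ?_)
    rw [Real.norm_of_nonneg (Real.exp_pos _).le]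
    exact Real.exp_le_one_iff.2 (neg_nonpos.2 (by positivity))
  have h1 := mul_le_mul_of_nonneg_right (integral_gauss_circle_le (s : S1) hκ hε) (norm_nonneg G)
  refine le_trans ?_ h1
  rw [mass, scaledMass, mul_assoc]
  refine mul_le_mul_of_nonneg_left ?_ (inv_pos.2 hε).le
  rw [← integral_mul_const]
  refine integral_mono (h.integrable_mass ε (measurable_extend _) (bounded_extend _))
    (hi.mul_const _) fun x => ?_
  refine (mul_le_mul_of_nonneg_right (h.norm_extend_asm_le hε G x) (Real.exp_pos _).le).trans ?_
  rw [mul_assoc, ← Real.exp_add, mul_comm]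
  refine mul_le_mul_of_nonneg_right (Real.exp_le_exp.2 ?_) (norm_nonneg _)
  have h2 := pow_le_pow_left₀ (div_nonneg (norm_nonneg _) hε.le)
    (div_le_div_of_nonneg_right (h.metric.le x) hε.le) 2
  have h3 := mul_le_mul_of_nonneg_left h2 hκ.le
  linarith

lemma gaussMass_fst_le (h : StableData f F σ s δ θ b r₀ D ρ m S κ κ₁ κ₂) {ε : ℝ}
    (G : GluedSpace κ ε ρ) :
    gaussMass κ₁ G.1 ≤ (∫ u : ℝ, Real.exp (-(κ₁ - κ) * u ^ 2)) * ‖G‖ := by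
  have hκ := sub_pos.2 h.lt_mid
  rw [gaussMass, ← integral_mul_const]
  refine integral_mono (GaussBdd.integrable_norm h.lt_mid G.1)
    ((integrable_exp_neg_mul_sq hκ).mul_const _) fun u => ?_
  refine (mul_le_mul_of_nonneg_right ((G.1.norm_apply_le u).trans (mul_le_mul_of_nonneg_right
    (norm_fst_le G) (Real.exp_pos _).le)) (Real.exp_pos _).le).trans (le_of_eq ?_)
  rw [mul_assoc, ← Real.exp_add, mul_comm]
  ring_nf

lemma gaussMass_loc_le (h : StableData f F σ s δ θ b r₀ D ρ m S κ κ₁ κ₂) {ε : ℝ} (hε : 0 < ε)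
    (φ : BddMeas (Metric.ball (s : S1) δ)) :
    gaussMass κ₁ (h.loc ε φ).1 ≤ h.mass ε φ := by
  have hρ := h.continuous_rho
  have h1 := integral_rescaled_ball (s : S1)
    (fun x => ‖extendZero (Metric.ball (s : S1) δ) φ.1 x‖ *
      Real.exp (-(κ₁ * (‖x - s‖ / ε) ^ 2))) h.metric.radius_lt_pi hε
  have h2 : gaussMass κ₁ (h.loc ε φ).1 = ∫ u : ℝ, (if |ε * u| < r₀ then
      ‖extendZero (Metric.ball (s : S1) δ) φ.1 ((s : S1) + ((ε * u : ℝ) : S1))‖ *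
      Real.exp (-(κ₁ * (‖(s : S1) + ((ε * u : ℝ) : S1) - s‖ / ε) ^ 2)) else 0) := by
    refine integral_congr_ae (Eventually.of_forall fun u => ?_)
    simp only [loc, localize_fst_apply]
    split_ifs with hu
    · rw [add_sub_cancel_left, norm_coe_eq_abs (hu.trans h.metric.radius_lt_pi).le, abs_mul,
        abs_of_pos hε, mul_div_cancel_left₀ _ hε.ne', sq_abs, neg_mul]
    · simp
  rw [h2, h1, mass, scaledMass, smul_eq_mul]
  refine mul_le_mul_of_nonneg_left ?_ (inv_pos.2 hε).le
  have hi := h.integrable_mass ε (measurable_extend φ) (bounded_extend φ)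
  have hpt : ∀ x : S1, (if ‖x - s‖ < r₀ then ‖extendZero (Metric.ball (s : S1) δ) φ.1 x‖ *
      Real.exp (-(κ₁ * (‖x - s‖ / ε) ^ 2)) else 0) ≤
      ‖extendZero (Metric.ball (s : S1) δ) φ.1 x‖ * Real.exp (-(κ₁ * (ρ x / ε) ^ 2)) := by
    intro x
    split_ifs with hx
    · rw [h.metric.eq x hx]
    · positivity
  refine integral_mono_of_nonneg (Eventually.of_forall fun x => ?_) hi (Eventually.of_forall hpt)
  simp only [Pi.zero_apply]
  split_ifs <;> positivity

lemma exists_norm_loc_block_sub_le (h : StableData f F σ s δ θ b r₀ D ρ m S κ κ₁ κ₂) :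
    ∃ C > (0 : ℝ), ∀ (ε : ℝ) (hε : 0 < ε), ε ≤ 1 → ∀ G : GluedSpace κ ε ρ,
      ‖h.loc ε (arcBlock f σ ε s δ (h.asm hε G)) - h.modelOp ε G‖ ≤
        C * ε * (h.mass ε (h.asm hε G) + gaussMass κ₁ G.1) := by
  obtain ⟨C₁, hC₁, h₁⟩ := h.exists_transition_compare
  obtain ⟨C₂, hC₂, h₂⟩ := h.exists_norm_transition_le
  obtain ⟨C₃, hC₃, h₃⟩ := h.exists_norm_mehlerOp_le
  have hr := h.metric.radius_pos
  have hκ := sub_pos.2 h.weight.lower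
  obtain ⟨a, ha⟩ : ∃ a, a = ((κ - θ * κ₂) * r₀ ^ 2)⁻¹ := ⟨_, rfl⟩
  have ha0 : 0 < a := by rw [ha]; positivity
  refine ⟨C₁ + C₂ * a + C₃ * a, by positivity, fun ε hε hε1 G => ?_⟩
  have hfar := fun {y : ℝ} (hy : r₀ / ε ≤ y) => h.exp_far_le hε hε1 hy
  rw [← ha] at hfar
  have hN1 := h.mass_nonneg hε (h.asm hε G)
  have hN2 := gaussMass_nonneg κ₁ G.1
  obtain ⟨ψ, hψ⟩ : ∃ ψ, ψ = h.asm hε G := ⟨_, rfl⟩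
  have hG : ∀ u, |ε * u| < r₀ → G.1 u =
      extendZero (Metric.ball (s : S1) δ) ψ.1 ((s : S1) + ((ε * u : ℝ) : S1)) := fun u hu => by
    rw [hψ, h.extend_asm_apply hε G hu]
  rw [← hψ] at hN1 ⊢
  have hTx : ∀ x ∈ Metric.ball (s : S1) δ,
      extendZero (Metric.ball (s : S1) δ) (arcBlock f σ ε s δ ψ).1 x =
        transition f σ ε (extendZero (Metric.ball (s : S1) δ) ψ.1) x := fun x hx => by
    rw [extendZero_apply _ _ ⟨x, hx⟩]
    rfl
  have hC0 : 0 ≤ (C₁ + C₂ * a + C₃ * a) * ε * (h.mass ε ψ + gaussMass κ₁ G.1) := by positivity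
  rw [modelOp_apply, Prod.norm_def]
  refine max_le (WeightedBdd.norm_le hC0 fun y => ?_) (WeightedBdd.norm_le hC0 fun x => ?_)
  · rw [Prod.fst_sub, WeightedBdd.sub_apply, loc, localize_fst_apply]
    split_ifs with hy
    · have hx : (s : S1) + ((ε * y : ℝ) : S1) ∈ Metric.ball (s : S1) δ := by
        rw [Metric.mem_ball, dist_eq_norm, add_sub_cancel_left,
          norm_coe_eq_abs (hy.trans h.metric.radius_lt_pi).le]
        exact hy.trans_le h.metric.radius_le
      rw [hTx _ hx]
      refine (h₁ _ (measurable_extend ψ) (bounded_extend ψ) ε hε hε1 G.1 hG y hy).trans ?_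
      refine mul_le_mul_of_nonneg_right ?_ (Real.exp_pos _).le
      refine mul_le_mul_of_nonneg_right (mul_le_mul_of_nonneg_right ?_ hε.le) (by positivity)
      linarith [mul_pos hC₂ ha0, mul_pos hC₃ ha0]
    · rw [zero_sub, norm_neg]
      have hy' : r₀ / ε ≤ |y| := by
        rw [abs_mul, abs_of_pos hε, not_lt, mul_comm] at hy
        rwa [div_le_iff₀ hε]
      have e1 := hfar hy'
      rw [sq_abs] at e1
      have e2 : 0 ≤ (C₁ + C₂ * a) * ε * (h.mass ε ψ + gaussMass κ₁ G.1) * Real.exp (κ * y ^ 2) := by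
        positivity
      have e3 : 0 ≤ C₃ * a * ε * h.mass ε ψ * Real.exp (κ * y ^ 2) := by positivity
      have e4 := mul_le_mul_of_nonneg_left e1 (by positivity : 0 ≤ C₃ * gaussMass κ₁ G.1)
      have e5 := h₃ G.1 y
      linarith
  · rw [Prod.snd_sub, sub_zero, loc, localize_snd_apply]
    split_ifs with hx
    · rw [norm_zero]
      positivity
    · by_cases hxV : x ∈ Metric.ball (s : S1) δ
      · rw [hTx x hxV]
        have hy' : r₀ / ε ≤ ρ x / ε :=
          div_le_div_of_nonneg_right ((not_lt.1 hx).trans (h.metric.le x)) hε.le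
        have e1 := hfar hy'
        have e2 : 0 ≤ (C₁ + C₃ * a) * ε * (h.mass ε ψ + gaussMass κ₁ G.1) *
          Real.exp (κ * (ρ x / ε) ^ 2) := by positivity
        have e3 : 0 ≤ C₂ * a * ε * gaussMass κ₁ G.1 * Real.exp (κ * (ρ x / ε) ^ 2) := by
          positivity
        have e4 := mul_le_mul_of_nonneg_left e1 (by positivity : 0 ≤ C₂ * h.mass ε ψ)
        have e5 := h₂ _ (measurable_extend ψ) (bounded_extend ψ) ε hε hε1 x hxV
        change _ ≤ C₂ * h.mass ε ψ * _ at e5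
        linarith
      · rw [extendZero_of_notMem _ _ hxV, norm_zero]
        positivity

/-- The block of the transition operator, conjugated to the glued space, is `O(ε)`-close to the
limiting operator, and more precisely so on functions of small mass. -/
theorem exists_glued_operator (h : StableData f F σ s δ θ b r₀ D ρ m S κ κ₁ κ₂) :
    ∃ C > (0 : ℝ), ∀ (ε : ℝ) (hε : 0 < ε), ε ≤ 1 →
      ∃ A : GluedSpace κ ε ρ →L[ℂ] GluedSpace κ ε ρ,
        (∀ G, A G = h.loc ε (arcBlock f σ ε s δ (h.asm hε G))) ∧
        ‖A - h.modelOp ε‖ ≤ C * ε ∧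
        (∀ φ, ‖A (h.loc ε φ) - h.modelOp ε (h.loc ε φ)‖ ≤ C * ε * h.mass ε φ) ∧
        (∀ φ, ‖h.modelOp ε (h.loc ε φ)‖ ≤ C * h.mass ε φ) := by
  obtain ⟨C, hC, hsub⟩ := h.exists_norm_loc_block_sub_le
  obtain ⟨C₃, hC₃, h₃⟩ := h.exists_norm_mehlerOp_le
  have hκ := sub_pos.2 h.lt_mid
  obtain ⟨I, hI⟩ : ∃ I, I = ∫ u : ℝ, Real.exp (-(κ₁ - κ) * u ^ 2) := ⟨_, rfl⟩
  have hI0 : 0 ≤ I := by rw [hI]; positivity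
  refine ⟨2 * C * (1 + I) + C₃, by positivity, fun ε hε hε1 => ?_⟩
  have hbd : ∀ G : GluedSpace κ ε ρ,
      ‖h.loc ε (arcBlock f σ ε s δ (h.asm hε G)) - h.modelOp ε G‖ ≤
        (2 * C * (1 + I) + C₃) * ε * ‖G‖ := by
    intro G
    have e1 := h.mass_asm_le hε G
    have e2 := h.gaussMass_fst_le G
    rw [← hI] at e1 e2
    have e3 := mul_le_mul_of_nonneg_left (add_le_add e1 e2) (by positivity : 0 ≤ C * ε)
    have e4 : 0 ≤ (2 * C + C₃) * ε * ‖G‖ := by positivity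
    linarith [hsub ε hε hε1 G]
  obtain ⟨L, hL⟩ : ∃ L, L = (2 * C * (1 + I) + C₃) * ε + ‖h.modelOp ε‖ := ⟨_, rfl⟩
  refine ⟨LinearMap.mkContinuous (h.loc ε ∘ₗ arcBlock f σ ε s δ ∘ₗ h.asm hε) L fun G => ?_,
    fun G => rfl, ?_, fun φ => ?_, fun φ => ?_⟩
  · rw [hL, add_mul]
    have e1 := norm_le_norm_sub_add (h.loc ε (arcBlock f σ ε s δ (h.asm hε G))) (h.modelOp ε G)
    have e2 := (h.modelOp ε).le_opNorm G
    exact e1.trans (add_le_add (hbd G) e2)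
  · exact ContinuousLinearMap.opNorm_le_bound _ (by positivity) hbd
  · have e1 := hsub ε hε hε1 (h.loc ε φ)
    rw [h.asm_loc] at e1
    have e2 := h.gaussMass_loc_le hε φ
    have e3 := mul_le_mul_of_nonneg_left e2 (by positivity : 0 ≤ C * ε)
    have e4 := h.mass_nonneg hε φ
    have e5 : 0 ≤ (2 * C * I + C₃) * ε * h.mass ε φ := by positivity
    change ‖h.loc ε (arcBlock f σ ε s δ (h.asm hε (h.loc ε φ))) - _‖ ≤ _
    rw [h.asm_loc]
    linarith
  · have e4 := h.mass_nonneg hε φ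
    rw [modelOp_apply, Prod.norm_mk, norm_zero, max_eq_left (norm_nonneg _)]
    refine (WeightedBdd.norm_le (C := C₃ * h.mass ε φ) (by positivity) fun y => ?_).trans ?_
    · refine (h₃ _ y).trans ?_
      refine mul_le_mul (mul_le_mul_of_nonneg_left (h.gaussMass_loc_le hε φ) hC₃.le)
        (Real.exp_le_exp.2 (mul_le_mul_of_nonneg_right h.weight.lower.le (sq_nonneg y)))
        (Real.exp_pos _).le (by positivity)
    · refine mul_le_mul_of_nonneg_right ?_ e4
      have : 0 ≤ 2 * C * (1 + I) := by positivity
      linarith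

end StableData

end GluedOperator

section Densities

lemma Module.End.finrank_maxGenEigenspace_eq_one {E : Type*} [AddCommGroup E] [Module ℂ E]
    {T : Module.End ℂ E} {μ : ℂ} {g : E} (hg : g ≠ 0)
    (h : ∀ (a : ℂ) (g₂ : E), T g₂ = μ • g₂ + a • g → ∃ t : ℂ, g₂ = t • g) (hT : T g = μ • g) :
    Module.finrank ℂ (T.maxGenEigenspace μ) = 1 := by
  have key : ∀ (k : ℕ) (v : E), ((T - μ • (1 : Module.End ℂ E)) ^ k) v = 0 → ∃ t : ℂ, v = t • g := by
    intro k
    induction k with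
    | zero => intro v hv; exact ⟨0, by simpa using hv⟩
    | succ k ih =>
      intro v hv
      rw [pow_succ, Module.End.mul_apply] at hv
      obtain ⟨a, ha⟩ := ih _ hv
      refine h a v ?_
      rw [LinearMap.sub_apply, LinearMap.smul_apply, Module.End.one_apply, sub_eq_iff_eq_add] at ha
      rw [ha, add_comm]
  have hspan : T.maxGenEigenspace μ = Submodule.span ℂ {g} := by
    ext v
    rw [Module.End.mem_maxGenEigenspace, Submodule.mem_span_singleton]
    constructor
    · rintro ⟨k, hk⟩
      obtain ⟨t, ht⟩ := key k v hk
      exact ⟨t, ht.symm⟩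
    · rintro ⟨t, rfl⟩
      refine ⟨1, ?_⟩
      rw [pow_one, LinearMap.sub_apply, LinearMap.smul_apply, Module.End.one_apply, map_smul, hT,
        smul_comm, sub_self]
  rw [hspan, finrank_span_singleton hg]

instance (V : Set S1) : IsFiniteMeasure (arcMeasure V) := by
  unfold arcMeasure; infer_instance

variable {V : Set S1}

lemma integrable_test_mul (φ : BddMeas V) {m : V → ℂ} (hm : Integrable m (arcMeasure V)) :
    Integrable (fun x => φ.1 x * m x) (arcMeasure V) := by
  obtain ⟨hφ, C, hC⟩ := φ.2
  exact hm.bdd_mul hφ.aestronglyMeasurable (Eventually.of_forall hC)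

/-- An integrable function is dominated by `w` if it is so when tested against bounded functions. -/
lemma ae_norm_le_of_forall_test {m : V → ℂ} {w : V → ℝ} (hm : Integrable m (arcMeasure V))
    (hw : Integrable w (arcMeasure V))
    (h : ∀ φ : BddMeas V, ‖∫ x, φ.1 x * m x ∂(arcMeasure V)‖ ≤
      ∫ x, ‖φ.1 x‖ * w x ∂(arcMeasure V)) (hw0 : ∀ x, 0 ≤ w x) :
    ∀ᵐ x ∂(arcMeasure V), ‖m x‖ ≤ w x := by
  refine ae_le_of_forall_setIntegral_le hm.norm hw fun t ht _ => ?_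
  obtain ⟨m', hm', hmm'⟩ := hm.aestronglyMeasurable
  have hm'' : Measurable m' := hm'.measurable
  obtain ⟨p, hp⟩ : ∃ p : V → ℂ, p = t.indicator fun x => (starRingEnd ℂ) (m' x) / (‖m' x‖ : ℂ) :=
    ⟨_, rfl⟩
  have hp1 : ∀ x, ‖p x‖ ≤ t.indicator (fun _ => (1 : ℝ)) x := by
    intro x
    rw [hp]
    by_cases hx : x ∈ t
    · rw [Set.indicator_of_mem hx, Set.indicator_of_mem hx, norm_div, RCLike.norm_conj,
        Complex.norm_real, norm_norm]
      exact div_self_le_one _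
    · rw [Set.indicator_of_notMem hx, Set.indicator_of_notMem hx, norm_zero]
  have hpm : Measurable p := by
    rw [hp]
    exact ((Complex.continuous_conj.measurable.comp hm'').div
      (Complex.measurable_ofReal.comp hm''.norm)).indicator ht
  have hp2 : ∀ x, p x * m' x = t.indicator (fun x => (‖m' x‖ : ℂ)) x := by
    intro x
    rw [hp]
    by_cases hx : x ∈ t
    · rw [Set.indicator_of_mem hx, Set.indicator_of_mem hx]
      rcases eq_or_ne (m' x) 0 with h0 | h0
      · simp [h0]
      · have h1 : (‖m' x‖ : ℂ) ≠ 0 := by simpa using h0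
        rw [div_mul_eq_mul_div, div_eq_iff h1, mul_comm, Complex.mul_conj, Complex.normSq_eq_norm_sq]
        push_cast
        ring
    · rw [Set.indicator_of_notMem hx, Set.indicator_of_notMem hx, zero_mul]
  have h1 := h ⟨p, hpm, 1, fun x => (hp1 x).trans (Set.indicator_le_self' (by simp) x)⟩
  have h2 : ∫ x, p x * m x ∂(arcMeasure V) = ((∫ x in t, ‖m x‖ ∂(arcMeasure V) : ℝ) : ℂ) := by
    rw [← integral_complex_ofReal, ← integral_indicator ht]
    refine integral_congr_ae ?_
    filter_upwards [hmm'] with x hx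
    rw [hx, hp2]
    by_cases hxt : x ∈ t
    · rw [Set.indicator_of_mem hxt, Set.indicator_of_mem hxt, hx]
    · rw [Set.indicator_of_notMem hxt, Set.indicator_of_notMem hxt]
  rw [h2, Complex.norm_real] at h1
  refine (le_abs_self _).trans (h1.trans ?_)
  rw [← integral_indicator ht]
  refine integral_mono_of_nonneg (Eventually.of_forall fun x => mul_nonneg (norm_nonneg _) (hw0 x))
    (hw.indicator ht) (Eventually.of_forall fun x => ?_)
  refine (mul_le_mul_of_nonneg_right (hp1 x) (hw0 x)).trans (le_of_eq ?_)
  by_cases hxt : x ∈ t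
  · rw [Set.indicator_of_mem hxt, Set.indicator_of_mem hxt, one_mul]
  · rw [Set.indicator_of_notMem hxt, Set.indicator_of_notMem hxt, zero_mul]

lemma ae_eq_zero_of_forall_test {m : V → ℂ} (hm : Integrable m (arcMeasure V))
    (h : ∀ φ : BddMeas V, ∫ x, φ.1 x * m x ∂(arcMeasure V) = 0) : m =ᵐ[arcMeasure V] 0 := by
  have := ae_norm_le_of_forall_test hm (integrable_zero _ ℝ _) (fun φ => by simp [h φ])
    (fun _ => le_rfl)
  filter_upwards [this] with x hx
  simpa using hx

lemma integral_arcMeasure {E : Type*} [NormedAddCommGroup E] [NormedSpace ℝ E]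
    (hV : MeasurableSet V) {H : S1 → E} (h0 : ∀ x ∉ V, H x = 0) :
    ∫ x, H x.1 ∂(arcMeasure V) = ∫ x, H x := by
  rw [arcMeasure, integral_subtype_comap hV, setIntegral_eq_integral_of_forall_compl_eq_zero h0]

namespace StableData

variable {f : C(S1, S1)} {F : ℝ → ℝ} {σ : C(S1, ℝ)} {s δ θ b r₀ D : ℝ} {ρ : S1 → ℝ}
  {m S κ κ₁ κ₂ : ℝ}

lemma mass_eq (h : StableData f F σ s δ θ b r₀ D ρ m S κ κ₁ κ₂) (ε : ℝ)
    (φ : BddMeas (Metric.ball (s : S1) δ)) :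
    h.mass ε φ = ε⁻¹ * ∫ x, ‖φ.1 x‖ * Real.exp (-(κ₁ * (ρ x.1 / ε) ^ 2))
      ∂(arcMeasure (Metric.ball (s : S1) δ)) := by
  rw [mass, scaledMass, ← integral_arcMeasure Metric.isOpen_ball.measurableSet]
  · congr 1
    refine integral_congr_ae (Eventually.of_forall fun x => ?_)
    simp only [extendZero_apply]
  · intro x hx
    rw [extendZero_of_notMem _ _ hx, norm_zero, zero_mul]

lemma integral_loc_mul (h : StableData f F σ s δ θ b r₀ D ρ m S κ κ₁ κ₂) {ε : ℝ} (hε : 0 < ε)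
    (φ : BddMeas (Metric.ball (s : S1) δ)) (H : ℝ → ℂ) :
    ∫ u, (h.loc ε φ).1 u * H u = (ε : ℂ)⁻¹ * ∫ x, φ.1 x *
      (if ‖x.1 - s‖ < r₀ then H (displacement s x.1 / ε) else 0)
      ∂(arcMeasure (Metric.ball (s : S1) δ)) := by
  have h1 := integral_rescaled_ball (s : S1) (fun x => extendZero (Metric.ball (s : S1) δ) φ.1 x *
    H (displacement s x / ε)) h.metric.radius_lt_pi hε
  have h2 : ∫ u, (h.loc ε φ).1 u * H u = ∫ u : ℝ, (if |ε * u| < r₀ then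
      extendZero (Metric.ball (s : S1) δ) φ.1 ((s : S1) + ((ε * u : ℝ) : S1)) *
        H (displacement s ((s : S1) + ((ε * u : ℝ) : S1)) / ε) else 0) := by
    refine integral_congr_ae (Eventually.of_forall fun u => ?_)
    simp only [loc, localize_fst_apply]
    split_ifs with hu
    · rw [displacement_coe_add _ (hu.trans h.metric.radius_lt_pi), mul_div_cancel_left₀ _ hε.ne']
    · rw [zero_mul]
  have h3 : ∀ z : ℂ, ε⁻¹ • z = (ε : ℂ)⁻¹ * z := fun z => by
    rw [Complex.real_smul, Complex.ofReal_inv]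
  rw [h2, h1, h3, ← integral_arcMeasure (V := Metric.ball (s : S1) δ)
    Metric.isOpen_ball.measurableSet]
  · congr 1
    refine integral_congr_ae (Eventually.of_forall fun x => ?_)
    simp only [extendZero_apply]
    split_ifs
    · rfl
    · rw [mul_zero]
  · intro x hx
    rw [extendZero_of_notMem _ _ hx, zero_mul, ite_self]

/-- The functional on the glued space given by a density on the arc. -/
noncomputable def densityFunctional (h : StableData f F σ s δ θ b r₀ D ρ m S κ κ₁ κ₂) {ε : ℝ}
    (hε : 0 < ε) {p : Metric.ball (s : S1) δ → ℂ}
    (hp : Integrable p (arcMeasure (Metric.ball (s : S1) δ))) :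
    GluedSpace κ ε ρ →L[ℂ] ℂ :=
  LinearMap.mkContinuous
    { toFun := fun G => ∫ x, (h.asm hε G).1 x * p x ∂(arcMeasure (Metric.ball (s : S1) δ))
      map_add' := fun G H => by
        rw [← integral_add (integrable_test_mul (h.asm hε G) hp) (integrable_test_mul (h.asm hε H) hp)]
        simp only [map_add, Submodule.coe_add, Pi.add_apply, add_mul]
      map_smul' := fun c G => by
        simp only [map_smul, Submodule.coe_smul, Pi.smul_apply, smul_eq_mul, mul_assoc,
          integral_const_mul, RingHom.id_apply] }
    (∫ x, Real.exp (κ * (ρ x.1 / ε) ^ 2) * ‖p x‖ ∂(arcMeasure (Metric.ball (s : S1) δ)))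
    (fun G => by
      have hκ := h.weight.pos
      have hρ := h.continuous_rho
      have hi : Integrable (fun x : Metric.ball (s : S1) δ =>
          Real.exp (κ * (ρ x.1 / ε) ^ 2) * ‖p x‖) (arcMeasure (Metric.ball (s : S1) δ)) := by
        refine hp.norm.bdd_mul (c := Real.exp (κ * (b * Real.pi / ε) ^ 2))
          (Measurable.aestronglyMeasurable (by fun_prop)) (Eventually.of_forall fun x => ?_)
        rw [Real.norm_of_nonneg (Real.exp_pos _).le]
        refine Real.exp_le_exp.2 (mul_le_mul_of_nonneg_left ?_ hκ.le)
        exact pow_le_pow_left₀ (div_nonneg (h.rho_nonneg _) hε.le)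
          (div_le_div_of_nonneg_right (h.rho_le _) hε.le) 2
      rw [← integral_mul_const]
      refine norm_integral_le_of_norm_le (hi.mul_const _) (Eventually.of_forall fun x => ?_)
      have e1 := h.norm_extend_asm_le hε G x.1
      rw [extendZero_apply] at e1
      rw [norm_mul]
      refine (mul_le_mul_of_nonneg_right e1 (norm_nonneg _)).trans (le_of_eq ?_)
      ring)

lemma densityFunctional_apply (h : StableData f F σ s δ θ b r₀ D ρ m S κ κ₁ κ₂) {ε : ℝ}
    (hε : 0 < ε) {p : Metric.ball (s : S1) δ → ℂ}
    (hp : Integrable p (arcMeasure (Metric.ball (s : S1) δ))) (G : GluedSpace κ ε ρ) :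
    h.densityFunctional hε hp G =
      ∫ x, (h.asm hε G).1 x * p x ∂(arcMeasure (Metric.ball (s : S1) δ)) := rfl

lemma densityFunctional_loc (h : StableData f F σ s δ θ b r₀ D ρ m S κ κ₁ κ₂) {ε : ℝ}
    (hε : 0 < ε) {p : Metric.ball (s : S1) δ → ℂ}
    (hp : Integrable p (arcMeasure (Metric.ball (s : S1) δ)))
    (φ : BddMeas (Metric.ball (s : S1) δ)) :
    h.densityFunctional hε hp (h.loc ε φ) =
      ∫ x, φ.1 x * p x ∂(arcMeasure (Metric.ball (s : S1) δ)) := by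
  rw [densityFunctional_apply, h.asm_loc]

end StableData

end Densities

section Core

/-- An eigenfunctional of `A` near the eigenfunctional `l i` of `A₀`, evaluated at a vector on which
`A` and `A₀` almost agree. -/
lemma SpectralModel.norm_functional_sub_le {ι X : Type*} [Fintype ι] [NormedAddCommGroup X]
    [NormedSpace ℂ X] {A₀ A : X →L[ℂ] X} {lam : ι → ℂ} {e : ι → X} {l : ι → X →L[ℂ] ℂ} {M r : ℝ}
    {n : ℕ} (h : SpectralModel A₀ lam e l M r n) (hr : 0 < r) {i : ι} {μ a : ℂ} {Λ : X →L[ℂ] ℂ}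
    {q ε C : ℝ} (hq4 : q * ε ≤ 1 / 4) (hqr : q * ε ≤ r / 2) (hμ : r < ‖μ‖)
    (hμi : ‖μ - lam i‖ ≤ q * ε) (hΛ : ∀ g, Λ (A g) = μ * Λ g)
    (hclose : ‖Λ - a • l i‖ ≤ q * ε * ‖Λ‖) :
    ‖Λ‖ ≤ 2 * M * ‖a‖ ∧ ∀ (g : X) (w : ℝ), ‖A g - A₀ g‖ ≤ C * ε * w → ‖A₀ g‖ ≤ C * w →
      ‖Λ g - a * l i g‖ ≤ (2 * M * C + 2 * M * q * C + 2 * M * q * C / r) / r * ε * ‖a‖ * w := by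
  have hM : 0 ≤ M := zero_le_one.trans h.one_le
  have hΛa : ‖Λ‖ ≤ 2 * M * ‖a‖ := by
    have e1 := norm_le_norm_sub_add Λ (a • l i)
    rw [norm_smul] at e1
    have e2 := mul_le_mul_of_nonneg_left (h.norm_fun i) (norm_nonneg a)
    have e3 := mul_le_mul_of_nonneg_right hq4 (norm_nonneg Λ)
    have e4 : 0 ≤ M * ‖a‖ := by positivity
    linarith
  refine ⟨hΛa, fun g w h1 h2 => ?_⟩
  have hμ0 : 0 < ‖μ‖ := hr.trans hμ
  have hqε : 0 ≤ q * ε := (norm_nonneg _).trans hμi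
  have hw : 0 ≤ C * w := (norm_nonneg _).trans h2
  have hl : ‖l i g‖ ≤ 2 * M * (C * w) / r := by
    have e1 : r / 2 ≤ ‖lam i‖ := by
      have := norm_le_norm_sub_add μ (lam i)
      linarith
    have e2 : ‖lam i‖ * ‖l i g‖ ≤ M * (C * w) := by
      rw [← norm_mul, ← h.coeig]
      exact ((l i).le_opNorm _).trans (mul_le_mul (h.norm_fun i) h2 (norm_nonneg _) hM)
    have e3 := mul_le_mul_of_nonneg_right e1 (norm_nonneg (l i g))
    rw [le_div_iff₀ hr]
    linarith
  have hid : μ * (Λ g - a * l i g) = Λ (A g - A₀ g) + (Λ - a • l i) (A₀ g) -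
      a * ((μ - lam i) * l i g) := by
    rw [map_sub, hΛ, sub_apply, smul_apply, h.coeig,
      smul_eq_mul]
    ring
  have b1 : ‖Λ (A g - A₀ g)‖ ≤ 2 * M * ‖a‖ * (C * ε * w) :=
    (Λ.le_opNorm _).trans (mul_le_mul hΛa h1 (norm_nonneg _) (by positivity))
  have b2 : ‖(Λ - a • l i) (A₀ g)‖ ≤ q * ε * (2 * M * ‖a‖) * (C * w) :=
    (ContinuousLinearMap.le_opNorm _ _).trans (mul_le_mul
      (hclose.trans (mul_le_mul_of_nonneg_left hΛa hqε)) h2 (norm_nonneg _) (by positivity))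
  have b3 : ‖a * ((μ - lam i) * l i g)‖ ≤ ‖a‖ * (q * ε * (2 * M * (C * w) / r)) := by
    rw [norm_mul, norm_mul]
    exact mul_le_mul_of_nonneg_left (mul_le_mul hμi hl (norm_nonneg _) hqε) (norm_nonneg _)
  have b4 : ‖μ‖ * ‖Λ g - a * l i g‖ ≤ 2 * M * ‖a‖ * (C * ε * w) +
      q * ε * (2 * M * ‖a‖) * (C * w) + ‖a‖ * (q * ε * (2 * M * (C * w) / r)) := by
    rw [← norm_mul, hid]
    exact (norm_sub_le _ _).trans (add_le_add ((norm_add_le _ _).trans (add_le_add b1 b2)) b3)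
  have b5 := mul_le_mul_of_nonneg_right hμ.le (norm_nonneg (Λ g - a * l i g))
  have b6 : (2 * M * C + 2 * M * q * C + 2 * M * q * C / r) / r * ε * ‖a‖ * w =
      (2 * M * ‖a‖ * (C * ε * w) +
      q * ε * (2 * M * ‖a‖) * (C * w) + ‖a‖ * (q * ε * (2 * M * (C * w) / r))) / r := by
    ring
  rw [b6, le_div_iff₀ hr]
  linarith

namespace StableData

variable {f : C(S1, S1)} {F : ℝ → ℝ} {σ : C(S1, ℝ)} {s δ θ b r₀ D : ℝ} {ρ : S1 → ℝ}
  {m S κ κ₁ κ₂ : ℝ}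

lemma exists_hermite_constants (h : StableData f F σ s δ θ b r₀ D ρ m S κ κ₁ κ₂) (N : ℕ) :
    ∃ H > (0 : ℝ), ∀ i : Fin (N + 1), hermiteNormSq i ≤ H ∧
      ∀ u, |hermiteFun i u| ≤ H * Real.exp (-κ₂ * u ^ 2) := by
  choose B hB hBu using fun n => exists_hermiteFun_bound n h.weight.upper_lt_one
  have hsum : ∀ (v : ℕ → ℝ), (∀ n, 0 < v n) → ∀ i : Fin (N + 1),
      v i ≤ ∑ n ∈ Finset.range (N + 1), v n := fun v hv i =>
    Finset.single_le_sum (f := v) (fun n _ => (hv n).le) (Finset.mem_range.2 i.2)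
  have e1 := fun i => hsum hermiteNormSq hermiteNormSq_pos i
  have e2 := fun i => hsum B hB i
  have p1 : 0 ≤ ∑ n ∈ Finset.range (N + 1), hermiteNormSq n :=
    Finset.sum_nonneg fun n _ => (hermiteNormSq_pos n).le
  have p2 : 0 ≤ ∑ n ∈ Finset.range (N + 1), B n := Finset.sum_nonneg fun n _ => (hB n).le
  refine ⟨(∑ n ∈ Finset.range (N + 1), hermiteNormSq n) + (∑ n ∈ Finset.range (N + 1), B n) + 1,
    by positivity, fun i => ⟨by linarith [e1 i], fun u => (hBu i u).trans ?_⟩⟩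
  exact mul_le_mul_of_nonneg_right (by linarith [e2 i]) (Real.exp_pos _).le

/-- Passage from the tested estimate to the pointwise estimate of a density. -/
lemma ae_density_close (h : StableData f F σ s δ θ b r₀ D ρ m S κ κ₁ κ₂) {ε H K : ℝ}
    (hε : 0 < ε) (hε1 : ε ≤ 1) (hK : 0 ≤ K) (hH : 0 ≤ H) {n : ℕ}
    (hn : ∀ u, |hermiteFun n u| ≤ H * Real.exp (-κ₂ * u ^ 2)) {p : Metric.ball (s : S1) δ → ℂ}
    (hp : Integrable p (arcMeasure (Metric.ball (s : S1) δ)))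
    (htest : ∀ φ : BddMeas (Metric.ball (s : S1) δ),
      ‖∫ x, φ.1 x * p x ∂(arcMeasure (Metric.ball (s : S1) δ)) -
        ε * ∫ u, (h.loc ε φ).1 u * (hermiteFun n u : ℂ)‖ ≤ K * ε * (ε * h.mass ε φ)) :
    ∀ᵐ x ∂(arcMeasure (Metric.ball (s : S1) δ)),
      ‖p x - (hermiteFun n (displacement s x.1 / ε) : ℂ)‖ ≤
        (K + H * ((κ₂ - κ₁) * r₀ ^ 2)⁻¹) * ε *
          Real.exp (-(κ₁ * (displacement s x.1 / ε) ^ 2)) := by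
  have hκ := h.mid_pos
  have hκ2 := sub_pos.2 h.mid_lt
  have hr := h.metric.radius_pos
  have hρ := h.continuous_rho
  obtain ⟨c, hc⟩ : ∃ c : Metric.ball (s : S1) δ → ℂ, c = fun x =>
    if ‖x.1 - (s : S1)‖ < r₀ then (hermiteFun n (displacement s x.1 / ε) : ℂ) else 0 := ⟨_, rfl⟩
  have hbn : ∀ u, |hermiteFun n u| ≤ H := fun u => (hn u).trans
    (mul_le_of_le_one_right hH (Real.exp_le_one_iff.2 (by nlinarith [sq_nonneg u])))
  have hcm : Measurable c := by
    rw [hc]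
    exact Measurable.ite (measurableSet_lt (by fun_prop) measurable_const)
      ((measurable_ofReal_hermiteFun n).comp
        (((measurable_displacement s).comp measurable_subtype_coe).div_const ε)) measurable_const
  have hci : Integrable c (arcMeasure (Metric.ball (s : S1) δ)) := by
    refine Integrable.of_bound hcm.aestronglyMeasurable H (Eventually.of_forall fun x => ?_)
    rw [hc]
    simp only
    split_ifs
    · rw [Complex.norm_real]; exact hbn _
    · simpa using hH
  have hwi : Integrable (fun x : Metric.ball (s : S1) δ =>
      K * ε * Real.exp (-(κ₁ * (ρ x.1 / ε) ^ 2))) (arcMeasure (Metric.ball (s : S1) δ)) := by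
    refine Integrable.of_bound (Measurable.aestronglyMeasurable (by fun_prop)) (K * ε)
      (Eventually.of_forall fun x => ?_)
    rw [Real.norm_of_nonneg (by positivity)]
    exact mul_le_of_le_one_right (by positivity)
      (Real.exp_le_one_iff.2 (neg_nonpos.2 (by positivity)))
  have hmain := ae_norm_le_of_forall_test (hp.sub hci) hwi (fun φ => by
    have e1 := htest φ
    rw [h.integral_loc_mul hε, h.mass_eq, mul_inv_cancel_left₀ hε.ne',
      mul_inv_cancel_left₀ (Complex.ofReal_ne_zero.2 hε.ne')] at e1
    have e2 : ∫ x, φ.1 x * (p - c) x ∂(arcMeasure (Metric.ball (s : S1) δ)) =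
        ∫ x, φ.1 x * p x ∂(arcMeasure (Metric.ball (s : S1) δ)) -
        ∫ x, φ.1 x * c x ∂(arcMeasure (Metric.ball (s : S1) δ)) := by
      rw [← integral_sub (integrable_test_mul φ hp) (integrable_test_mul φ hci)]
      simp only [Pi.sub_apply, mul_sub]
    rw [e2, hc]
    refine e1.trans (le_of_eq ?_)
    rw [← integral_const_mul]
    refine integral_congr_ae (Eventually.of_forall fun x => ?_)
    simp only
    ring) (fun x => by positivity)
  filter_upwards [hmain] with x hx
  rw [Pi.sub_apply] at hx
  have habs := abs_displacement (s : S1) x.1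
  have hdρ : (displacement s x.1 / ε) ^ 2 ≤ (ρ x.1 / ε) ^ 2 := by
    rw [div_pow, div_pow, ← sq_abs (displacement _ _), habs]
    exact div_le_div_of_nonneg_right (pow_le_pow_left₀ (norm_nonneg _) (h.metric.le _) 2)
      (sq_nonneg _)
  have e1 : K * ε * Real.exp (-(κ₁ * (ρ x.1 / ε) ^ 2)) ≤
      K * ε * Real.exp (-(κ₁ * (displacement s x.1 / ε) ^ 2)) :=
    mul_le_mul_of_nonneg_left (Real.exp_le_exp.2
      (neg_le_neg (mul_le_mul_of_nonneg_left hdρ hκ.le))) (by positivity)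
  have e2 : ‖c x - (hermiteFun n (displacement s x.1 / ε) : ℂ)‖ ≤
      H * ((κ₂ - κ₁) * r₀ ^ 2)⁻¹ * ε * Real.exp (-(κ₁ * (displacement s x.1 / ε) ^ 2)) := by
    rw [hc]
    simp only
    split_ifs with hxr
    · rw [sub_self, norm_zero]
      positivity
    · rw [zero_sub, norm_neg, Complex.norm_real]
      refine (hn _).trans ?_
      rw [mul_assoc, mul_assoc]
      refine mul_le_mul_of_nonneg_left ?_ hH
      rw [← mul_assoc]
      refine le_trans ?_ (mul_le_mul_of_nonneg_right
        (exp_neg_div_sq_le (a := (κ₂ - κ₁) * r₀ ^ 2) (by positivity) hε hε1) (Real.exp_pos _).le)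
      rw [← Real.exp_add]
      refine Real.exp_le_exp.2 ?_
      have e3 : r₀ ^ 2 / ε ^ 2 ≤ (displacement s x.1 / ε) ^ 2 := by
        rw [div_pow, ← sq_abs (displacement _ _), habs]
        exact div_le_div_of_nonneg_right (pow_le_pow_left₀ hr.le (not_lt.1 hxr) 2) (sq_nonneg _)
      have e4 := mul_le_mul_of_nonneg_left e3 hκ2.le
      have e5 : (κ₂ - κ₁) * r₀ ^ 2 / ε ^ 2 = (κ₂ - κ₁) * (r₀ ^ 2 / ε ^ 2) := by ring
      rw [e5]
      linarith
  have e3 := norm_sub_le_norm_sub_add_norm_sub (p x) (c x)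
    (hermiteFun n (displacement s x.1 / ε) : ℂ)
  linarith

end StableData

end Core

section Spectrum

namespace StableData

variable {f : C(S1, S1)} {F : ℝ → ℝ} {σ : C(S1, ℝ)} {s δ θ b r₀ D : ℝ} {ρ : S1 → ℝ}
  {m S κ κ₁ κ₂ : ℝ}

lemma dualOperator_densityFunctional (h : StableData f F σ s δ θ b r₀ D ρ m S κ κ₁ κ₂) {ε : ℝ}
    (hε : 0 < ε) {A : GluedSpace κ ε ρ →L[ℂ] GluedSpace κ ε ρ}
    (hA : ∀ G, A G = h.loc ε (arcBlock f σ ε s δ (h.asm hε G))) {μ : ℂ}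
    {p : Metric.ball (s : S1) δ → ℂ} (hp : IsEigendensity (arcBlock f σ ε s δ) μ p) :
    dualOperator A (h.densityFunctional hε hp.1) = μ • h.densityFunctional hε hp.1 := by
  refine ContinuousLinearMap.ext fun G => ?_
  rw [dualOperator_apply, smul_apply, hA, densityFunctional_loc, densityFunctional_apply,
    smul_eq_mul]
  exact hp.2.2 _

lemma densityFunctional_ne_zero (h : StableData f F σ s δ θ b r₀ D ρ m S κ κ₁ κ₂) {ε : ℝ}
    (hε : 0 < ε) {p : Metric.ball (s : S1) δ → ℂ}
    (hp : Integrable p (arcMeasure (Metric.ball (s : S1) δ)))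
    (h0 : ¬ p =ᵐ[arcMeasure (Metric.ball (s : S1) δ)] 0) : h.densityFunctional hε hp ≠ 0 := by
  intro h1
  refine h0 (ae_eq_zero_of_forall_test hp fun φ => ?_)
  rw [← h.densityFunctional_loc hε hp, h1, zero_apply]

/-- Eigenvalues, eigenfunctions and eigendensities of the block for small noise. -/
theorem exists_spectral_estimates (h : StableData f F σ s δ θ b r₀ D ρ m S κ κ₁ κ₂) {r : ℝ}
    (hr : 0 < r) :
    ∃ N : ℕ, (∀ j, N < j → |deriv F s| ^ j < r) ∧ ∃ ε₀ > (0 : ℝ), ∃ q > (0 : ℝ), ∃ K > (0 : ℝ),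
      ∀ ε, 0 < ε → ε < ε₀ →
        (∀ (μ : ℂ) (g : BddMeas (Metric.ball (s : S1) δ)), r < ‖μ‖ → g ≠ 0 →
          arcBlock f σ ε s δ g = μ • g →
            ∃ i : Fin (N + 1), ‖μ - ((deriv F s : ℝ) : ℂ) ^ (i : ℕ)‖ ≤ q * ε) ∧
        ∀ i : Fin (N + 1),
          (∀ (μ₁ μ₂ a : ℂ) (g₁ g₂ : BddMeas (Metric.ball (s : S1) δ)), r < ‖μ₁‖ → r < ‖μ₂‖ →
            ‖μ₁ - ((deriv F s : ℝ) : ℂ) ^ (i : ℕ)‖ ≤ q * ε →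
            ‖μ₂ - ((deriv F s : ℝ) : ℂ) ^ (i : ℕ)‖ ≤ q * ε → g₁ ≠ 0 →
            arcBlock f σ ε s δ g₁ = μ₁ • g₁ → arcBlock f σ ε s δ g₂ = μ₂ • g₂ + a • g₁ →
              ∃ t : ℂ, g₂ = t • g₁) ∧
          (∀ μ : ℂ, r < ‖μ‖ → ‖μ - ((deriv F s : ℝ) : ℂ) ^ (i : ℕ)‖ ≤ q * ε →
            ∀ p, IsEigendensity (arcBlock f σ ε s δ) μ p →
              (∃ a : ℂ, a ≠ 0 ∧ ∀ᵐ x ∂(arcMeasure (Metric.ball (s : S1) δ)),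
                ‖a * p x - (hermiteFun i (displacement s x.1 / ε) : ℂ)‖ ≤
                  K * ε * Real.exp (-(κ₁ * (displacement s x.1 / ε) ^ 2))) ∧
              ∀ p', IsEigendensity (arcBlock f σ ε s δ) μ p' →
                ∃ t : ℂ, ∀ᵐ x ∂(arcMeasure (Metric.ball (s : S1) δ)), p' x = t * p x) := by
  obtain ⟨N, hinj, htail, M, n, hmodel⟩ :=
    exists_mehler_spectralModel h.weight h.metric.abs_deriv_le hr
  refine ⟨N, htail, ?_⟩
  obtain ⟨d, hd, hgap, C, hC, η₀, hη₀, hCd, hC4, hpert⟩ :=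
    SpectralModel.perturbation hinj M hr (n + 1)
  obtain ⟨C₁, hC₁, hglue⟩ := h.exists_glued_operator
  obtain ⟨H, hH, hHi⟩ := h.exists_hermite_constants N
  have hM : 0 < M := zero_lt_one.trans_le hmodel.one_le
  have hκ2 := sub_pos.2 h.mid_lt
  have hr0 := h.metric.radius_pos
  obtain ⟨q, hq⟩ : ∃ q, q = C * C₁ := ⟨_, rfl⟩
  have hq0 : 0 < q := by rw [hq]; positivity
  obtain ⟨K₁, hK₁⟩ : ∃ K₁, K₁ =
    (2 * M * C₁ + 2 * M * (M * q) * C₁ + 2 * M * (M * q) * C₁ / r) / r := ⟨_, rfl⟩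
  have hK₁0 : 0 < K₁ := by rw [hK₁]; positivity
  refine ⟨min 1 (min (η₀ / C₁) (min (1 / (4 * (M * q))) (r / (2 * (M * q))))), by positivity,
    q, hq0, H * K₁ + H * ((κ₂ - κ₁) * r₀ ^ 2)⁻¹, by positivity, fun ε hε hεlt => ?_⟩
  obtain ⟨hε1, hε2, hε3, hε4⟩ : ε < 1 ∧ ε < η₀ / C₁ ∧ ε < 1 / (4 * (M * q)) ∧
      ε < r / (2 * (M * q)) := by
    simpa only [lt_min_iff] using hεlt
  have hη : C₁ * ε ≤ η₀ := by
    rw [lt_div_iff₀ hC₁] at hε2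
    linarith
  have hq4 : M * q * ε ≤ 1 / 4 := by
    rw [lt_div_iff₀ (by positivity)] at hε3
    linarith
  have hqr : M * q * ε ≤ r / 2 := by
    rw [lt_div_iff₀ (by positivity)] at hε4
    linarith
  have hqM : q * ε ≤ M * q * ε := by
    rw [mul_assoc]
    exact le_mul_of_one_le_left (by positivity) hmodel.one_le
  have hCη : C * (C₁ * ε) = q * ε := by rw [hq]; ring
  have hqd : q * ε ≤ d / 4 := by
    rw [← hCη]
    exact (mul_le_mul_of_nonneg_left hη hC.le).trans hCd
  obtain ⟨A, hA, hAsub, hAloc, hA₀loc⟩ := hglue ε hε hε1.le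
  have hX := hmodel.inl (Z := WeightedBdd (fun x : S1 => κ * (ρ x / ε) ^ 2)) hr.le
  obtain ⟨hnear, huniq⟩ := hpert _ _ _ _ hX A (C₁ * ε) hη hAsub
  obtain ⟨hnear', huniq'⟩ := hpert _ _ _ _ hX.dual (dualOperator A) (C₁ * ε) hη (by
    rw [dualOperator_sub]
    exact (norm_dualOperator_le _).trans hAsub)
  rw [hCη] at hnear huniq hnear' huniq'
  have hloc : ∀ φ, A (h.loc ε φ) = h.loc ε (arcBlock f σ ε s δ φ) := fun φ => by
    rw [hA, h.asm_loc]
  have hinjl := h.loc_injective hε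
  refine ⟨fun μ g hμ hg hT => ?_, fun i => ⟨?_, fun μ hμ hμi p hp => ⟨?_, fun p' hp' => ?_⟩⟩⟩
  · obtain ⟨i, hi, -⟩ := hnear μ (h.loc ε g) hμ ((map_ne_zero_iff _ hinjl).2 hg)
      (by rw [hloc, hT, map_smul])
    exact ⟨i, hi⟩
  · intro μ₁ μ₂ a g₁ g₂ hμ₁ hμ₂ hi₁ hi₂ hg₁ hT₁ hT₂
    obtain ⟨t, ht⟩ := huniq i μ₁ μ₂ a (h.loc ε g₁) (h.loc ε g₂) hμ₁ hμ₂ hi₁ hi₂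
      ((map_ne_zero_iff _ hinjl).2 hg₁) (by rw [hloc, hT₁, map_smul])
      (by rw [hloc, hT₂, map_add, map_smul, map_smul])
    exact ⟨t, hinjl (by rw [ht, map_smul])⟩
  · obtain ⟨Λ, hΛ⟩ : ∃ Λ, Λ = h.densityFunctional hε hp.1 := ⟨_, rfl⟩
    have hΛ0 : Λ ≠ 0 := by rw [hΛ]; exact h.densityFunctional_ne_zero hε hp.1 hp.2.1
    have hΛA : dualOperator A Λ = μ • Λ := by
      rw [hΛ]; exact h.dualOperator_densityFunctional hε hA hp
    obtain ⟨i', hi', hclose⟩ := hnear' μ Λ hμ hΛ0 hΛA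
    have hii : i' = i := by
      by_contra hne
      have e1 := hgap i' i hne
      have e2 := norm_sub_le_norm_sub_add_norm_sub (((deriv F s : ℝ) : ℂ) ^ (i' : ℕ)) μ
        (((deriv F s : ℝ) : ℂ) ^ (i : ℕ))
      rw [norm_sub_rev] at hi'
      linarith
    subst hii
    obtain ⟨a, ha⟩ : ∃ a, a = Λ (hermiteVec h.weight i', 0) := ⟨_, rfl⟩
    obtain ⟨l, hl⟩ : ∃ l : GluedSpace κ ε ρ →L[ℂ] ℂ, l = hermiteFunctional h.weight i' ∘L
      ContinuousLinearMap.fst ℂ (GaussBdd κ) (WeightedBdd fun x : S1 => κ * (ρ x / ε) ^ 2) :=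
      ⟨_, rfl⟩
    have hclose' : ‖Λ - a • l‖ ≤ M * q * ε * ‖Λ‖ := by
      rw [ha, hl]
      exact hclose.trans (mul_le_mul_of_nonneg_right hqM (norm_nonneg _))
    obtain ⟨hΛa, htest⟩ := hX.norm_functional_sub_le (A := A) (Λ := Λ) (a := a) (i := i') (μ := μ)
      (q := M * q) (ε := ε) (C := C₁) hr hq4 hqr hμ (hi'.trans hqM) (fun g => by
        rw [← dualOperator_apply, hΛA, smul_apply, smul_eq_mul]) (by rw [← hl]; exact hclose')
    have ha0 : a ≠ 0 := by
      rintro rfl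
      rw [norm_zero, mul_zero] at hΛa
      exact hΛ0 (norm_le_zero_iff.1 hΛa)
    have hν := hermiteNormSq_pos i'
    have hνc : (hermiteNormSq i' : ℂ) ≠ 0 := Complex.ofReal_ne_zero.2 hν.ne'
    have hεc : (ε : ℂ) ≠ 0 := Complex.ofReal_ne_zero.2 hε.ne'
    refine ⟨ε * hermiteNormSq i' / a, div_ne_zero (mul_ne_zero hεc hνc) ha0, ?_⟩
    refine h.ae_density_close hε hε1.le (by positivity) hH.le (hHi i').2
      (hp.1.const_mul (ε * hermiteNormSq i' / a)) fun φ => ?_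
    have e1 := htest (h.loc ε φ) _ (hAloc φ) (hA₀loc φ)
    have hmass := h.mass_nonneg hε φ
    have e2 : ∫ x, φ.1 x * (ε * hermiteNormSq i' / a * p x)
        ∂(arcMeasure (Metric.ball (s : S1) δ)) = ε * hermiteNormSq i' / a * Λ (h.loc ε φ) := by
      rw [hΛ, densityFunctional_loc, ← integral_const_mul]
      refine integral_congr_ae (Eventually.of_forall fun x => ?_)
      simp only
      ring
    have e3 : (ε : ℂ) * ∫ u, (h.loc ε φ).1 u * (hermiteFun i' u : ℂ) =
        ε * hermiteNormSq i' / a * (a * (hermiteFunctional h.weight i' ∘L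
          ContinuousLinearMap.fst ℂ (GaussBdd κ) (WeightedBdd fun x : S1 => κ * (ρ x / ε) ^ 2))
          (h.loc ε φ)) := by
      rw [ContinuousLinearMap.comp_apply, ContinuousLinearMap.coe_fst', hermiteFunctional_apply]
      field_simp
    rw [e2, e3, ← mul_sub, norm_mul, norm_div, norm_mul, Complex.norm_real, Complex.norm_real,
      Real.norm_of_nonneg hε.le, Real.norm_of_nonneg hν.le]
    refine (mul_le_mul_of_nonneg_left e1 (by positivity)).trans ?_
    have hna : 0 < ‖a‖ := norm_pos_iff.2 ha0
    rw [← hK₁]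
    have e4 : ε * hermiteNormSq i' / ‖a‖ * (K₁ * ε * ‖a‖ * h.mass ε φ) =
        hermiteNormSq i' * (K₁ * ε * (ε * h.mass ε φ)) := by
      field_simp
    rw [e4]
    calc _ ≤ H * (K₁ * ε * (ε * h.mass ε φ)) :=
          mul_le_mul_of_nonneg_right (hHi i').1 (by positivity)
      _ = _ := by ring
  · obtain ⟨t, ht⟩ := huniq' i μ μ 0 (h.densityFunctional hε hp.1) (h.densityFunctional hε hp'.1)
      hμ hμ hμi hμi (h.densityFunctional_ne_zero hε hp.1 hp.2.1)
      (h.dualOperator_densityFunctional hε hA hp)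
      (by
        rw [h.dualOperator_densityFunctional hε hA hp']
        exact ContinuousLinearMap.ext fun G => by
          simp only [add_apply, smul_apply, zero_smul, add_zero])
    refine ⟨t, ?_⟩
    have e1 := ae_eq_zero_of_forall_test (hp'.1.sub (hp.1.const_mul t)) fun φ => by
      have e2 : ∫ x, φ.1 x * (p' - fun x => t * p x) x ∂(arcMeasure (Metric.ball (s : S1) δ)) =
          ∫ x, φ.1 x * p' x ∂(arcMeasure (Metric.ball (s : S1) δ)) -
          t * ∫ x, φ.1 x * p x ∂(arcMeasure (Metric.ball (s : S1) δ)) := by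
        rw [← integral_const_mul, ← integral_sub (integrable_test_mul φ hp'.1)
          ((integrable_test_mul φ hp.1).const_mul t)]
        refine integral_congr_ae (Eventually.of_forall fun x => ?_)
        simp only [Pi.sub_apply]
        ring
      rw [e2, ← h.densityFunctional_loc hε hp'.1, ← h.densityFunctional_loc hε hp.1, ht,
        smul_apply, smul_eq_mul, sub_self]
    filter_upwards [e1] with x hx
    rw [Pi.sub_apply, Pi.zero_apply, sub_eq_zero] at hx
    exact hx

end StableData

end Spectrum

section Main

namespace StableData

variable {f : C(S1, S1)} {F : ℝ → ℝ} {σ : C(S1, ℝ)} {s δ θ b r₀ D : ℝ} {ρ : S1 → ℝ}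
  {m S κ κ₁ κ₂ : ℝ}

/-- The expansion of eigenvalues and eigendensities, in the normalised case. -/
theorem exists_expansion (h : StableData f F σ s δ θ b r₀ D ρ m S κ κ₁ κ₂) {r : ℝ}
    (hr : 0 < r) :
    ∃ εr > (0 : ℝ), ∃ L > (0 : ℝ), ∃ K > (0 : ℝ), ∀ ε : ℝ, 0 < ε → ε < εr →
      ∃ (l : ℕ → ℂ) (ψ : ℕ → ℝ → ℂ),
        (∀ j, ‖l j‖ ≤ L) ∧
        (∀ j (x : ℝ), ‖ψ j x‖ * Real.exp (κ₁ * x ^ 2) ≤ K) ∧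
        (∀ μ : ℂ, (arcBlock f σ ε s δ).HasEigenvalue μ → r < ‖μ‖ →
          IsSimpleEigenvalue (arcBlock f σ ε s δ) μ ∧
            ∃ j : ℕ, μ = ((deriv F s : ℝ) : ℂ) ^ j + (ε : ℂ) * l j) ∧
        (∀ (j : ℕ) (μ : ℂ), μ = ((deriv F s : ℝ) : ℂ) ^ j + (ε : ℂ) * l j →
          (arcBlock f σ ε s δ).HasEigenvalue μ → r < ‖μ‖ →
            ∀ φ : Metric.ball (s : S1) δ → ℂ, IsEigendensity (arcBlock f σ ε s δ) μ φ →
              ∃ a : ℂ, ∀ᵐ x ∂(arcMeasure (Metric.ball (s : S1) δ)),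
                φ x = a * ((hermiteFun j (displacement (s : S1) x / ε) : ℝ)
                    + (ε : ℂ) * ψ j (displacement (s : S1) x / ε))) := by
  obtain ⟨N, htail, ε₀, hε₀, q, hq, K, hK, hest⟩ := h.exists_spectral_estimates hr
  refine ⟨ε₀, hε₀, q, hq, K, hK, fun ε hε hεlt => ?_⟩
  obtain ⟨hnear, hest⟩ := hest ε hε hεlt
  have hεc : (ε : ℂ) ≠ 0 := Complex.ofReal_ne_zero.2 hε.ne'
  obtain ⟨T, hT⟩ : ∃ T, T = arcBlock f σ ε s δ := ⟨_, rfl⟩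
  obtain ⟨c, hc⟩ : ∃ c : ℂ, c = ((deriv F s : ℝ) : ℂ) := ⟨_, rfl⟩
  rw [← hT] at hnear hest ⊢
  rw [← hc] at hnear hest ⊢
  have heq : ∀ (i : Fin (N + 1)) (μ₁ μ₂ : ℂ), T.HasEigenvalue μ₁ → T.HasEigenvalue μ₂ →
      r < ‖μ₁‖ → r < ‖μ₂‖ → ‖μ₁ - c ^ (i : ℕ)‖ ≤ q * ε → ‖μ₂ - c ^ (i : ℕ)‖ ≤ q * ε →
      μ₁ = μ₂ := by
    intro i μ₁ μ₂ h₁ h₂ hr₁ hr₂ hi₁ hi₂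
    obtain ⟨g₁, hg₁⟩ := h₁.exists_hasEigenvector
    obtain ⟨g₂, hg₂⟩ := h₂.exists_hasEigenvector
    obtain ⟨t, ht⟩ := (hest i).1 μ₁ μ₂ 0 g₁ g₂ hr₁ hr₂ hi₁ hi₂ hg₁.2 hg₁.apply_eq_smul
      (by rw [hg₂.apply_eq_smul, zero_smul, add_zero])
    have e1 : μ₁ • g₂ = μ₂ • g₂ := by
      rw [← hg₂.apply_eq_smul, ht, map_smul, hg₁.apply_eq_smul, smul_comm]
    exact smul_left_injective ℂ hg₂.2 e1
  have hl : ∀ j : ℕ, ∃ lj : ℂ, ‖lj‖ ≤ q ∧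
      ((∃ μ, j ≤ N ∧ T.HasEigenvalue μ ∧ r < ‖μ‖ ∧ ‖μ - c ^ j‖ ≤ q * ε ∧ μ = c ^ j + ε * lj) ∨
        lj = 0 ∧ ∀ μ, j ≤ N → T.HasEigenvalue μ → r < ‖μ‖ → ¬ ‖μ - c ^ j‖ ≤ q * ε) := by
    intro j
    by_cases hj : ∃ μ, j ≤ N ∧ T.HasEigenvalue μ ∧ r < ‖μ‖ ∧ ‖μ - c ^ j‖ ≤ q * ε
    · obtain ⟨μ, h1, h2, h3, h4⟩ := hj
      refine ⟨(μ - c ^ j) / ε, ?_, Or.inl ⟨μ, h1, h2, h3, h4, ?_⟩⟩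
      · rw [norm_div, Complex.norm_real, Real.norm_of_nonneg hε.le, div_le_iff₀ hε]
        exact h4
      · rw [mul_div_cancel₀ _ hεc, add_sub_cancel]
    · exact ⟨0, by simpa using hq.le, Or.inr ⟨rfl, fun μ h1 h2 h3 h4 => hj ⟨μ, h1, h2, h3, h4⟩⟩⟩
  choose l hlq hl using hl
  have hlnear : ∀ (j : ℕ) (μ : ℂ), μ = c ^ j + ε * l j → T.HasEigenvalue μ → r < ‖μ‖ →
      j ≤ N ∧ ‖μ - c ^ j‖ ≤ q * ε := by
    intro j μ hμ hev hrμ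
    rcases hl j with ⟨μ', h1, -, -, h4, h5⟩ | ⟨h1, h2⟩
    · rw [hμ, ← h5]
      exact ⟨h1, h4⟩
    · rw [h1, mul_zero, add_zero] at hμ
      rcases le_or_gt j N with hj | hj
      · exact absurd (by rw [hμ, sub_self, norm_zero]; positivity) (h2 μ hj hev hrμ)
      · have := htail j hj
        rw [hμ, hc, norm_pow, Complex.norm_real, Real.norm_eq_abs] at hrμ
        linarith
  have hψ : ∀ j : ℕ, ∃ ψ : ℝ → ℂ, (∀ x, ‖ψ x‖ * Real.exp (κ₁ * x ^ 2) ≤ K) ∧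
      ∀ μ : ℂ, μ = c ^ j + ε * l j → T.HasEigenvalue μ → r < ‖μ‖ →
        ∀ φ : Metric.ball (s : S1) δ → ℂ, IsEigendensity T μ φ →
          ∃ a : ℂ, ∀ᵐ x ∂(arcMeasure (Metric.ball (s : S1) δ)),
            φ x = a * ((hermiteFun j (displacement (s : S1) x / ε) : ℝ)
              + (ε : ℂ) * ψ (displacement (s : S1) x / ε)) := by
    intro j
    by_cases hex : (T.HasEigenvalue (c ^ j + ε * l j) ∧ r < ‖c ^ j + ε * l j‖) ∧
        ∃ p, IsEigendensity T (c ^ j + ε * l j) p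
    · obtain ⟨⟨hev, hrμ⟩, p, hp⟩ := hex
      obtain ⟨hjN, hj⟩ := hlnear j _ rfl hev hrμ
      obtain ⟨⟨a, ha0, ha⟩, hmul⟩ := (hest ⟨j, Nat.lt_succ_of_le hjN⟩).2 _ hrμ hj p hp
      obtain ⟨v, hv⟩ : ∃ v : ℝ → ℂ, v = fun u =>
        (a * extendZero (Metric.ball (s : S1) δ) p ((s : S1) + ((ε * u : ℝ) : S1)) -
          (hermiteFun j u : ℂ)) / ε := ⟨_, rfl⟩
      refine ⟨fun u => if ‖v u‖ * Real.exp (κ₁ * u ^ 2) ≤ K then v u else 0, fun u => ?_, ?_⟩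
      · simp only
        split_ifs with hu
        · exact hu
        · rw [norm_zero, zero_mul]
          exact hK.le
      · rintro μ rfl - - φ hφ
        obtain ⟨t, ht⟩ := hmul φ hφ
        refine ⟨t * a⁻¹, ?_⟩
        filter_upwards [ha, ht] with x hax htx
        have hvx : v (displacement s x.1 / ε) =
            (a * p x - (hermiteFun j (displacement s x.1 / ε) : ℂ)) / ε := by
          rw [hv]
          simp only
          rw [mul_div_cancel₀ _ hε.ne', coe_displacement, extendZero_apply]
        have hb : ‖v (displacement s x.1 / ε)‖ *
            Real.exp (κ₁ * (displacement s x.1 / ε) ^ 2) ≤ K := by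
          rw [hvx, norm_div, Complex.norm_real, Real.norm_of_nonneg hε.le, div_mul_eq_mul_div,
            div_le_iff₀ hε]
          refine (mul_le_mul_of_nonneg_right hax (Real.exp_pos _).le).trans (le_of_eq ?_)
          rw [mul_assoc, ← Real.exp_add, neg_add_cancel, Real.exp_zero, mul_one]
        rw [if_pos hb, hvx, mul_div_cancel₀ _ hεc, add_sub_cancel, htx, mul_assoc,
          inv_mul_cancel_left₀ ha0]
    · refine ⟨0, fun x => by simpa using hK.le, ?_⟩
      rintro μ rfl hev hrμ φ hφ
      exact absurd ⟨⟨hev, hrμ⟩, φ, hφ⟩ hex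
  choose ψ hψK hψ using hψ
  refine ⟨l, ψ, hlq, hψK, fun μ hev hrμ => ?_, fun j μ => hψ j μ⟩
  obtain ⟨g, hg⟩ := hev.exists_hasEigenvector
  obtain ⟨i, hi⟩ := hnear μ g hrμ hg.2 hg.apply_eq_smul
  refine ⟨⟨hev, Module.End.finrank_maxGenEigenspace_eq_one hg.2 (fun a g₂ hg₂ => ?_)
    hg.apply_eq_smul⟩, i, ?_⟩
  · exact (hest i).1 μ μ a g g₂ hrμ hrμ hi hi hg.2 hg.apply_eq_smul hg₂
  · rcases hl i with ⟨μ', -, h2, h3, h4, h5⟩ | ⟨-, h2⟩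
    · rw [← h5]
      exact heq i μ μ' hev h2 hrμ h3 hi h4
    · exact absurd hi (h2 μ (Nat.le_of_lt_succ i.2) hev hrμ)

end StableData

lemma exists_noise_bounds (σ : C(S1, ℝ)) (hσ : ∀ x, 0 < σ x) :
    ∃ m S : ℝ, 0 < m ∧ (∀ x, m ≤ σ x) ∧ ∀ x, σ x ≤ S := by
  obtain ⟨x₀, -, hx₀⟩ := isCompact_univ.exists_isMinOn Set.univ_nonempty σ.continuous.continuousOn
  obtain ⟨x₁, -, hx₁⟩ := isCompact_univ.exists_isMaxOn Set.univ_nonempty σ.continuous.continuousOn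
  exact ⟨σ x₀, σ x₁, hσ x₀, fun x => hx₀ (Set.mem_univ x), fun x => hx₁ (Set.mem_univ x)⟩

/-- Admissible weight exponents exist for any stable fixed point in normalised form. -/
lemma exists_stableData {f : C(S1, S1)} {F : ℝ → ℝ} {σ : C(S1, ℝ)} {s δ θ b r₀ D : ℝ}
    {ρ : S1 → ℝ} (hM : AdaptedMetric f F σ s δ θ b r₀ D ρ)
    (hfF : ∀ t : ℝ, f (t : S1) = (F t : S1)) (hs : f (s : S1) = (s : S1))
    (hσ : ∀ x, 0 < σ x) (hv : σ (s : S1) ^ 2 = (1 - deriv F s ^ 2) / 2) :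
    ∃ m S κ κ₁ κ₂ : ℝ, StableData f F σ s δ θ b r₀ D ρ m S κ κ₁ κ₂ := by
  obtain ⟨m, S, hm, hmσ, hσS⟩ := exists_noise_bounds σ hσ
  have hS : 0 < S := (hσ 0).trans_le (hσS 0)
  have hb : 0 < b := zero_lt_one.trans_le hM.one_le
  have hθ0 := hM.theta_pos
  have hθ : 0 < 1 - θ := sub_pos.2 hM.theta_lt
  obtain ⟨κ₂, hκ₂⟩ : ∃ κ₂, κ₂ = min ((1 - θ) / 2) ((1 - θ) / (8 * S ^ 2 * b ^ 2)) := ⟨_, rfl⟩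
  have h0 : 0 < κ₂ := by rw [hκ₂]; positivity
  have h1 : κ₂ ≤ (1 - θ) / 2 := by rw [hκ₂]; exact min_le_left _ _
  have h2 : κ₂ ≤ (1 - θ) / (8 * S ^ 2 * b ^ 2) := by rw [hκ₂]; exact min_le_right _ _
  have h3 : 0 < (1 - θ) * κ₂ := mul_pos hθ h0
  have h4 : 0 < θ * κ₂ := mul_pos hθ0 h0
  refine ⟨m, S, θ * κ₂ + (1 - θ) * κ₂ / 3, θ * κ₂ + (1 - θ) * κ₂ * 2 / 3, κ₂, hM,
    ⟨hθ0, hM.theta_lt, by linarith, by linarith, by linarith, h1⟩, by linarith, by linarith, hfF, hs,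
    hm, hmσ, hσS, hv, ?_⟩
  rw [le_div_iff₀ (by positivity)] at h2
  rw [div_le_div_iff₀ hθ (by positivity)]
  linarith

lemma arcBlock_rescale (f : C(S1, S1)) {σ σ' : C(S1, ℝ)} {ε ε' : ℝ}
    (h : ∀ x, ε * σ x = ε' * σ' x) (x₀ : S1) (δ : ℝ) :
    arcBlock f σ ε x₀ δ = arcBlock f σ' ε' x₀ δ := by
  ext φ x
  change transition f σ ε _ _ = transition f σ' ε' _ _
  simp only [transition, h]

theorem theorem4
    -- a smooth circle map `f`, given with a smooth lift `F`, so that `f'(t mod 2π) = F'(t)`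
    (f : C(S1, S1)) (F : ℝ → ℝ) (hF : ContDiff ℝ ∞ F)
    (hfF : ∀ t : ℝ, f (t : S1) = (F t : S1))
    -- the smooth positive noise amplitude
    (σ : C(S1, ℝ)) (hσ : ContDiff ℝ ∞ (fun t : ℝ => σ (t : S1))) (hσpos : ∀ x, 0 < σ x)
    -- the stable fixed point `s mod 2π` and the unstable fixed point `u mod 2π`
    (s u : ℝ) (hs : f (s : S1) = (s : S1)) (hu : f (u : S1) = (u : S1))
    (hcs : |deriv F s| < 1) (hcu : 1 < |deriv F u|)
    (hattr : ∀ x : S1, x ≠ (u : S1) → Tendsto (fun n : ℕ => f^[n] x) atTop (𝓝 (s : S1)))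
    -- the neighbourhood `V₃ = B_δ(x_s)`, which `f` maps into itself with a margin `η`
    (δ η : ℝ) (hδ : 0 < δ) (hη : 0 < η) (huV : (u : S1) ∉ Metric.ball (s : S1) δ)
    (hV : ∀ x ∈ Metric.ball (s : S1) δ, η < Metric.infDist (f x) (Metric.ball (s : S1) δ)ᶜ) :
    ∃ k > (0 : ℝ), ∀ r > (0 : ℝ), ∃ εr > (0 : ℝ), ∃ L > (0 : ℝ), ∃ K > (0 : ℝ),
      ∀ ε : ℝ, 0 < ε → ε < εr →
        ∃ (l : ℕ → ℂ) (ψ : ℕ → ℝ → ℂ),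
          (∀ j, ‖l j‖ ≤ L) ∧
          (∀ j (x : ℝ), ‖ψ j x‖ * Real.exp (k * x ^ 2) ≤ K) ∧
          (∀ μ : ℂ, (arcBlock f σ ε s δ).HasEigenvalue μ → r < ‖μ‖ →
            IsSimpleEigenvalue (arcBlock f σ ε s δ) μ ∧
              ∃ j : ℕ, μ = ((deriv F s : ℝ) : ℂ) ^ j + (ε : ℂ) * l j) ∧
          (∀ (j : ℕ) (μ : ℂ), μ = ((deriv F s : ℝ) : ℂ) ^ j + (ε : ℂ) * l j →
            (arcBlock f σ ε s δ).HasEigenvalue μ → r < ‖μ‖ →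
              ∀ φ : Metric.ball (s : S1) δ → ℂ, IsEigendensity (arcBlock f σ ε s δ) μ φ →
                ∃ a : ℂ, ∀ᵐ x ∂(arcMeasure (Metric.ball (s : S1) δ)),
                  φ x = a *
                    ((hermiteFun j (Real.sqrt ((1 - deriv F s ^ 2) / (2 * σ (s : S1) ^ 2)) *
                        displacement (s : S1) x / ε) : ℝ)
                      + (ε : ℂ) * ψ j (displacement (s : S1) x / ε))) := by
  have hc := one_sub_sq_pos hcs
  have hσs := hσpos (s : S1)
  obtain ⟨α, hα⟩ : ∃ α, α = Real.sqrt ((1 - deriv F s ^ 2) / (2 * σ (s : S1) ^ 2)) := ⟨_, rfl⟩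
  rw [← hα]
  have hα0 : 0 < α := by rw [hα]; positivity
  have hα2 : α ^ 2 = (1 - deriv F s ^ 2) / (2 * σ (s : S1) ^ 2) := by
    rw [hα, Real.sq_sqrt (by positivity)]
  have hαc : (α : ℂ) ≠ 0 := Complex.ofReal_ne_zero.2 hα0.ne'
  obtain ⟨τ, hτ⟩ : ∃ τ : C(S1, ℝ), ∀ x, τ x = α * σ x :=
    ⟨⟨fun x => α * σ x, by fun_prop⟩, fun _ => rfl⟩
  obtain ⟨θ, b, r₀, D, ρ, hM⟩ := exists_adaptedMetric f F hF hfF τ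
    (by simp only [hτ]; exact contDiff_const.mul hσ) s u hs hcs hattr δ η hδ hη huV hV
  obtain ⟨m, S, κ, κ₁, κ₂, h⟩ := exists_stableData hM hfF hs
    (fun x => by rw [hτ]; exact mul_pos hα0 (hσpos x)) (by
      rw [hτ, mul_pow, hα2]
      field_simp)
  have hκ := h.mid_pos
  refine ⟨κ₁ * α ^ 2, by positivity, fun r hr => ?_⟩
  obtain ⟨εr, hεr, L, hL, K, hK, hexp⟩ := h.exists_expansion hr
  refine ⟨α * εr, by positivity, L / α, by positivity, K / α, by positivity, fun ε hε hεlt => ?_⟩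
  obtain ⟨l, ψ, hl, hψ, hev, hden⟩ := hexp (ε / α) (by positivity)
    (by rw [div_lt_iff₀ hα0]; linarith)
  rw [arcBlock_rescale f (σ' := σ) (ε' := ε) (fun x => by rw [hτ]; field_simp)] at hev hden
  have hε' : ∀ z : ℂ, ((ε / α : ℝ) : ℂ) * z = ε * (z / α) := fun z => by
    push_cast
    field_simp
  refine ⟨fun j => l j / α, fun j x => ψ j (α * x) / α, fun j => ?_, fun j x => ?_,
    fun μ h1 h2 => ?_, fun j μ h1 h2 h3 φ hφ => ?_⟩
  · rw [norm_div, Complex.norm_real, Real.norm_of_nonneg hα0.le]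
    exact div_le_div_of_nonneg_right (hl j) hα0.le
  · rw [norm_div, Complex.norm_real, Real.norm_of_nonneg hα0.le, div_mul_eq_mul_div]
    refine div_le_div_of_nonneg_right ?_ hα0.le
    have := hψ j (α * x)
    rwa [mul_pow, ← mul_assoc] at this
  · obtain ⟨h3, j, hj⟩ := hev μ h1 h2
    exact ⟨h3, j, by rw [hj, hε']⟩
  · obtain ⟨a, ha⟩ := hden j μ (by rw [h1, hε']) h2 h3 φ hφ
    refine ⟨a, ?_⟩
    filter_upwards [ha] with x hx
    have e1 : displacement (s : S1) x / (ε / α) = α * displacement (s : S1) x / ε := by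
      field_simp
    rw [hx, hε', e1, mul_div_assoc α]

end Main
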